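/- **Setting.** Let $M$ be a smooth (Hausdorff) manifold of dimension $2n$ with a Fedosov structure: a symplectic form $J_{ab}$ together with a smooth torsion-free connection $\nabla_a$ on the tangent bundle (and hence on all tensor bundles) such that $\nabla_aJ_{bc}=0$. Let $J^{ab}$ be the inverse of $J_{ab}$, normalised by $J_{ab}J^{ac}=\delta_b{}^c$. The curvature $R_{ab}{}^c{}_d$ of $\nabla_a$ is given by $(\nabla_a\nabla_b-\nabla_b\nabla_a)X^c=R_{ab}{}^c{}_dX^d$. Put $\Phi_{bd}=\frac1{2(n+1)}R_{ab}{}^a{}_d$ and define $V_{ab}{}^c{}_d$ by $$R_{ab}{}^c{}_d=V_{ab}{}^c{}_d+\delta_a{}^c\Phi_{bd}-\delta_b{}^c\Phi_{ad}+J_{ad}\Phi_{be}J^{ce}-J_{bd}\Phi_{ae}J^{ce}+2J_{ab}\Phi_{de}J^{ce}.$$ Put $$S_a=\tfrac1{2n+1}J^{bc}\nabla_c\Phi_{ab},\qquad Y_{abd}=\tfrac1{2n+1}\nabla_cV_{ab}{}^c{}_d.$$ The standard tractor bundle is $\mathcal T=\Lambda^0\oplus\Lambda^1\oplus\Lambda^0$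 (of rank $2n+2$), with the tractor connection $$\nabla_a\begin{bmatrix}\sigma\\ \mu_b\\ \rho\end{bmatrix}=\begin{bmatrix}\nabla_a\sigma-\mu_a\\ \nabla_a\mu_b+J_{ab}\rho+\Phi_{ab}\sigma\\ \nabla_a\rho-\Phi_{ab}J^{bc}\mu_c+S_a\sigma\end{bmatrix}.$$ **Proposition.** The skew form on $\mathcal T$ $$\left\langle\begin{bmatrix}\sigma\\ \mu_b\\ \rho\end{bmatrix},\begin{bmatrix}\tilde\sigma\\ \tilde\mu_c\\ \tilde\rho\end{bmatrix}\right\rangle=\sigma\tilde\rho+J^{bc}\mu_b\tilde\mu_c-\rho\tilde\sigma$$ is non-degenerate and is preserved by the tractor connection: $\nabla_a\langle s,t\rangle=\langle\nabla_as,t\rangle+\langle s,\nabla_at\rangle$ for all smooth sections $s,t$ of $\mathcal T$. For every smooth section of $\mathcal T$, the curvature of the tractor connection is given by $$(\nabla_a\nabla_b-\nabla_b\nabla_a)\begin{bmatrix}\sigma\\ \mu_d\\ \rho\end{bmatrix}=\begin{bmatrix}0\\ -V_{ab}{}^c{}_d\mu_c+Y_{abd}\sigma\\ -Y_{abc}J^{cd}\mu_d+\frac1{2n}\big(J^{cd}V_{ab}{}^e{}_c\Phi_{de}-J^{cd}\nabla_cY_{abd}\big)\sigma\end{bmatrix}+2J_{ab}\begin{bmatrix}\rho\\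 J^{ce}\Phi_{cd}\mu_e-S_d\sigma\\ S_cJ^{cd}\mu_d+\frac1{2n}J^{cd}\big(\nabla_cS_d-J^{ef}\Phi_{ce}\Phi_{df}\big)\sigma\end{bmatrix}.$$ (On the left, the two derivatives are formed with the tractor connection coupled to $\nabla_a$. If $n=0$, the terms with $\frac1{2n}$ are read as $0$.) -/

import Mathlib

open Bundle
open scoped Manifold ContDiff Topology

/-! ### The bundle of homomorphisms between two vector bundles -/

noncomputable section

/-- The normed space `F →L[ℝ] F'`, sealed in a definition (see `HomBundle`). -/
def HomFiber (F F' : Type*) [NormedAddCommGroup F] [NormedSpace ℝ F] [NormedAddCommGroup F']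
    [NormedSpace ℝ F'] : Type _ := F →L[ℝ] F'

section HomFiber

variable (F F' : Type*) [NormedAddCommGroup F] [NormedSpace ℝ F] [NormedAddCommGroup F']
    [NormedSpace ℝ F']

instance : NormedAddCommGroup (HomFiber F F') := inferInstanceAs (NormedAddCommGroup (F →L[ℝ] F'))

instance : NormedSpace ℝ (HomFiber F F') := inferInstanceAs (NormedSpace ℝ (F →L[ℝ] F'))

instance [FiniteDimensional ℝ F] [FiniteDimensional ℝ F'] : FiniteDimensional ℝ (HomFiber F F') :=
  inferInstanceAs (FiniteDimensional ℝ (F →L[ℝ] F'))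

end HomFiber

section HomBundle

variable {B : Type*} {V V' : B → Type*}
  [∀ x, AddCommGroup (V x)] [∀ x, Module ℝ (V x)] [∀ x, TopologicalSpace (V x)]
  [∀ x, AddCommGroup (V' x)] [∀ x, Module ℝ (V' x)] [∀ x, TopologicalSpace (V' x)]

variable (V V') in
/-- The family of spaces `Hom(V_x, V'_x)`.  This is Mathlib's bundle `fun x ↦ V x →L[ℝ] V' x`,
sealed in a definition so that iterated bundles of homomorphisms (tensor bundles) have a
well-behaved instance search. -/
def HomBundle (x : B) : Type _ := V x →L[ℝ] V' x

namespace HomBundle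

instance (x : B) : FunLike (HomBundle V V' x) (V x) (V' x) :=
  inferInstanceAs (FunLike (V x →L[ℝ] V' x) (V x) (V' x))

instance (x : B) : ContinuousLinearMapClass (HomBundle V V' x) ℝ (V x) (V' x) :=
  inferInstanceAs (ContinuousLinearMapClass (V x →L[ℝ] V' x) ℝ (V x) (V' x))

@[ext] theorem ext {x : B} {A A' : HomBundle V V' x} (h : ∀ v, A v = A' v) : A = A' :=
  ContinuousLinearMap.ext h

variable [∀ x, IsTopologicalAddGroup (V' x)] [∀ x, ContinuousSMul ℝ (V' x)]

instance (x : B) : TopologicalSpace (HomBundle V V' x) :=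
  inferInstanceAs (TopologicalSpace (V x →L[ℝ] V' x))

instance (x : B) : AddCommGroup (HomBundle V V' x) :=
  inferInstanceAs (AddCommGroup (V x →L[ℝ] V' x))

instance (x : B) : Module ℝ (HomBundle V V' x) :=
  inferInstanceAs (Module ℝ (V x →L[ℝ] V' x))

instance (x : B) : IsTopologicalAddGroup (HomBundle V V' x) :=
  inferInstanceAs (IsTopologicalAddGroup (V x →L[ℝ] V' x))

instance (x : B) : ContinuousSMul ℝ (HomBundle V V' x) :=
  inferInstanceAs (ContinuousSMul ℝ (V x →L[ℝ] V' x))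

@[simp] theorem add_apply {x : B} (A A' : HomBundle V V' x) (v : V x) :
    (A + A') v = A v + A' v := rfl

@[simp] theorem sub_apply {x : B} (A A' : HomBundle V V' x) (v : V x) :
    (A - A') v = A v - A' v := rfl

@[simp] theorem neg_apply {x : B} (A : HomBundle V V' x) (v : V x) : (-A) v = -A v := rfl

@[simp] theorem smul_apply {x : B} (c : ℝ) (A : HomBundle V V' x) (v : V x) :
    (c • A) v = c • A v := rfl

@[simp] theorem zero_apply {x : B} (v : V x) : (0 : HomBundle V V' x) v = 0 := rfl

instance (x : B) [FiniteDimensional ℝ (V x)] [FiniteDimensional ℝ (V' x)]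
    [IsTopologicalAddGroup (V x)] [ContinuousSMul ℝ (V x)] [T2Space (V x)] :
    FiniteDimensional ℝ (HomBundle V V' x) :=
  inferInstanceAs (FiniteDimensional ℝ (V x →L[ℝ] V' x))

instance (x : B) [ContinuousSMul ℝ (V x)] [T2Space (V' x)] : T2Space (HomBundle V V' x) :=
  inferInstanceAs (T2Space (V x →L[ℝ] V' x))

/-- The linear map underlying an element of `Hom(V_x, V'_x)`. -/
def toLinear {x : B} (A : HomBundle V V' x) : V x →ₗ[ℝ] V' x :=
  ContinuousLinearMap.toLinearMap (show V x →L[ℝ] V' x from A)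

@[simp] theorem toLinear_apply {x : B} (A : HomBundle V V' x) (v : V x) : A.toLinear v = A v := rfl

/-- On finite-dimensional fibres, an element of `Hom(V_x, V'_x)` is just a linear map. -/
def ofLinear {x : B} [IsTopologicalAddGroup (V x)] [ContinuousSMul ℝ (V x)]
    [FiniteDimensional ℝ (V x)] [T2Space (V x)] (f : V x →ₗ[ℝ] V' x) : HomBundle V V' x :=
  LinearMap.toContinuousLinearMap f

@[simp] theorem ofLinear_apply {x : B} [IsTopologicalAddGroup (V x)] [ContinuousSMul ℝ (V x)]
    [FiniteDimensional ℝ (V x)] [T2Space (V x)] (f : V x →ₗ[ℝ] V' x) (v : V x) :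
    ofLinear f v = f v := rfl

variable [TopologicalSpace B]
  {F : Type*} [NormedAddCommGroup F] [NormedSpace ℝ F] [TopologicalSpace (TotalSpace F V)]
  [FiberBundle F V] [VectorBundle ℝ F V]
  {F' : Type*} [NormedAddCommGroup F'] [NormedSpace ℝ F'] [TopologicalSpace (TotalSpace F' V')]
  [FiberBundle F' V'] [VectorBundle ℝ F' V']

instance : TopologicalSpace (TotalSpace (HomFiber F F') (HomBundle V V')) :=
  inferInstanceAs (TopologicalSpace (TotalSpace (F →L[ℝ] F') (fun x ↦ V x →L[ℝ] V' x)))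

instance : FiberBundle (HomFiber F F') (HomBundle V V') :=
  inferInstanceAs (FiberBundle (F →L[ℝ] F') (fun x ↦ V x →L[ℝ] V' x))

instance : VectorBundle ℝ (HomFiber F F') (HomBundle V V') :=
  inferInstanceAs (VectorBundle ℝ (F →L[ℝ] F') (fun x ↦ V x →L[ℝ] V' x))

instance {EB : Type*} [NormedAddCommGroup EB] [NormedSpace ℝ EB] {HB : Type*} [TopologicalSpace HB]
    {IB : ModelWithCorners ℝ EB HB} [ChartedSpace HB B] {n : WithTop ℕ∞}
    [ContMDiffVectorBundle n F V IB] [ContMDiffVectorBundle n F' V' IB] :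
    ContMDiffVectorBundle n (HomFiber F F') (HomBundle V V') IB :=
  inferInstanceAs (ContMDiffVectorBundle n (F →L[ℝ] F') (fun x ↦ V x →L[ℝ] V' x) IB)

end HomBundle
end HomBundle

/-! ### Sections -/

section Sections

variable {E : Type*} [NormedAddCommGroup E] [NormedSpace ℝ E]
  {H : Type*} [TopologicalSpace H] (I : ModelWithCorners ℝ E H)
  {M : Type*} [TopologicalSpace M] [ChartedSpace H M]
  (F : Type*) [NormedAddCommGroup F] [NormedSpace ℝ F]
  {V : M → Type*} [TopologicalSpace (TotalSpace F V)]
  [∀ x, TopologicalSpace (V x)] [FiberBundle F V]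

/-- The section `s` of the vector bundle `V` with model fibre `F` is differentiable at `x`. -/
abbrev DiffSectionAt (s : Π x, V x) (x : M) : Prop :=
  MDifferentiableAt I (I.prod 𝓘(ℝ, F)) (fun y ↦ TotalSpace.mk' F y (s y)) x

/-- The section `s` of the vector bundle `V` with model fibre `F` is smooth. -/
abbrev SmoothSection (s : Π x, V x) : Prop :=
  ContMDiff I (I.prod 𝓘(ℝ, F)) ∞ (fun y ↦ TotalSpace.mk' F y (s y))

end Sections

/-! ### Trivial connection, direct sums and homomorphisms -/

namespace CovariantDerivative
section Generic
variable {E : Type*} [NormedAddCommGroup E] [NormedSpace ℝ E]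
  {H : Type*} [TopologicalSpace H] {I : ModelWithCorners ℝ E H}
  {M : Type*} [TopologicalSpace M] [ChartedSpace H M]
  {F : Type*} [NormedAddCommGroup F] [NormedSpace ℝ F]
  {V : M → Type*} [TopologicalSpace (TotalSpace F V)]
  [∀ x, AddCommGroup (V x)] [∀ x, Module ℝ (V x)] [∀ x, TopologicalSpace (V x)]
  [∀ x, IsTopologicalAddGroup (V x)] [∀ x, ContinuousSMul ℝ (V x)]
  [FiberBundle F V] [VectorBundle ℝ F V]
  {F' : Type*} [NormedAddCommGroup F'] [NormedSpace ℝ F']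
  {V' : M → Type*} [TopologicalSpace (TotalSpace F' V')]
  [∀ x, AddCommGroup (V' x)] [∀ x, Module ℝ (V' x)] [∀ x, TopologicalSpace (V' x)]
  [∀ x, IsTopologicalAddGroup (V' x)] [∀ x, ContinuousSMul ℝ (V' x)]
  [FiberBundle F' V'] [VectorBundle ℝ F' V']

variable (I M) in
/-- The connection on the trivial line bundle given by the differential of functions. -/
def trivialLine : CovariantDerivative I ℝ (Bundle.Trivial M ℝ) where
  toFun f x := mvfderiv I (fun y : M ↦ (f y : ℝ)) x
  isCovariantDerivativeOnUniv := {
    add := by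
      intro f g x hf hg _
      rw [mdifferentiableAt_section] at hf hg
      exact mvfderiv_fun_add hf hg
    leibniz := by
      intro f g x hf hg _
      rw [mdifferentiableAt_section] at hf
      exact mvfderiv_fun_smul hg hf }

theorem diffSectionAt_prod_iff (s : Π x, (V ×ᵇ V') x) (x : M) :
    DiffSectionAt I (F × F') s x ↔
      DiffSectionAt I F (fun y ↦ (s y).1) x ∧ DiffSectionAt I F' (fun y ↦ (s y).2) x := by
  unfold DiffSectionAt
  rw [mdifferentiableAt_section, mdifferentiableAt_section, mdifferentiableAt_section]
  exact mdifferentiableAt_prod_module_iff _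

/-- The direct sum of two connections. -/
def directSum (D : CovariantDerivative I F V) (D' : CovariantDerivative I F' V') :
    CovariantDerivative I (F × F') (V ×ᵇ V') where
  toFun s x := (D (fun y ↦ (s y).1) x).prod (D' (fun y ↦ (s y).2) x)
  isCovariantDerivativeOnUniv := {
    add := by
      intro s t x hs ht _
      replace hs := (diffSectionAt_prod_iff s x).1 hs
      replace ht := (diffSectionAt_prod_iff t x).1 ht
      have h1 := D.isCovariantDerivativeOnUniv.add hs.1 ht.1
      have h2 := D'.isCovariantDerivativeOnUniv.add hs.2 ht.2
      ext u
      · exact congr($h1 u)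
      · exact congr($h2 u)
    leibniz := by
      intro s g x hs hg _
      replace hs := (diffSectionAt_prod_iff s x).1 hs
      have h1 := D.isCovariantDerivativeOnUniv.leibniz hs.1 hg
      have h2 := D'.isCovariantDerivativeOnUniv.leibniz hs.2 hg
      ext u
      · exact congr($h1 u)
      · exact congr($h2 u) }

theorem diffSectionAt_homBundle_apply {A : Π x, HomBundle V V' x} {σ : Π x, V x} {x : M}
    (hA : DiffSectionAt I (HomFiber F F') A x) (hσ : DiffSectionAt I F σ x) :
    DiffSectionAt I F' (fun y ↦ A y (σ y)) x :=
  MDifferentiableAt.clm_bundle_apply hA hσ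

variable [FiniteDimensional ℝ F] [ContMDiffVectorBundle 1 F V I]

theorem tensorialAt_hom (D : CovariantDerivative I F V) (D' : CovariantDerivative I F' V')
    {A : Π x, HomBundle V V' x} {x : M} (hA : DiffSectionAt I (HomFiber F F') A x)
    (u : TangentSpace I x) :
    TensorialAt I F (fun σ : Π x, V x ↦ D' (fun y ↦ A y (σ y)) x u - A x (D σ x u)) x where
  smul := by
    intro f σ hf hσ
    have h1 := D'.isCovariantDerivativeOnUniv.leibniz (diffSectionAt_homBundle_apply hA hσ) hf
    have h2 := D.isCovariantDerivativeOnUniv.leibniz hσ hf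
    have h3 : (fun y ↦ A y ((f • σ) y)) = f • (fun y ↦ A y (σ y)) := by
      funext y; simp
    simp only [h3]
    erw [h1, h2]
    simp
    module
  add := by
    intro σ τ hσ hτ
    have h1 := D'.isCovariantDerivativeOnUniv.add (diffSectionAt_homBundle_apply hA hσ)
      (diffSectionAt_homBundle_apply hA hτ)
    have h2 := D.isCovariantDerivativeOnUniv.add hσ hτ
    have h3 : (fun y ↦ A y ((σ + τ) y)) = (fun y ↦ A y (σ y)) + (fun y ↦ A y (τ y)) := by
      funext y; simp
    simp only [h3]
    erw [h1, h2]
    simp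
    module

instance [FiniteDimensional ℝ E] (x : M) : FiniteDimensional ℝ (TangentSpace I x) :=
  inferInstanceAs (FiniteDimensional ℝ E)

instance (x : M) : T2Space (TangentSpace I x) := inferInstanceAs (T2Space E)

/-- The homomorphism `∇_u A`, for a section `A` of `Hom(V, V')` which is differentiable at `x`. -/
def homAux (D : CovariantDerivative I F V) (D' : CovariantDerivative I F' V')
    {A : Π x, HomBundle V V' x} {x : M} (hA : DiffSectionAt I (HomFiber F F') A x)
    (u : TangentSpace I x) : HomBundle V V' x :=
  TensorialAt.mkHom _ x (tensorialAt_hom D D' hA u)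

theorem homAux_apply (D : CovariantDerivative I F V) (D' : CovariantDerivative I F' V')
    {A : Π x, HomBundle V V' x} {x : M} (hA : DiffSectionAt I (HomFiber F F') A x)
    (u : TangentSpace I x) {σ : Π x, V x} (hσ : DiffSectionAt I F σ x) :
    homAux D D' hA u (σ x) = D' (fun y ↦ A y (σ y)) x u - A x (D σ x u) :=
  TensorialAt.mkHom_apply (tensorialAt_hom D D' hA u) hσ

theorem homAux_apply_extend (D : CovariantDerivative I F V) (D' : CovariantDerivative I F' V')
    {A : Π x, HomBundle V V' x} {x : M} (hA : DiffSectionAt I (HomFiber F F') A x)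
    (u : TangentSpace I x) (v : V x) :
    homAux D D' hA u v = D' (fun y ↦ A y (FiberBundle.extend F v y)) x u
      - A x (D (FiberBundle.extend F v) x u) := rfl

open Classical in
/-- The connection on `Hom(V, V')` induced by connections on `V` and `V'`:
`(∇_u A) (σ) = ∇_u (A σ) - A (∇_u σ)` for every section `σ` of `V`; see `hom_apply`.
(The value at a section `A` which is not differentiable at the point is a junk value.) -/
def hom [FiniteDimensional ℝ E] (D : CovariantDerivative I F V) (D' : CovariantDerivative I F' V') :
    CovariantDerivative I (HomFiber F F') (HomBundle V V') where
  toFun A x := if hA : DiffSectionAt I (HomFiber F F') A x then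
      LinearMap.toContinuousLinearMap
        { toFun u := homAux D D' hA u
          map_add' u u' := by
            ext v
            simp only [HomBundle.add_apply, homAux_apply_extend, map_add]
            module
          map_smul' c u := by
            ext v
            simp only [HomBundle.smul_apply, homAux_apply_extend, map_smul, RingHom.id_apply]
            module }
    else 0
  isCovariantDerivativeOnUniv := {
    add := by
      intro A A' x hA hA' _
      have hs : DiffSectionAt I (HomFiber F F') (A + A') x := mdifferentiableAt_add_section hA hA'
      rw [dif_pos hA, dif_pos hA', dif_pos hs]
      ext u v
      have hv : DiffSectionAt I F (FiberBundle.extend F v) x :=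
        FiberBundle.mdifferentiableAt_extend ..
      have h1 := D'.isCovariantDerivativeOnUniv.add (diffSectionAt_homBundle_apply hA hv)
        (diffSectionAt_homBundle_apply hA' hv)
      replace h1 := congr($h1 u)
      change homAux D D' hs u v = homAux D D' hA u v + homAux D D' hA' u v
      simp only [homAux_apply_extend]
      erw [h1]
      change _ - (A x _ + A' x _) = _
      simp
      module
    leibniz := by
      intro A g x hA hg _
      have hs : DiffSectionAt I (HomFiber F F') (g • A) x := MDifferentiableAt.smul_section hg hA
      rw [dif_pos hA, dif_pos hs]
      ext u v
      have hv : DiffSectionAt I F (FiberBundle.extend F v) x :=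
        FiberBundle.mdifferentiableAt_extend ..
      have h1 := D'.isCovariantDerivativeOnUniv.leibniz (diffSectionAt_homBundle_apply hA hv) hg
      replace h1 := congr($h1 u)
      change homAux D D' hs u v = g x • homAux D D' hA u v + (mvfderiv I g x u) • A x v
      simp only [homAux_apply_extend]
      erw [h1]
      change _ - g x • A x _ = _
      simp
      module }

theorem hom_apply [FiniteDimensional ℝ E] (D : CovariantDerivative I F V)
    (D' : CovariantDerivative I F' V') {A : Π x, HomBundle V V' x} {σ : Π x, V x} {x : M}
    (hA : DiffSectionAt I (HomFiber F F') A x) (hσ : DiffSectionAt I F σ x)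
    (u : TangentSpace I x) :
    (hom D D' A x u : HomBundle V V' x) (σ x) = D' (fun y ↦ A y (σ y)) x u - A x (D σ x u) := by
  have h : hom D D' A x u = homAux D D' hA u := by
    exact congrArg (fun L : TangentSpace I x →L[ℝ] HomBundle V V' x ↦ L u) (dif_pos hA)
  rw [h, homAux_apply D D' hA u hσ]

end Generic
end CovariantDerivative

/-! ### Fedosov structures -/

section Fedosov

variable (E : Type*) [NormedAddCommGroup E] [NormedSpace ℝ E]
  (M : Type*) [TopologicalSpace M] [ChartedSpace E M]

/-- The tangent bundle of `M`. -/
abbrev Tan : M → Type _ := TangentSpace 𝓘(ℝ, E)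

/-- The trivial real line bundle on `M`. -/
abbrev Line : M → Type := Bundle.Trivial M ℝ

/-- The cotangent bundle of `M`. -/
abbrev Cotan : M → Type _ := HomBundle (Tan E M) (Line M)

/-- A symplectic form on a manifold: a smooth closed nondegenerate `2`-form.
Closedness is expressed by the invariant formula for the exterior derivative. -/
structure SymplecticForm [IsManifold 𝓘(ℝ, E) ∞ M] where
  form : Π x, HomBundle (Tan E M) (Cotan E M) x
  smooth : SmoothSection 𝓘(ℝ, E) (HomFiber E (HomFiber E ℝ)) form
  skew : ∀ x (u v : Tan E M x), form x u v = -form x v u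
  nondegenerate : ∀ x (u : Tan E M x), (∀ v, form x u v = 0) → u = 0
  closed : ∀ X Y Z : Π x, Tan E M x, SmoothSection 𝓘(ℝ, E) E X → SmoothSection 𝓘(ℝ, E) E Y →
    SmoothSection 𝓘(ℝ, E) E Z → ∀ x,
      mvfderiv 𝓘(ℝ, E) (fun y ↦ form y (Y y) (Z y) : M → ℝ) x (X x)
        + mvfderiv 𝓘(ℝ, E) (fun y ↦ form y (Z y) (X y) : M → ℝ) x (Y x)
        + mvfderiv 𝓘(ℝ, E) (fun y ↦ form y (X y) (Y y) : M → ℝ) x (Z x)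
        - form x (VectorField.mlieBracket 𝓘(ℝ, E) X Y x) (Z x)
        - form x (VectorField.mlieBracket 𝓘(ℝ, E) Y Z x) (X x)
        - form x (VectorField.mlieBracket 𝓘(ℝ, E) Z X x) (Y x) = 0

/-- A Fedosov structure on a manifold of dimension `2n`: a symplectic form `J` together with a
smooth torsion-free connection `∇` on the tangent bundle such that `∇ J = 0`. -/
structure FedosovStructure [FiniteDimensional ℝ E] [IsManifold 𝓘(ℝ, E) ∞ M] (n : ℕ)
    extends SymplecticForm E M where
  finrank_eq : Module.finrank ℝ E = 2 * n
  conn : CovariantDerivative 𝓘(ℝ, E) E (Tan E M)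
  conn_smooth : CovariantDerivative.ContMDiffCovariantDerivative conn ∞
  torsion_eq_zero : conn.torsion = 0
  parallel : conn.hom (conn.hom (CovariantDerivative.trivialLine 𝓘(ℝ, E) M)) form = 0

end Fedosov


namespace FedosovStructure

variable {E : Type*} [NormedAddCommGroup E] [NormedSpace ℝ E] [FiniteDimensional ℝ E]
  {M : Type*} [TopologicalSpace M] [ChartedSpace E M] [IsManifold 𝓘(ℝ, E) ∞ M] {n : ℕ}

section SecondDerivative

variable {F : Type*} [NormedAddCommGroup F] [NormedSpace ℝ F]
  {V : M → Type*} [TopologicalSpace (TotalSpace F V)]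
  [∀ x, AddCommGroup (V x)] [∀ x, Module ℝ (V x)] [∀ x, TopologicalSpace (V x)]
  [∀ x, IsTopologicalAddGroup (V x)] [∀ x, ContinuousSMul ℝ (V x)]
  [FiberBundle F V] [VectorBundle ℝ F V]

/-- The section `D σ` of `T^*M ⊗ V = Hom(TM, V)`. -/
def derivSection (D : CovariantDerivative 𝓘(ℝ, E) F V) (σ : Π x, V x) (x : M) :
    HomBundle (Tan E M) V x := D σ x

/-- The second covariant derivative `u^a v^b ∇_a ∇_b σ` at `x` of a section `σ` of a bundle with
connection `D`: the derivative along `u` of the section `D σ` of `T^*M ⊗ V = Hom(TM, V)`, for the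
connection induced by `∇` and `D`, evaluated on `v`. -/
def secondDeriv (𝓕 : FedosovStructure E M n) (D : CovariantDerivative 𝓘(ℝ, E) F V)
    (σ : Π x, V x) (x : M) (u v : Tan E M x) : V x :=
  (𝓕.conn.hom D (derivSection D σ) x u : HomBundle (Tan E M) V x) v

/-- `u^a v^b (∇_a ∇_b - ∇_b ∇_a) σ` at `x`. -/
def curv (𝓕 : FedosovStructure E M n) (D : CovariantDerivative 𝓘(ℝ, E) F V)
    (σ : Π x, V x) (x : M) (u v : Tan E M x) : V x :=
  𝓕.secondDeriv D σ x u v - 𝓕.secondDeriv D σ x v u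

end SecondDerivative

section Curvature

variable [T2Space M] (𝓕 : FedosovStructure E M n)

theorem diffSectionAt_conn {X : Π x, Tan E M x} {x : M} {s : Set M} (hs : s ∈ 𝓝 x)
    (hX : ContMDiffOn 𝓘(ℝ, E) (𝓘(ℝ, E).prod 𝓘(ℝ, E)) ∞ (fun y ↦ TotalSpace.mk' E y (X y)) s) :
    DiffSectionAt 𝓘(ℝ, E) (HomFiber E E)
      (derivSection 𝓕.conn X) x := by
  obtain ⟨f, hf, -⟩ := ((SmoothBumpFunction.nhds_basis_support (I := 𝓘(ℝ, E))
    (interior_mem_nhds.2 hs)).mem_iff).1 (Filter.univ_mem (f := 𝓝 x))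
  have h1 : ContMDiff 𝓘(ℝ, E) (𝓘(ℝ, E).prod 𝓘(ℝ, E)) ∞
      (fun y ↦ TotalSpace.mk' E y (((f : M → ℝ) • X) y)) :=
    ContMDiffOn.smul_section_of_tsupport f.contMDiff.contMDiffOn isOpen_interior hf
      (hX.mono interior_subset)
  have h2 := (𝓕.conn_smooth.contMDiff.contMDiff (σ := (f : M → ℝ) • X)
    (by simpa using h1.contMDiffOn)) x (Set.mem_univ _)
  have h3 : DiffSectionAt 𝓘(ℝ, E) (HomFiber E E)
      (derivSection 𝓕.conn ((f : M → ℝ) • X)) x :=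
    (contMDiffWithinAt_univ.1 h2).mdifferentiableAt (by simp)
  refine h3.congr_of_eventuallyEq ?_
  filter_upwards [f.eventuallyEq_one.eventually_nhds, eventually_mem_nhds_iff.2 hs] with y hy hys
  refine congrArg (TotalSpace.mk' (HomFiber E E) y) ?_
  have hXy : DiffSectionAt 𝓘(ℝ, E) E X y :=
    ((hX y (mem_of_mem_nhds hys)).contMDiffAt hys).mdifferentiableAt (by simp)
  refine 𝓕.conn.isCovariantDerivativeOnUniv.congr_of_eventuallyEq hXy
    ((h1 y).mdifferentiableAt (by simp)) Filter.univ_mem ?_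
  filter_upwards [hy] with z hz
  simp [hz]

theorem extend_add {x y : M} (hy : y ∈ (trivializationAt E (Tan E M) x).baseSet)
    (w w' : Tan E M x) :
    (FiberBundle.extend E (w + w') : Π y, Tan E M y) y =
      FiberBundle.extend E w y + FiberBundle.extend E w' y := by
  have h := Trivialization.linear ℝ (trivializationAt E (Tan E M) x)
    (FiberBundle.mem_baseSet_trivializationAt' x)
  change (trivializationAt E (Tan E M) x).symm y _ =
    (trivializationAt E (Tan E M) x).symm y _ + (trivializationAt E (Tan E M) x).symm y _
  rw [h.map_add, ← Trivialization.coe_symmₗ (R := ℝ) _ hy]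
  exact map_add _ _ _

theorem extend_smul {x y : M} (hy : y ∈ (trivializationAt E (Tan E M) x).baseSet)
    (c : ℝ) (w : Tan E M x) :
    (FiberBundle.extend E (c • w) : Π y, Tan E M y) y = c • FiberBundle.extend E w y := by
  have h := Trivialization.linear ℝ (trivializationAt E (Tan E M) x)
    (FiberBundle.mem_baseSet_trivializationAt' x)
  change (trivializationAt E (Tan E M) x).symm y _ =
    c • (trivializationAt E (Tan E M) x).symm y _
  rw [h.map_smul, ← Trivialization.coe_symmₗ (R := ℝ) _ hy]
  exact map_smul _ _ _

theorem eventually_mem_baseSet (x : M) :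
    ∀ᶠ y in 𝓝 x, ∀ᶠ z in 𝓝 y, z ∈ (trivializationAt E (Tan E M) x).baseSet :=
  eventually_mem_nhds_iff.2 ((trivializationAt E (Tan E M) x).open_baseSet.mem_nhds
    (FiberBundle.mem_baseSet_trivializationAt' x))

theorem contMDiffOn_extend {x : M} (w : Tan E M x) : ∃ s ∈ 𝓝 x,
    ContMDiffOn 𝓘(ℝ, E) (𝓘(ℝ, E).prod 𝓘(ℝ, E)) ∞
      (fun y ↦ TotalSpace.mk' E y ((FiberBundle.extend E w : Π y, Tan E M y) y)) s :=
  FiberBundle.exists_contMDiffOn_extend 𝓘(ℝ, E) E w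

theorem secondDeriv_extend_add {x : M} (u v w w' : Tan E M x) :
    𝓕.secondDeriv 𝓕.conn (FiberBundle.extend E (w + w')) x u v =
      𝓕.secondDeriv 𝓕.conn (FiberBundle.extend E w) x u v +
        𝓕.secondDeriv 𝓕.conn (FiberBundle.extend E w') x u v := by
  obtain ⟨s, hs, h⟩ := contMDiffOn_extend w
  obtain ⟨s', hs', h'⟩ := contMDiffOn_extend w'
  obtain ⟨s'', hs'', h''⟩ := contMDiffOn_extend (w + w')
  have d := 𝓕.diffSectionAt_conn hs h
  have d' := 𝓕.diffSectionAt_conn hs' h'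
  have d'' := 𝓕.diffSectionAt_conn hs'' h''
  have key : (𝓕.conn.hom 𝓕.conn) (derivSection 𝓕.conn (FiberBundle.extend E (w + w'))) x =
      (𝓕.conn.hom 𝓕.conn) (derivSection 𝓕.conn (FiberBundle.extend E w)
        + derivSection 𝓕.conn (FiberBundle.extend E w')) x := by
    refine (𝓕.conn.hom 𝓕.conn).isCovariantDerivativeOnUniv.congr_of_eventuallyEq d''
      (mdifferentiableAt_add_section d d') Filter.univ_mem ?_
    filter_upwards [eventually_mem_nhds_iff.2 hs, eventually_mem_nhds_iff.2 hs',
      eventually_mem_nhds_iff.2 hs'', eventually_mem_baseSet (E := E) x] with y hy hy' hy'' hb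
    have e1 : DiffSectionAt 𝓘(ℝ, E) E (FiberBundle.extend E w : Π y, Tan E M y) y :=
      ((h y (mem_of_mem_nhds hy)).contMDiffAt hy).mdifferentiableAt (by simp)
    have e2 : DiffSectionAt 𝓘(ℝ, E) E (FiberBundle.extend E w' : Π y, Tan E M y) y :=
      ((h' y (mem_of_mem_nhds hy')).contMDiffAt hy').mdifferentiableAt (by simp)
    have e3 := 𝓕.conn.isCovariantDerivativeOnUniv.add e1 e2
    have e4 : DiffSectionAt 𝓘(ℝ, E) E (FiberBundle.extend E (w + w') : Π y, Tan E M y) y :=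
      ((h'' y (mem_of_mem_nhds hy'')).contMDiffAt hy'').mdifferentiableAt (by simp)
    refine Eq.trans ?_ e3
    refine 𝓕.conn.isCovariantDerivativeOnUniv.congr_of_eventuallyEq e4
      (mdifferentiableAt_add_section e1 e2) Filter.univ_mem ?_
    filter_upwards [hb] with z hz
    exact extend_add hz w w'
  have e4 := (𝓕.conn.hom 𝓕.conn).isCovariantDerivativeOnUniv.add d d'
  unfold secondDeriv
  rw [key]
  exact congr(($e4 u : HomBundle (Tan E M) (Tan E M) x) v)

theorem secondDeriv_extend_smul {x : M} (u v w : Tan E M x) (c : ℝ) :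
    𝓕.secondDeriv 𝓕.conn (FiberBundle.extend E (c • w)) x u v =
      c • 𝓕.secondDeriv 𝓕.conn (FiberBundle.extend E w) x u v := by
  obtain ⟨s, hs, h⟩ := contMDiffOn_extend w
  obtain ⟨s'', hs'', h''⟩ := contMDiffOn_extend (c • w)
  have d := 𝓕.diffSectionAt_conn hs h
  have d'' := 𝓕.diffSectionAt_conn hs'' h''
  have key : (𝓕.conn.hom 𝓕.conn) (derivSection 𝓕.conn (FiberBundle.extend E (c • w))) x =
      (𝓕.conn.hom 𝓕.conn) (c • derivSection 𝓕.conn (FiberBundle.extend E w)) x := by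
    refine (𝓕.conn.hom 𝓕.conn).isCovariantDerivativeOnUniv.congr_of_eventuallyEq d''
      (mdifferentiableAt_const.smul_section d) Filter.univ_mem ?_
    filter_upwards [eventually_mem_nhds_iff.2 hs, eventually_mem_nhds_iff.2 hs'',
      eventually_mem_baseSet (E := E) x] with y hy hy'' hb
    have e1 : DiffSectionAt 𝓘(ℝ, E) E (FiberBundle.extend E w : Π y, Tan E M y) y :=
      ((h y (mem_of_mem_nhds hy)).contMDiffAt hy).mdifferentiableAt (by simp)
    have e3 := 𝓕.conn.isCovariantDerivativeOnUniv.smul_const c e1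
    have e4 : DiffSectionAt 𝓘(ℝ, E) E (FiberBundle.extend E (c • w) : Π y, Tan E M y) y :=
      ((h'' y (mem_of_mem_nhds hy'')).contMDiffAt hy'').mdifferentiableAt (by simp)
    refine Eq.trans ?_ e3
    refine 𝓕.conn.isCovariantDerivativeOnUniv.congr_of_eventuallyEq e4
      (mdifferentiableAt_const.smul_section e1) Filter.univ_mem ?_
    filter_upwards [hb] with z hz
    exact extend_smul hz c w
  have e4 := (𝓕.conn.hom 𝓕.conn).isCovariantDerivativeOnUniv.smul_const c d
  unfold secondDeriv
  rw [key]
  exact congr(($e4 u : HomBundle (Tan E M) (Tan E M) x) v)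

/-- The curvature tensor `R_{ab}{}^c{}_d u^a v^b w^d`, defined by
`(∇_a ∇_b - ∇_b ∇_a) X^c = R_{ab}{}^c{}_d X^d`. -/
def R (x : M) : HomBundle (Tan E M) (HomBundle (Tan E M) (HomBundle (Tan E M) (Tan E M))) x :=
  .ofLinear
    { toFun u := .ofLinear
        { toFun v := .ofLinear
            { toFun w := 𝓕.curv 𝓕.conn (FiberBundle.extend E w) x u v
              map_add' w w' := by
                simp only [curv, secondDeriv_extend_add]
                module
              map_smul' c w := by
                simp only [curv, secondDeriv_extend_smul, RingHom.id_apply]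
                module }
          map_add' v v' := by
            ext w
            simp only [curv, secondDeriv, HomBundle.ofLinear_apply, LinearMap.coe_mk,
              AddHom.coe_mk, map_add, HomBundle.add_apply]
            module
          map_smul' c v := by
            ext w
            simp only [curv, secondDeriv, HomBundle.ofLinear_apply, LinearMap.coe_mk,
              AddHom.coe_mk, map_smul, HomBundle.smul_apply, RingHom.id_apply]
            module }
      map_add' u u' := by
        ext v w
        simp only [curv, secondDeriv, HomBundle.ofLinear_apply, LinearMap.coe_mk,
          AddHom.coe_mk, map_add, HomBundle.add_apply]
        module
      map_smul' c u := by
        ext v w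
        simp only [curv, secondDeriv, HomBundle.ofLinear_apply, LinearMap.coe_mk,
          AddHom.coe_mk, map_smul, HomBundle.smul_apply, RingHom.id_apply]
        module }

theorem R_apply (x : M) (u v w : Tan E M x) :
    𝓕.R x u v w = 𝓕.curv 𝓕.conn (FiberBundle.extend E w) x u v := rfl

end Curvature

section Contraction

variable (𝓕 : FedosovStructure E M n)

/-- The map `T_x M → T_x^* M`, `u ↦ J(u, ·)`. -/
def lower (x : M) : Tan E M x →ₗ[ℝ] Cotan E M x := (𝓕.form x).toLinear

theorem lower_injective (x : M) : Function.Injective (𝓕.lower x) := by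
  refine (injective_iff_map_eq_zero _).2 fun u hu ↦ 𝓕.nondegenerate x u fun v ↦ ?_
  exact congr(($hu : Cotan E M x) v)

theorem finrank_cotan (x : M) :
    Module.finrank ℝ (Tan E M x) = Module.finrank ℝ (Cotan E M x) := by
  have e : Module.Dual ℝ (Tan E M x) ≃ₗ[ℝ] (Tan E M x →L[ℝ] ℝ) := LinearMap.toContinuousLinearMap
  exact Subspace.dual_finrank_eq.symm.trans e.finrank_eq

/-- Raising an index with `J^{ab}`: `(raise φ)^a = J^{ab} φ_b`.  This is the inverse of
`u^a ↦ u^a J_{ab}`, because `J_{ab} J^{ac} = δ_b^c`. -/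
def raise (x : M) : Cotan E M x →ₗ[ℝ] Tan E M x :=
  (LinearMap.linearEquivOfInjective (𝓕.lower x) (𝓕.lower_injective x)
    (finrank_cotan x)).symm.toLinearMap

theorem form_raise (x : M) (φ : Cotan E M x) : 𝓕.form x (𝓕.raise x φ) = φ :=
  (LinearMap.linearEquivOfInjective (𝓕.lower x) (𝓕.lower_injective x)
    (finrank_cotan x)).apply_symm_apply φ

/-- The full contraction `J^{ab} T_{ab}` of a tensor `T`, where `T p q = T_{ab} p^a q^b`. -/
def contract (x : M) (T : HomBundle (Tan E M) (Cotan E M) x) : ℝ :=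
  LinearMap.trace ℝ (Tan E M x) (𝓕.raise x ∘ₗ T.toLinear)

end Contraction

section Tensors

variable [T2Space M] (𝓕 : FedosovStructure E M n)

/-- The endomorphism `u ↦ A u v w` of the tangent space. -/
def firstSlot {x : M}
    (A : HomBundle (Tan E M) (HomBundle (Tan E M) (HomBundle (Tan E M) (Tan E M))) x)
    (v w : Tan E M x) : Tan E M x →ₗ[ℝ] Tan E M x where
  toFun u := A u v w
  map_add' u u' := by simp
  map_smul' c u := by simp

/-- `Φ_{bd} = (1 / (2 (n + 1))) R_{ab}{}^a{}_d`, as `Φ v w = Φ_{bd} v^b w^d`. -/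
def Phi (x : M) : HomBundle (Tan E M) (Cotan E M) x :=
  .ofLinear
    { toFun v := .ofLinear
        { toFun w := (1 / (2 * ((n : ℝ) + 1))) *
            LinearMap.trace ℝ (Tan E M x) (firstSlot (𝓕.R x) v w)
          map_add' w w' := by
            rw [← mul_add, ← map_add]
            congr 2
            ext u
            simp [firstSlot]
          map_smul' c w := by
            rw [RingHom.id_apply, smul_eq_mul, mul_left_comm, ← smul_eq_mul c, ← map_smul]
            congr 2
            ext u
            simp [firstSlot] }
      map_add' v v' := by
        ext w
        change (_ * _ : ℝ) = (_ * _ : ℝ) + (_ * _ : ℝ)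
        rw [← mul_add, ← map_add]
        congr 2
        ext u
        simp [firstSlot]
      map_smul' c v := by
        ext w
        change (_ * _ : ℝ) = c * (_ * _ : ℝ)
        rw [mul_left_comm, ← smul_eq_mul c, ← map_smul]
        congr 2
        ext u
        simp [firstSlot] }

theorem Phi_apply (x : M) (v w : Tan E M x) :
    𝓕.Phi x v w = (1 / (2 * ((n : ℝ) + 1))) *
      LinearMap.trace ℝ (Tan E M x) (firstSlot (𝓕.R x) v w) := rfl

/-- The tensor `V_{ab}{}^c{}_d` defined by the decomposition
`R_{ab}{}^c{}_d = V_{ab}{}^c{}_d + δ_a^c Φ_{bd} - δ_b^c Φ_{ad} + J_{ad} Φ_{be} J^{ce}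
  - J_{bd} Φ_{ae} J^{ce} + 2 J_{ab} Φ_{de} J^{ce}`. -/
def V (x : M) : HomBundle (Tan E M) (HomBundle (Tan E M) (HomBundle (Tan E M) (Tan E M))) x :=
  .ofLinear
    { toFun u := .ofLinear
        { toFun v := .ofLinear
            { toFun w := 𝓕.R x u v w - ((𝓕.Phi x v w : ℝ) • u - (𝓕.Phi x u w : ℝ) • v
                + (𝓕.form x u w : ℝ) • 𝓕.raise x (𝓕.Phi x v)
                - (𝓕.form x v w : ℝ) • 𝓕.raise x (𝓕.Phi x u)
                + (2 * (𝓕.form x u v : ℝ)) • 𝓕.raise x (𝓕.Phi x w))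
              map_add' w w' := by
                simp only [map_add, add_smul, smul_add]
                module
              map_smul' c w := by
                simp only [map_smul, smul_eq_mul, RingHom.id_apply]
                module }
          map_add' v v' := by
            ext w
            simp only [map_add, HomBundle.ofLinear_apply, LinearMap.coe_mk, AddHom.coe_mk,
              HomBundle.add_apply]
            module
          map_smul' c v := by
            ext w
            simp only [map_smul, HomBundle.ofLinear_apply, LinearMap.coe_mk, AddHom.coe_mk,
              HomBundle.smul_apply, RingHom.id_apply, smul_eq_mul]
            module }
      map_add' u u' := by
        ext v w
        simp only [map_add, HomBundle.ofLinear_apply, LinearMap.coe_mk, AddHom.coe_mk,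
          HomBundle.add_apply]
        module
      map_smul' c u := by
        ext v w
        simp only [map_smul, HomBundle.ofLinear_apply, LinearMap.coe_mk, AddHom.coe_mk,
          HomBundle.smul_apply, RingHom.id_apply, smul_eq_mul]
        module }

theorem R_eq (x : M) (u v w : Tan E M x) :
    𝓕.R x u v w = 𝓕.V x u v w + ((𝓕.Phi x v w : ℝ) • u - (𝓕.Phi x u w : ℝ) • v
      + (𝓕.form x u w : ℝ) • 𝓕.raise x (𝓕.Phi x v)
      - (𝓕.form x v w : ℝ) • 𝓕.raise x (𝓕.Phi x u)
      + (2 * (𝓕.form x u v : ℝ)) • 𝓕.raise x (𝓕.Phi x w)) := by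
  simp only [V, HomBundle.ofLinear_apply, LinearMap.coe_mk, AddHom.coe_mk]
  module

/-- The connection on `T^*M` induced by `∇`. -/
abbrev cotanConn : CovariantDerivative 𝓘(ℝ, E) (HomFiber E ℝ) (Cotan E M) :=
  𝓕.conn.hom (CovariantDerivative.trivialLine 𝓘(ℝ, E) M)

/-- `∇_c Φ_{ab}`, as `gradPhi w u v = w^c u^a v^b ∇_c Φ_{ab}`. -/
def gradPhi (x : M) : HomBundle (Tan E M) (HomBundle (Tan E M) (Cotan E M)) x :=
  derivSection (𝓕.conn.hom 𝓕.cotanConn) 𝓕.Phi x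

/-- `∇_e V_{ab}{}^c{}_d`, the index `e` being the first argument. -/
def gradV (x : M) : HomBundle (Tan E M)
    (HomBundle (Tan E M) (HomBundle (Tan E M) (HomBundle (Tan E M) (Tan E M)))) x :=
  derivSection (𝓕.conn.hom (𝓕.conn.hom (𝓕.conn.hom 𝓕.conn))) 𝓕.V x

/-- The bilinear form `(p, q) ↦ q^c u^a p^b ∇_c Φ_{ab}`. -/
def gradPhiAux (x : M) (u : Tan E M x) : HomBundle (Tan E M) (Cotan E M) x :=
  .ofLinear
    { toFun p := .ofLinear
        { toFun q := 𝓕.gradPhi x q u p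
          map_add' q q' := by simp
          map_smul' c q := by simp }
      map_add' p p' := by ext q; simp
      map_smul' c p := by ext q; simp }

/-- `S_a = (1 / (2 n + 1)) J^{bc} ∇_c Φ_{ab}`. -/
def S (x : M) : Cotan E M x :=
  .ofLinear
    { toFun u := (1 / (2 * (n : ℝ) + 1)) * 𝓕.contract x (𝓕.gradPhiAux x u)
      map_add' u u' := by
        rw [← mul_add, contract, contract, contract, ← map_add]
        congr 2
        ext p
        simp only [LinearMap.add_apply, LinearMap.comp_apply, ← map_add]
        congr 1
        ext q
        simp [gradPhiAux]
      map_smul' c u := by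
        rw [RingHom.id_apply, smul_eq_mul, mul_left_comm, ← smul_eq_mul c, contract, contract,
          ← map_smul]
        congr 2
        ext p
        simp only [LinearMap.smul_apply, LinearMap.comp_apply, ← map_smul]
        congr 1
        ext q
        simp [gradPhiAux] }

/-- The endomorphism `z^e ↦ z^e u^a v^b w^d ∇_e V_{ab}{}^c{}_d`. -/
def gradVAux (x : M) (u v w : Tan E M x) : Tan E M x →ₗ[ℝ] Tan E M x where
  toFun z := 𝓕.gradV x z u v w
  map_add' z z' := by simp
  map_smul' c z := by simp

/-- `Y_{abd} = (1 / (2 n + 1)) ∇_c V_{ab}{}^c{}_d`. -/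
def Y (x : M) : HomBundle (Tan E M) (HomBundle (Tan E M) (Cotan E M)) x :=
  .ofLinear
    { toFun u := .ofLinear
        { toFun v := .ofLinear
            { toFun w := (1 / (2 * (n : ℝ) + 1)) *
                LinearMap.trace ℝ (Tan E M x) (𝓕.gradVAux x u v w)
              map_add' w w' := by
                rw [← mul_add, ← map_add]
                congr 2
                ext z
                simp [gradVAux]
              map_smul' c w := by
                rw [RingHom.id_apply, smul_eq_mul, mul_left_comm, ← smul_eq_mul c, ← map_smul]
                congr 2
                ext z
                simp [gradVAux] }
          map_add' v v' := by
            ext w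
            change (_ * _ : ℝ) = (_ * _ : ℝ) + (_ * _ : ℝ)
            rw [← mul_add, ← map_add]
            congr 2
            ext z
            simp [gradVAux]
          map_smul' c v := by
            ext w
            change (_ * _ : ℝ) = c * (_ * _ : ℝ)
            rw [mul_left_comm, ← smul_eq_mul c, ← map_smul]
            congr 2
            ext z
            simp [gradVAux] }
      map_add' u u' := by
        ext v w
        change (_ * _ : ℝ) = (_ * _ : ℝ) + (_ * _ : ℝ)
        rw [← mul_add, ← map_add]
        congr 2
        ext z
        simp [gradVAux]
      map_smul' c u := by
        ext v w
        change (_ * _ : ℝ) = c * (_ * _ : ℝ)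
        rw [mul_left_comm, ← smul_eq_mul c, ← map_smul]
        congr 2
        ext z
        simp [gradVAux] }

/-- `∇_c S_d`, as `gradS p q = p^c q^d ∇_c S_d`. -/
def gradS (x : M) : HomBundle (Tan E M) (Cotan E M) x :=
  derivSection 𝓕.cotanConn 𝓕.S x

/-- `∇_c Y_{abd}`, the index `c` being the first argument. -/
def gradY (x : M) :
    HomBundle (Tan E M) (HomBundle (Tan E M) (HomBundle (Tan E M) (Cotan E M))) x :=
  derivSection (𝓕.conn.hom (𝓕.conn.hom 𝓕.cotanConn)) 𝓕.Y x

end Tensors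

section Tractors

variable (E M) in
/-- The standard tractor bundle `Λ⁰ ⊕ Λ¹ ⊕ Λ⁰`, whose elements are triples `(σ, μ, ρ)`. -/
abbrev Tractor : M → Type _ := Line M ×ᵇ (Cotan E M ×ᵇ Line M)

variable (E) in
/-- The model fibre of the standard tractor bundle. -/
abbrev TractorFiber : Type _ := ℝ × (HomFiber E ℝ × ℝ)

variable [T2Space M] (𝓕 : FedosovStructure E M n)

/-- The form `⟨(σ, μ, ρ), (σ', μ', ρ')⟩ = σ ρ' + J^{bc} μ_b μ'_c - ρ σ'` on tractors. -/
def pairing (x : M) (s t : Tractor E M x) : ℝ :=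
  s.1 * t.2.2 + s.2.1 (𝓕.raise x t.2.1) - s.2.2 * t.1

/-- The algebraic part `(σ, μ, ρ) ↦ (-μ_a, J_{ab} ρ + Φ_{ab} σ, -Φ_{ab} J^{bc} μ_c + S_a σ)`
of the tractor connection. -/
def tractorForm (x : M) : Tractor E M x →L[ℝ] Tan E M x →L[ℝ] Tractor E M x :=
  LinearMap.toContinuousBilinearMap <| LinearMap.mk₂ ℝ
    (fun (s : Tractor E M x) (u : Tan E M x) ↦
      ((-(s.2.1 u), s.2.2 • 𝓕.form x u + s.1 • 𝓕.Phi x u,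
        -(𝓕.Phi x u (𝓕.raise x s.2.1)) + 𝓕.S x u * s.1) : Tractor E M x))
    (by
      intro s s' u
      refine Prod.ext ?_ (Prod.ext ?_ ?_)
      · change -((s.2.1 + s'.2.1) u : ℝ) = -(s.2.1 u : ℝ) + -(s'.2.1 u : ℝ)
        rw [HomBundle.add_apply]
        ring
      · change (s.2.2 + s'.2.2 : ℝ) • 𝓕.form x u + (s.1 + s'.1 : ℝ) • 𝓕.Phi x u =
          (s.2.2 • 𝓕.form x u + s.1 • 𝓕.Phi x u) + (s'.2.2 • 𝓕.form x u + s'.1 • 𝓕.Phi x u)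
        module
      · change -(𝓕.Phi x u (𝓕.raise x (s.2.1 + s'.2.1)) : ℝ) + 𝓕.S x u * (s.1 + s'.1 : ℝ) =
          (-(𝓕.Phi x u (𝓕.raise x s.2.1)) + 𝓕.S x u * s.1 : ℝ) +
            (-(𝓕.Phi x u (𝓕.raise x s'.2.1)) + 𝓕.S x u * s'.1 : ℝ)
        simp only [map_add]
        ring)
    (by
      intro c s u
      refine Prod.ext ?_ (Prod.ext ?_ ?_)
      · change -((c • s.2.1) u : ℝ) = c * (-(s.2.1 u : ℝ))
        rw [HomBundle.smul_apply, smul_eq_mul]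
        ring
      · change (c * s.2.2 : ℝ) • 𝓕.form x u + (c * s.1 : ℝ) • 𝓕.Phi x u =
          c • (s.2.2 • 𝓕.form x u + s.1 • 𝓕.Phi x u)
        module
      · change -(𝓕.Phi x u (𝓕.raise x (c • s.2.1)) : ℝ) + 𝓕.S x u * (c * s.1 : ℝ) =
          c * (-(𝓕.Phi x u (𝓕.raise x s.2.1)) + 𝓕.S x u * s.1 : ℝ)
        simp only [map_smul, smul_eq_mul]
        ring)
    (by
      intro s u u'
      refine Prod.ext ?_ (Prod.ext ?_ ?_)
      · change -(s.2.1 (u + u') : ℝ) = -(s.2.1 u : ℝ) + -(s.2.1 u' : ℝ)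
        rw [map_add]
        ring
      · change s.2.2 • 𝓕.form x (u + u') + s.1 • 𝓕.Phi x (u + u') =
          (s.2.2 • 𝓕.form x u + s.1 • 𝓕.Phi x u) + (s.2.2 • 𝓕.form x u' + s.1 • 𝓕.Phi x u')
        simp only [map_add]
        module
      · change -(𝓕.Phi x (u + u') (𝓕.raise x s.2.1) : ℝ) + 𝓕.S x (u + u') * s.1 =
          (-(𝓕.Phi x u (𝓕.raise x s.2.1)) + 𝓕.S x u * s.1 : ℝ) +
            (-(𝓕.Phi x u' (𝓕.raise x s.2.1)) + 𝓕.S x u' * s.1 : ℝ)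
        simp only [map_add, HomBundle.add_apply]
        ring)
    (by
      intro c s u
      refine Prod.ext ?_ (Prod.ext ?_ ?_)
      · change -(s.2.1 (c • u) : ℝ) = c * (-(s.2.1 u : ℝ))
        rw [map_smul, smul_eq_mul]
        ring
      · change s.2.2 • 𝓕.form x (c • u) + s.1 • 𝓕.Phi x (c • u) =
          c • (s.2.2 • 𝓕.form x u + s.1 • 𝓕.Phi x u)
        simp only [map_smul]
        module
      · change -(𝓕.Phi x (c • u) (𝓕.raise x s.2.1) : ℝ) + 𝓕.S x (c • u) * s.1 =
          c * (-(𝓕.Phi x u (𝓕.raise x s.2.1)) + 𝓕.S x u * s.1 : ℝ)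
        simp only [map_smul, HomBundle.smul_apply, smul_eq_mul]
        ring)

/-- The tractor connection
`∇_a (σ, μ_b, ρ) = (∇_a σ - μ_a, ∇_a μ_b + J_{ab} ρ + Φ_{ab} σ, ∇_a ρ - Φ_{ab} J^{bc} μ_c + S_a σ)`;
see `tractorConnection_apply`. -/
def tractorConnection : CovariantDerivative 𝓘(ℝ, E) (TractorFiber E) (Tractor E M) :=
  ((CovariantDerivative.trivialLine 𝓘(ℝ, E) M).directSum
    (𝓕.cotanConn.directSum (CovariantDerivative.trivialLine 𝓘(ℝ, E) M))).addOneForm 𝓕.tractorForm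

theorem tractorConnection_apply (s : Π x, Tractor E M x) (x : M) (u : Tan E M x) :
    𝓕.tractorConnection s x u =
      (mvfderiv 𝓘(ℝ, E) (fun y ↦ (s y).1 : M → ℝ) x u - (s x).2.1 u,
        𝓕.cotanConn (fun y ↦ (s y).2.1) x u
          + ((s x).2.2 • 𝓕.form x u + (s x).1 • 𝓕.Phi x u),
        mvfderiv 𝓘(ℝ, E) (fun y ↦ (s y).2.2 : M → ℝ) x u
          + (-(𝓕.Phi x u (𝓕.raise x (s x).2.1)) + 𝓕.S x u * (s x).1)) := by
  refine Prod.ext ?_ rfl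
  exact (sub_eq_add_neg (G := ℝ) _ _).symm

/-- The tensor `V_{bc}{}^e{}_p Φ_{eq}` evaluated on `u^b v^c`, as a bilinear form in `p` and `q`. -/
def VPhi (x : M) (u v : Tan E M x) : HomBundle (Tan E M) (Cotan E M) x :=
  .ofLinear
    { toFun p := .ofLinear
        { toFun q := 𝓕.Phi x q (𝓕.V x u v p)
          map_add' q q' := by simp
          map_smul' c q := by simp }
      map_add' p p' := by ext q; simp
      map_smul' c p := by ext q; simp }

/-- The bilinear form `(p, q) ↦ p^c q^d u^a v^b ∇_c Y_{abd}`. -/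
def gradYAux (x : M) (u v : Tan E M x) : HomBundle (Tan E M) (Cotan E M) x :=
  .ofLinear
    { toFun p := 𝓕.gradY x p u v
      map_add' p p' := by ext q; simp
      map_smul' c p := by ext q; simp }

/-- The bilinear form `(p, q) ↦ p^c q^d J^{ef} Φ_{ce} Φ_{df}`. -/
def PhiPhi (x : M) : HomBundle (Tan E M) (Cotan E M) x :=
  .ofLinear
    { toFun p := .ofLinear
        { toFun q := 𝓕.Phi x p (𝓕.raise x (𝓕.Phi x q))
          map_add' q q' := by simp
          map_smul' c q := by simp }
      map_add' p p' := by ext q; simp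
      map_smul' c p := by ext q; simp }

/-- The part of the tractor curvature built from `V` and `Y`, contracted with `u^a v^b`:
`(0, -V_{ab}{}^c{}_d μ_c + Y_{abd} σ,
  -Y_{abc} J^{cd} μ_d + (1 / (2 n)) (J^{cd} V_{ab}{}^e{}_c Φ_{de} - J^{cd} ∇_c Y_{abd}) σ)`. -/
def curvatureVY (x : M) (u v : Tan E M x) (s : Tractor E M x) : Tractor E M x :=
  (0,
    -(.ofLinear (s.2.1.toLinear ∘ₗ (𝓕.V x u v).toLinear)) + s.1 • 𝓕.Y x u v,
    -(𝓕.Y x u v (𝓕.raise x s.2.1)) + (1 / (2 * (n : ℝ))) *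
      (𝓕.contract x (𝓕.VPhi x u v) - 𝓕.contract x (𝓕.gradYAux x u v)) * s.1)

/-- The endomorphism
`(σ, μ_d, ρ) ↦ (ρ, J^{ce} Φ_{cd} μ_e - S_d σ,
  S_c J^{cd} μ_d + (1 / (2 n)) J^{cd} (∇_c S_d - J^{ef} Φ_{ce} Φ_{df}) σ)`
of the standard tractor bundle. -/
def Theta (x : M) : Tractor E M x →ₗ[ℝ] Tractor E M x where
  toFun s :=
    (s.2.2,
      𝓕.Phi x (𝓕.raise x s.2.1) - s.1 • 𝓕.S x,
      𝓕.S x (𝓕.raise x s.2.1) + (1 / (2 * (n : ℝ))) *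
        𝓕.contract x (𝓕.gradS x - 𝓕.PhiPhi x) * s.1)
  map_add' s t := by
    refine Prod.ext rfl (Prod.ext ?_ ?_)
    · change 𝓕.Phi x (𝓕.raise x (s.2.1 + t.2.1)) - (s.1 + t.1 : ℝ) • 𝓕.S x =
        (𝓕.Phi x (𝓕.raise x s.2.1) - s.1 • 𝓕.S x) + (𝓕.Phi x (𝓕.raise x t.2.1) - t.1 • 𝓕.S x)
      simp only [map_add]
      module
    · change (𝓕.S x (𝓕.raise x (s.2.1 + t.2.1)) : ℝ) + (1 / (2 * (n : ℝ))) *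
        𝓕.contract x (𝓕.gradS x - 𝓕.PhiPhi x) * (s.1 + t.1 : ℝ) = (_ + _ : ℝ) + (_ + _ : ℝ)
      simp only [map_add]
      ring
  map_smul' c s := by
    refine Prod.ext rfl (Prod.ext ?_ ?_)
    · change 𝓕.Phi x (𝓕.raise x (c • s.2.1)) - (c * s.1 : ℝ) • 𝓕.S x =
        c • (𝓕.Phi x (𝓕.raise x s.2.1) - s.1 • 𝓕.S x)
      simp only [map_smul]
      module
    · change (𝓕.S x (𝓕.raise x (c • s.2.1)) : ℝ) + (1 / (2 * (n : ℝ))) *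
        𝓕.contract x (𝓕.gradS x - 𝓕.PhiPhi x) * (c * s.1 : ℝ) = c * (_ + _ : ℝ)
      simp only [map_smul, smul_eq_mul]
      ring

end Tractors
end FedosovStructure

end

/-!
Every identity to be proved is an identity of tensors at a point `x`, and every vector at `x`
extends to a smooth vector field that is parallel at `x`. For such fields covariant derivatives of
tensors become derivatives of functions, and second covariant derivatives become iterated first
ones, so the tractor curvature can be computed slot by slot. The middle slot is the curvature of
`∇` together with `∇_a Φ_{bc} - ∇_b Φ_{ac}`, which the contracted second Bianchi identity
expresses through `Y` and `S`. The last slot contains `∇_a S_b - ∇_b S_a`. It is found by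
contracting the derivative of the formula for `Y`: up to the Ricci identity for `Φ`, whose
curvature terms are traces evaluated by means of the decomposition of `R`, this contraction is
`2 n` times the required antisymmetrisation.
-/

noncomputable section

/-! ### Smooth sections -/

section SmoothSections

variable {E : Type*} [NormedAddCommGroup E] [NormedSpace ℝ E]
  {H : Type*} [TopologicalSpace H] {I : ModelWithCorners ℝ E H}
  {M : Type*} [TopologicalSpace M] [ChartedSpace H M]
  {F : Type*} [NormedAddCommGroup F] [NormedSpace ℝ F]
  {V : M → Type*} [TopologicalSpace (TotalSpace F V)] [∀ x, TopologicalSpace (V x)]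
  [FiberBundle F V]

theorem SmoothSection.diffSectionAt {σ : Π x, V x} (hσ : SmoothSection I F σ) (x : M) :
    DiffSectionAt I F σ x :=
  (hσ x).mdifferentiableAt (by simp)

theorem smoothSection_line_iff {f : Π x, Line M x} :
    SmoothSection I ℝ f ↔ ContMDiff I 𝓘(ℝ, ℝ) ∞ (f : M → ℝ) :=
  forall_congr' contMDiffAt_section

theorem exists_contMDiff_eventuallyEq_one [FiniteDimensional ℝ E] [T2Space M]
    [IsManifold I ∞ M] {x : M} {s : Set M} (hs : s ∈ 𝓝 x) :
    ∃ f : M → ℝ, ContMDiff I 𝓘(ℝ, ℝ) ∞ f ∧ tsupport f ⊆ interior s ∧ f =ᶠ[𝓝 x] 1 := by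
  obtain ⟨f, hf, -⟩ := ((SmoothBumpFunction.nhds_basis_support (I := I)
    (interior_mem_nhds.2 hs)).mem_iff).1 (Filter.univ_mem (f := 𝓝 x))
  exact ⟨f, f.contMDiff, hf, f.eventuallyEq_one⟩

variable [∀ x, AddCommGroup (V x)] [∀ x, Module ℝ (V x)] [VectorBundle ℝ F V]

namespace SmoothSection

variable {σ τ : Π x, V x}

theorem add (hσ : SmoothSection I F σ) (hτ : SmoothSection I F τ) :
    SmoothSection I F (fun y ↦ σ y + τ y) :=
  hσ.add_section hτ

theorem sub (hσ : SmoothSection I F σ) (hτ : SmoothSection I F τ) :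
    SmoothSection I F (fun y ↦ σ y - τ y) :=
  hσ.sub_section hτ

theorem const_smul (c : ℝ) (hσ : SmoothSection I F σ) :
    SmoothSection I F (fun y ↦ c • σ y) :=
  hσ.const_smul_section

theorem smul (hσ : SmoothSection I F σ) {f : M → ℝ} (hf : ContMDiff I 𝓘(ℝ, ℝ) ∞ f) :
    SmoothSection I F (fun y ↦ f y • σ y) :=
  hf.smul_section hσ

end SmoothSection

theorem exists_smoothSection_eventuallyEq [FiniteDimensional ℝ E] [T2Space M] [IsManifold I ∞ M]
    {σ : Π x, V x} {x : M} {s : Set M} (hs : s ∈ 𝓝 x)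
    (hσ : ContMDiffOn I (I.prod 𝓘(ℝ, F)) ∞ (fun y ↦ TotalSpace.mk' F y (σ y)) s) :
    ∃ τ : Π x, V x, SmoothSection I F τ ∧ ∀ᶠ y in 𝓝 x, τ y = σ y := by
  obtain ⟨f, hf, hfs, hf_one⟩ := exists_contMDiff_eventuallyEq_one (I := I) hs
  refine ⟨f • σ, hf.contMDiffOn.smul_section_of_tsupport isOpen_interior hfs
    (hσ.mono interior_subset), ?_⟩
  filter_upwards [hf_one] with y hy
  simp [hy]

variable (I F) in
theorem exists_smoothSection_eq [FiniteDimensional ℝ E] [T2Space M] [IsManifold I ∞ M]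
    [ContMDiffVectorBundle ∞ F V I] {x : M} (v : V x) :
    ∃ σ : Π x, V x, SmoothSection I F σ ∧ σ x = v := by
  obtain ⟨s, hs, h⟩ := FiberBundle.exists_contMDiffOn_extend I F v (k := ∞)
  obtain ⟨σ, hσ, hσv⟩ := exists_smoothSection_eventuallyEq hs h
  exact ⟨σ, hσ, by rw [hσv.self_of_nhds]; simp⟩

theorem SmoothSection.map_sum {W : Type*} [AddCommGroup W] {T : (Π x, V x) → W} {ι : Type*}
    (s : Finset ι) {σ : ι → Π x, V x}
    (hadd : ∀ σ τ : Π x, V x, SmoothSection I F σ → SmoothSection I F τ →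
      T (fun y ↦ σ y + τ y) = T σ + T τ)
    (hzero : T (fun _ ↦ 0) = 0) (hσ : ∀ i, SmoothSection I F (σ i)) :
    T (fun y ↦ ∑ i ∈ s, σ i y) = ∑ i ∈ s, T (σ i) := by
  classical
  induction s using Finset.induction_on with
  | empty => simpa using hzero
  | insert i s hi ih =>
    simp only [Finset.sum_insert hi]
    rw [hadd _ _ (hσ i) (ContMDiff.sum_section fun j _ ↦ hσ j), ih]

variable {F' : Type*} [NormedAddCommGroup F'] [NormedSpace ℝ F']
  {V' : M → Type*} [TopologicalSpace (TotalSpace F' V')]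
  [∀ x, AddCommGroup (V' x)] [∀ x, Module ℝ (V' x)] [∀ x, TopologicalSpace (V' x)]
  [∀ x, IsTopologicalAddGroup (V' x)] [∀ x, ContinuousSMul ℝ (V' x)]
  [FiberBundle F' V'] [VectorBundle ℝ F' V']

theorem SmoothSection.hom_apply {A : Π x, HomBundle V V' x} {σ : Π x, V x}
    (hA : SmoothSection I (HomFiber F F') A) (hσ : SmoothSection I F σ) :
    SmoothSection I F' (fun y ↦ A y (σ y)) :=
  ContMDiff.clm_bundle_apply hA hσ

namespace HomBundle

/-- The continuous linear map underlying an element of `Hom(V_x, V'_x)`, the form in which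
Mathlib's constructions for continuous linear maps apply to it. -/
def toCLM {x : M} (A : HomBundle V V' x) : V x →L[ℝ] V' x := A

variable (F F') in
/-- The expression at `y` of a family of homomorphisms, in the trivialisations around `x`. -/
def inCoordinates (A : Π x, HomBundle V V' x) (x y : M) : F →L[ℝ] F' :=
  ContinuousLinearMap.inCoordinates F V F' V' x y x y (A y).toCLM

end HomBundle

theorem smoothSection_hom_iff_inCoordinates {A : Π x, HomBundle V V' x} :
    SmoothSection I (HomFiber F F') A ↔
      ∀ x, ContMDiffAt I 𝓘(ℝ, F →L[ℝ] F') ∞ (HomBundle.inCoordinates F F' A x) x :=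
  forall_congr' fun _ ↦ (contMDiffAt_hom_bundle _).trans (and_iff_right contMDiffAt_id)

theorem contMDiffAt_clm_of_basis {ι : Type*} [Finite ι] [FiniteDimensional ℝ F]
    (b : Module.Basis ι ℝ F) {T : M → F →L[ℝ] F'} {x : M}
    (h : ∀ i, ContMDiffAt I 𝓘(ℝ, F') ∞ (fun y ↦ T y (b i)) x) :
    ContMDiffAt I 𝓘(ℝ, F →L[ℝ] F') ∞ T x := by
  have := Fintype.ofFinite ι
  have hT : T = fun y ↦ ∑ i, ContinuousLinearMap.smulRightL ℝ F F'
      (LinearMap.toContinuousLinearMap (b.coord i)) (T y (b i)) := by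
    ext y v
    conv_lhs => rw [← b.sum_repr v, map_sum]
    simp
  rw [hT]
  exact ContMDiffAt.sum fun i _ ↦ (ContinuousLinearMap.contMDiff _).contMDiffAt.comp x (h i)

theorem smoothSection_hom [FiniteDimensional ℝ E] [T2Space M] [IsManifold I ∞ M]
    [FiniteDimensional ℝ F] [ContMDiffVectorBundle ∞ F V I] {A : Π x, HomBundle V V' x}
    (h : ∀ σ : Π x, V x, SmoothSection I F σ → SmoothSection I F' (fun y ↦ A y (σ y))) :
    SmoothSection I (HomFiber F F') A := by
  refine smoothSection_hom_iff_inCoordinates.2 fun x ↦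
    contMDiffAt_clm_of_basis (Module.finBasis ℝ F) fun i ↦ ?_
  let b := Module.finBasis ℝ F
  let e := trivializationAt F V x
  have hx := e.open_baseSet.mem_nhds (FiberBundle.mem_baseSet_trivializationAt' x)
  obtain ⟨τ, hτ, hτ_eq⟩ := exists_smoothSection_eventuallyEq hx
    (e.contMDiffOn_localFrame_baseSet (I := I) ∞ b i)
  refine ((contMDiffAt_section x).1 (h τ hτ x)).congr_of_eventuallyEq ?_
  filter_upwards [hτ_eq, hx, (trivializationAt F' V' x).open_baseSet.mem_nhds
    (FiberBundle.mem_baseSet_trivializationAt' x)] with y hy hb hb'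
  rw [HomBundle.inCoordinates, ContinuousLinearMap.inCoordinates_eq hb hb', hy,
    e.localFrame_apply_of_mem_baseSet b hb]
  simp only [ContinuousLinearMap.comp_apply, ContinuousLinearEquiv.coe_coe,
    Trivialization.continuousLinearEquivAt_symm_apply, Trivialization.continuousLinearEquivAt_apply,
    Trivialization.basisAt, Module.Basis.map_apply, Trivialization.linearEquivAt_symm_apply]
  rfl

variable [∀ x, IsTopologicalAddGroup (V x)] [∀ x, ContinuousSMul ℝ (V x)]

theorem smoothSection_of_inverse [FiniteDimensional ℝ F]
    {A : Π x, HomBundle V V' x} {B : Π x, HomBundle V' V x}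
    (hA : SmoothSection I (HomFiber F F') A)
    (hAB : ∀ x v, A x (B x v) = v) (hBA : ∀ x v, B x (A x v) = v) :
    SmoothSection I (HomFiber F' F) B := by
  refine smoothSection_hom_iff_inCoordinates.2 fun x ↦ ?_
  let a := HomBundle.inCoordinates F F' A x
  let b := HomBundle.inCoordinates F' F B x
  have hab : ∀ᶠ y in 𝓝 x, (∀ v, a y (b y v) = v) ∧ ∀ v, b y (a y v) = v := by
    filter_upwards [(trivializationAt F V x).open_baseSet.mem_nhds
        (FiberBundle.mem_baseSet_trivializationAt' x),
        (trivializationAt F' V' x).open_baseSet.mem_nhds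
          (FiberBundle.mem_baseSet_trivializationAt' x)] with y hb hb'
    have hA' : ∀ v, (A y).toCLM ((B y).toCLM v) = v := hAB y
    have hB' : ∀ v, (B y).toCLM ((A y).toCLM v) = v := hBA y
    constructor <;> intro v <;>
    · simp only [a, b, HomBundle.inCoordinates]
      rw [ContinuousLinearMap.inCoordinates_eq hb hb', ContinuousLinearMap.inCoordinates_eq hb' hb]
      simp [hA', hB', hb, hb']
  let e (y : M) (h : (∀ v, a y (b y v) = v) ∧ ∀ v, b y (a y v) = v) : F ≃L[ℝ] F' :=
    ContinuousLinearEquiv.equivOfInverse (a y) (b y) h.2 h.1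
  have hb_eq : b =ᶠ[𝓝 x] fun y ↦ ContinuousLinearMap.inverse (a y) := by
    filter_upwards [hab] with y hy
    exact (ContinuousLinearMap.inverse_equiv (e y hy)).symm
  have hinv : ContMDiffAt 𝓘(ℝ, F →L[ℝ] F') 𝓘(ℝ, F' →L[ℝ] F) ∞
      (ContinuousLinearMap.inverse : (F →L[ℝ] F') → F' →L[ℝ] F) (a x) := by
    have : CompleteSpace F := FiniteDimensional.complete ℝ F
    exact contMDiffAt_iff_contDiffAt.2 (contDiffAt_map_inverse (e x hab.self_of_nhds))
  exact (hinv.comp x (smoothSection_hom_iff_inCoordinates.1 hA x)).congr_of_eventuallyEq hb_eq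

variable (F V) in
theorem exists_frame [ContMDiffVectorBundle ∞ F V I] [FiniteDimensional ℝ E] [T2Space M]
    [IsManifold I ∞ M]
    [FiniteDimensional ℝ F] [∀ x, T2Space (V x)] [∀ x, FiniteDimensional ℝ (V x)] (x : M) :
    ∃ (X : Fin (Module.finrank ℝ F) → Π y, V y)
      (ε : Fin (Module.finrank ℝ F) → Π y, HomBundle V (Line M) y),
    (∀ i, SmoothSection I F (X i)) ∧ (∀ i, SmoothSection I (HomFiber F ℝ) (ε i)) ∧
    ∀ᶠ y in 𝓝 x, ∀ v : V y, ∑ i, (ε i y v : ℝ) • X i y = v := by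
  let e := trivializationAt F V x
  let b := Module.finBasis ℝ F
  have hx := e.open_baseSet.mem_nhds (FiberBundle.mem_baseSet_trivializationAt' x)
  choose X hX hXe using fun i ↦ exists_smoothSection_eventuallyEq hx
    (e.contMDiffOn_localFrame_baseSet (I := I) ∞ b i)
  obtain ⟨f, hf, hfs, hf_one⟩ := exists_contMDiff_eventuallyEq_one (I := I) hx
  let ε (i : Fin (Module.finrank ℝ F)) (y : M) : HomBundle V (Line M) y :=
    HomBundle.ofLinear (V' := Line M) (f y • e.localFrameCoeff I b i y)
  refine ⟨X, ε, hX, fun i ↦ smoothSection_hom fun σ hσ ↦ ?_, ?_⟩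
  · have hcoeff : ContMDiffOn I 𝓘(ℝ, ℝ) ∞ (fun y ↦ e.localFrameCoeff I b i y (σ y)) e.baseSet :=
      contMDiffOn_baseSet_localFrameCoeff b hσ.contMDiffOn i
    exact hf.contMDiffOn.smul_section_of_tsupport (V := Line M) isOpen_interior hfs
      fun y hy ↦ contMDiffWithinAt_section.2 (hcoeff.mono interior_subset y hy)
  · filter_upwards [hx, Filter.eventually_all.2 hXe, hf_one] with y hy hXy hfy v
    have hsum := e.eq_sum_localFrameCoeff_smul (I := I) (b := b)
      (s := fun z ↦ (FiberBundle.extend F v : Π z, V z) z) hy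
    simp only [FiberBundle.extend_apply_self] at hsum
    conv_rhs => rw [hsum]
    exact Finset.sum_congr rfl fun i _ ↦ by simp [hXy, ε, hfy]

section Tensorial

variable {W : Type*} [AddCommGroup W] [Module ℝ W] {T : (Π x, V x) → W} {x : M}

theorem SmoothSection.map_eq_of_eq [ContMDiffVectorBundle ∞ F V I] [FiniteDimensional ℝ E]
    [T2Space M] [IsManifold I ∞ M] [FiniteDimensional ℝ F] [∀ x, T2Space (V x)]
    [∀ x, FiniteDimensional ℝ (V x)]
    (hadd : ∀ σ τ : Π x, V x, SmoothSection I F σ → SmoothSection I F τ →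
      T (fun y ↦ σ y + τ y) = T σ + T τ)
    (hsmul : ∀ (f : M → ℝ) (σ : Π x, V x), ContMDiff I 𝓘(ℝ, ℝ) ∞ f → SmoothSection I F σ →
      T (fun y ↦ f y • σ y) = f x • T σ)
    {σ τ : Π x, V x} (hσ : SmoothSection I F σ) (hτ : SmoothSection I F τ) (h : σ x = τ x) :
    T σ = T τ := by
  obtain ⟨X, ε, hX, hε, hXε⟩ := exists_frame (I := I) F V x
  obtain ⟨f, hf, hfs, hf_one⟩ := exists_contMDiff_eventuallyEq_one (I := I) hXε
  have hfx : f x = 1 := hf_one.self_of_nhds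
  suffices expand : ∀ {σ : Π x, V x}, SmoothSection I F σ →
      T σ = ∑ i, (ε i x (σ x) : ℝ) • T (X i) by
    rw [expand hσ, expand hτ, h]
  intro σ hσ
  have hc (i) : ContMDiff I 𝓘(ℝ, ℝ) ∞ (fun y ↦ (ε i y (σ y) : ℝ)) :=
    smoothSection_line_iff.1 ((hε i).hom_apply hσ)
  have hcX (i) : SmoothSection I F (fun y ↦ (ε i y (σ y) : ℝ) • X i y) := (hX i).smul (hc i)
  have hzero : T (fun _ ↦ 0) = 0 := by
    simpa using hsmul (fun _ ↦ 0) σ contMDiff_const hσ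
  have hf_smul : (fun y ↦ f y • σ y) = fun y ↦ f y • ∑ i, (ε i y (σ y) : ℝ) • X i y := by
    funext y
    by_cases hy : f y = 0
    · simp [hy]
    · have hys := interior_subset (hfs (subset_tsupport f hy))
      exact congrArg (f y • ·) (hys (σ y)).symm
  calc T σ = T (fun y ↦ f y • σ y) := by rw [hsmul f σ hf hσ, hfx, one_smul]
    _ = T (fun y ↦ ∑ i, (ε i y (σ y) : ℝ) • X i y) := by
      rw [hf_smul, hsmul f _ hf (ContMDiff.sum_section fun i _ ↦ hcX i), hfx, one_smul]
    _ = ∑ i, T (fun y ↦ (ε i y (σ y) : ℝ) • X i y) := SmoothSection.map_sum _ hadd hzero hcX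
    _ = ∑ i, (ε i x (σ x) : ℝ) • T (X i) := Finset.sum_congr rfl fun i _ ↦ hsmul _ _ (hc i) (hX i)

end Tensorial

end SmoothSections

/-! ### Smooth covariant derivatives -/

section SmoothConnections

open CovariantDerivative FedosovStructure

variable {E : Type*} [NormedAddCommGroup E] [NormedSpace ℝ E]
  {M : Type*} [TopologicalSpace M] [ChartedSpace E M]

theorem contMDiff_mvfderiv_apply [IsManifold 𝓘(ℝ, E) ∞ M] {f : M → ℝ}
    (hf : ContMDiff 𝓘(ℝ, E) 𝓘(ℝ, ℝ) ∞ f)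
    {U : Π x, Tan E M x} (hU : SmoothSection 𝓘(ℝ, E) E U) :
    ContMDiff 𝓘(ℝ, E) 𝓘(ℝ, ℝ) ∞ (fun y ↦ mvfderiv 𝓘(ℝ, E) f y (U y)) :=
  (contMDiff_snd_tangentBundle_modelSpace ℝ 𝓘(ℝ, ℝ)).comp
    ((hf.contMDiff_tangentMap (m := ∞) (by simp)).comp hU)

theorem exists_contMDiff_mvfderiv_eq [FiniteDimensional ℝ E] [T2Space M]
    [IsManifold 𝓘(ℝ, E) ∞ M] (x : M) (φ : Tan E M x →L[ℝ] ℝ) :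
    ∃ f : M → ℝ, ContMDiff 𝓘(ℝ, E) 𝓘(ℝ, ℝ) ∞ f ∧ f x = 0 ∧ mvfderiv 𝓘(ℝ, E) f x = φ := by
  obtain ⟨L, hL⟩ := isInvertible_mfderiv_extChartAt (I := 𝓘(ℝ, E))
    (mem_extChartAt_source (I := 𝓘(ℝ, E)) x)
  let ψ : E →L[ℝ] ℝ := φ ∘L L.symm.toContinuousLinearMap
  let g : M → ℝ := fun y ↦ ψ (extChartAt 𝓘(ℝ, E) x y - extChartAt 𝓘(ℝ, E) x x)
  have hg_smooth : ContMDiffOn 𝓘(ℝ, E) 𝓘(ℝ, ℝ) ∞ g (chartAt E x).source := fun y hy ↦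
    (ψ.contMDiff.contMDiffAt.comp y
      ((contMDiffAt_extChartAt' hy).sub contMDiffAt_const)).contMDiffWithinAt
  have hg_deriv : HasMFDerivAt 𝓘(ℝ, E) 𝓘(ℝ, ℝ) g x (φ : Tan E M x →L[ℝ] ℝ) := by
    have hchart := (mdifferentiableAt_extChartAt (I := 𝓘(ℝ, E))
      (mem_chart_source E x)).hasMFDerivAt
    rw [← hL] at hchart
    have hψ : HasMFDerivAt 𝓘(ℝ, E) 𝓘(ℝ, ℝ) (fun z ↦ ψ (z - extChartAt 𝓘(ℝ, E) x x))
        (extChartAt 𝓘(ℝ, E) x x) ψ :=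
      (ψ.hasFDerivAt.comp _ ((hasFDerivAt_id _).sub_const _)).hasMFDerivAt
    refine (hψ.comp x hchart).congr_mfderiv ?_
    ext u
    exact congrArg φ (L.symm_apply_apply u)
  obtain ⟨f, hf, hfg⟩ := exists_smoothSection_eventuallyEq (V := Line M) (F := ℝ) (σ := g)
    ((chartAt E x).open_source.mem_nhds (mem_chart_source E x))
    fun y hy ↦ contMDiffWithinAt_section.2 (hg_smooth y hy)
  exact ⟨f, smoothSection_line_iff.1 hf, by simp [hfg.self_of_nhds, g],
    (hg_deriv.congr_of_eventuallyEq hfg).mfderiv⟩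

variable {F : Type*} [NormedAddCommGroup F] [NormedSpace ℝ F]
  {V : M → Type*} [TopologicalSpace (TotalSpace F V)]
  [∀ x, AddCommGroup (V x)] [∀ x, Module ℝ (V x)] [∀ x, TopologicalSpace (V x)]
  [∀ x, IsTopologicalAddGroup (V x)] [∀ x, ContinuousSMul ℝ (V x)]
  [FiberBundle F V] {D : CovariantDerivative 𝓘(ℝ, E) F V}

namespace DiffSectionAt

variable {σ τ : Π x, V x} {x : M}

theorem covDeriv_add (hσ : DiffSectionAt 𝓘(ℝ, E) F σ x) (hτ : DiffSectionAt 𝓘(ℝ, E) F τ x)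
    (u : Tan E M x) : D (fun y ↦ σ y + τ y) x u = D σ x u + D τ x u :=
  congr($(D.isCovariantDerivativeOnUniv.add hσ hτ) u)

theorem covDeriv_smul {f : M → ℝ} (hf : MDifferentiableAt 𝓘(ℝ, E) 𝓘(ℝ, ℝ) f x)
    (hσ : DiffSectionAt 𝓘(ℝ, E) F σ x) (u : Tan E M x) :
    D (fun y ↦ f y • σ y) x u = f x • D σ x u + (mvfderiv 𝓘(ℝ, E) f x u) • σ x :=
  congr($(D.isCovariantDerivativeOnUniv.leibniz hσ hf) u)

theorem covDeriv_const_smul (c : ℝ) (hσ : DiffSectionAt 𝓘(ℝ, E) F σ x) (u : Tan E M x) :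
    D (fun y ↦ c • σ y) x u = c • D σ x u :=
  congr($(D.isCovariantDerivativeOnUniv.smul_const c hσ) u)

theorem covDeriv_congr (hσ : DiffSectionAt 𝓘(ℝ, E) F σ x) (hτ : DiffSectionAt 𝓘(ℝ, E) F τ x)
    (h : ∀ᶠ y in 𝓝 x, σ y = τ y) : D σ x = D τ x :=
  D.isCovariantDerivativeOnUniv.congr_of_eventuallyEq hσ hτ Filter.univ_mem h

theorem covDeriv_sub [VectorBundle ℝ F V] (hσ : DiffSectionAt 𝓘(ℝ, E) F σ x)
    (hτ : DiffSectionAt 𝓘(ℝ, E) F τ x) (u : Tan E M x) :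
    D (fun y ↦ σ y - τ y) x u = D σ x u - D τ x u := by
  have hneg : DiffSectionAt 𝓘(ℝ, E) F (fun y ↦ (-1 : ℝ) • τ y) x :=
    mdifferentiableAt_const.smul_section hτ
  have h := covDeriv_add (D := D) hσ hneg u
  rw [covDeriv_const_smul (-1) hτ] at h
  simpa only [neg_smul, one_smul, ← sub_eq_add_neg] using h

end DiffSectionAt

variable [VectorBundle ℝ F V]

theorem SmoothSection.covDeriv_sum {ι : Type*} (s : Finset ι) {σ : ι → Π x, V x}
    (hσ : ∀ i, SmoothSection 𝓘(ℝ, E) F (σ i)) (x : M) (u : Tan E M x) :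
    D (fun y ↦ ∑ i ∈ s, σ i y) x u = ∑ i ∈ s, D (σ i) x u :=
  SmoothSection.map_sum (T := fun σ ↦ D σ x u) s
    (fun _ _ hσ hτ ↦ DiffSectionAt.covDeriv_add (hσ.diffSectionAt x) (hτ.diffSectionAt x) u)
    congr($(D.zero) x u) hσ

section Smoothness

variable [IsManifold 𝓘(ℝ, E) ∞ M]

theorem SmoothSection.derivSection [ContMDiffCovariantDerivative D ∞] {σ : Π x, V x}
    (hσ : SmoothSection 𝓘(ℝ, E) F σ) :
    SmoothSection 𝓘(ℝ, E) (HomFiber E F) (derivSection D σ) :=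
  contMDiffOn_univ.1 (ContMDiffCovariantDerivative.contMDiff.contMDiff (σ := σ)
    (by simpa using hσ.contMDiffOn))

theorem SmoothSection.covDeriv_apply [ContMDiffCovariantDerivative D ∞] {σ : Π x, V x}
    (hσ : SmoothSection 𝓘(ℝ, E) F σ) {U : Π x, Tan E M x} (hU : SmoothSection 𝓘(ℝ, E) E U) :
    SmoothSection 𝓘(ℝ, E) F (fun y ↦ D σ y (U y)) :=
  hσ.derivSection.hom_apply hU

theorem contMDiffCovariantDerivative_of_apply [FiniteDimensional ℝ E] [T2Space M]
    (h : ∀ σ : Π x, V x, SmoothSection 𝓘(ℝ, E) F σ → ∀ U : Π x, Tan E M x,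
      SmoothSection 𝓘(ℝ, E) E U → SmoothSection 𝓘(ℝ, E) F (fun y ↦ D σ y (U y))) :
    ContMDiffCovariantDerivative D ∞ where
  contMDiff :=
    { contMDiff := fun {σ} hσ ↦ ContMDiff.contMDiffOn
        (smoothSection_hom (A := FedosovStructure.derivSection D σ) fun U hU ↦
          h σ (contMDiffOn_univ.1 (by simpa using hσ)) U hU) }

instance [FiniteDimensional ℝ E] [T2Space M] :
    ContMDiffCovariantDerivative (trivialLine 𝓘(ℝ, E) M) ∞ :=
  contMDiffCovariantDerivative_of_apply fun _ hσ _ hU ↦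
    smoothSection_line_iff.2 (contMDiff_mvfderiv_apply (smoothSection_line_iff.1 hσ) hU)

theorem exists_smoothSection_covDeriv_eq [FiniteDimensional ℝ E] [T2Space M]
    [ContMDiffVectorBundle ∞ F V 𝓘(ℝ, E)]
    (D : CovariantDerivative 𝓘(ℝ, E) F V) (x : M) (L : Tan E M x →L[ℝ] V x) :
    ∃ σ : Π y, V y, SmoothSection 𝓘(ℝ, E) F σ ∧ σ x = 0 ∧ D σ x = L := by
  let b := Module.finBasis ℝ (Tan E M x)
  choose f hf hfx hdf using fun i ↦
    exists_contMDiff_mvfderiv_eq x (LinearMap.toContinuousLinearMap (b.coord i))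
  choose τ hτ hτx using fun i ↦ exists_smoothSection_eq 𝓘(ℝ, E) F (L (b i))
  have hfτ (i) : SmoothSection 𝓘(ℝ, E) F (fun y ↦ f i y • τ i y) := (hτ i).smul (hf i)
  refine ⟨fun y ↦ ∑ i, f i y • τ i y, ContMDiff.sum_section fun i _ ↦ hfτ i, by simp [hfx], ?_⟩
  ext u
  rw [SmoothSection.covDeriv_sum _ hfτ]
  calc ∑ i, D (fun y ↦ f i y • τ i y) x u = ∑ i, b.repr u i • L (b i) := by
        refine Finset.sum_congr rfl fun i _ ↦ ?_
        rw [DiffSectionAt.covDeriv_smul ((hf i).mdifferentiable (by simp) x)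
          ((hτ i).diffSectionAt x), hfx, hdf, hτx]
        simp
    _ = L u := by simp only [← map_smul, ← map_sum, b.sum_repr]

theorem exists_smoothSection_parallelAt [FiniteDimensional ℝ E] [T2Space M]
    [ContMDiffVectorBundle ∞ F V 𝓘(ℝ, E)]
    (D : CovariantDerivative 𝓘(ℝ, E) F V) (x : M) (v : V x) :
    ∃ σ : Π y, V y, SmoothSection 𝓘(ℝ, E) F σ ∧ σ x = v ∧ D σ x = 0 := by
  obtain ⟨σ, hσ, hσx⟩ := exists_smoothSection_eq 𝓘(ℝ, E) F v
  obtain ⟨τ, hτ, hτx, hDτ⟩ := exists_smoothSection_covDeriv_eq D x (D σ x)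
  refine ⟨fun y ↦ σ y - τ y, hσ.sub hτ, by simp [hσx, hτx], ?_⟩
  ext u
  rw [DiffSectionAt.covDeriv_sub (hσ.diffSectionAt x) (hτ.diffSectionAt x), hDτ, sub_self]
  rfl

end Smoothness

section Hom

variable [FiniteDimensional ℝ E] [FiniteDimensional ℝ F]
  {F' : Type*} [NormedAddCommGroup F'] [NormedSpace ℝ F']
  {V' : M → Type*} [TopologicalSpace (TotalSpace F' V')]
  [∀ x, AddCommGroup (V' x)] [∀ x, Module ℝ (V' x)] [∀ x, TopologicalSpace (V' x)]
  [∀ x, IsTopologicalAddGroup (V' x)] [∀ x, ContinuousSMul ℝ (V' x)]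
  [FiberBundle F' V'] [VectorBundle ℝ F' V'] {D' : CovariantDerivative 𝓘(ℝ, E) F' V'}

theorem SmoothSection.covDeriv_hom_apply [ContMDiffVectorBundle 1 F V 𝓘(ℝ, E)]
    {A : Π x, HomBundle V V' x} {σ : Π x, V x}
    (hA : SmoothSection 𝓘(ℝ, E) (HomFiber F F') A) (hσ : SmoothSection 𝓘(ℝ, E) F σ)
    (x : M) (u : Tan E M x) :
    D' (fun y ↦ A y (σ y)) x u = (hom D D' A x u : HomBundle V V' x) (σ x) + A x (D σ x u) := by
  rw [CovariantDerivative.hom_apply D D' (hA.diffSectionAt x) (hσ.diffSectionAt x) u,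
    sub_add_cancel]

theorem SmoothSection.hom_apply_of_parallelAt [ContMDiffVectorBundle 1 F V 𝓘(ℝ, E)]
    {A : Π x, HomBundle V V' x} {σ : Π x, V x}
    (hA : SmoothSection 𝓘(ℝ, E) (HomFiber F F') A) (hσ : SmoothSection 𝓘(ℝ, E) F σ)
    {x : M} (hσx : D σ x = 0) (u : Tan E M x) :
    (hom D D' A x u : HomBundle V V' x) (σ x) = D' (fun y ↦ A y (σ y)) x u := by
  rw [hA.covDeriv_hom_apply (D := D) hσ, hσx, zero_apply, map_zero, add_zero]

theorem SmoothSection.derivSection_apply_of_parallelAt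
    [ContMDiffVectorBundle 1 F V 𝓘(ℝ, E)] {A : Π x, HomBundle V V' x} {σ : Π x, V x}
    (hA : SmoothSection 𝓘(ℝ, E) (HomFiber F F') A) (hσ : SmoothSection 𝓘(ℝ, E) F σ)
    {x : M} (hσx : D σ x = 0) (u : Tan E M x) :
    FedosovStructure.derivSection (hom D D') A x u (σ x) = D' (fun y ↦ A y (σ y)) x u :=
  hA.hom_apply_of_parallelAt hσ hσx u

instance [T2Space M] [IsManifold 𝓘(ℝ, E) ∞ M] [ContMDiffVectorBundle ∞ F V 𝓘(ℝ, E)]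
    [ContMDiffCovariantDerivative D ∞] [ContMDiffCovariantDerivative D' ∞] :
    ContMDiffCovariantDerivative (hom D D') ∞ := by
  refine contMDiffCovariantDerivative_of_apply fun A hA U hU ↦ smoothSection_hom fun σ hσ ↦ ?_
  have h := ((hA.hom_apply hσ).covDeriv_apply (D := D') hU).sub
    (hA.hom_apply (hσ.covDeriv_apply (D := D) hU))
  convert h using 3 with y
  exact CovariantDerivative.hom_apply D D' (hA.diffSectionAt y) (hσ.diffSectionAt y) (U y)

end Hom

end SmoothConnections

/-! ### The curvature of a connection -/

section LieBracket

open VectorField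

variable {E : Type*} [NormedAddCommGroup E] [NormedSpace ℝ E] [FiniteDimensional ℝ E]
  {M : Type*} [TopologicalSpace M] [ChartedSpace E M] [IsManifold 𝓘(ℝ, E) ∞ M]
  {U W : Π x, Tan E M x}

theorem smoothSection_mlieBracket (hU : SmoothSection 𝓘(ℝ, E) E U)
    (hW : SmoothSection 𝓘(ℝ, E) E W) :
    SmoothSection 𝓘(ℝ, E) E (mlieBracket 𝓘(ℝ, E) U W) := by
  have := FiniteDimensional.complete ℝ E
  have : IsManifold 𝓘(ℝ, E) ((⊤ : ℕ∞) + 1) M := by simpa using ‹IsManifold 𝓘(ℝ, E) ∞ M›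
  have : IsManifold 𝓘(ℝ, E) (minSmoothness ℝ 2) M := by
    rw [minSmoothness_of_isRCLikeNormedField]
    infer_instance
  exact fun x ↦ (hU x).mlieBracket_vectorField (m := ⊤) (n := ⊤) (hW x) (by simp)

theorem mlieBracket_mlieBracket_smul (U : Π x, Tan E M x)
    (hW : SmoothSection 𝓘(ℝ, E) E W) {Z : Π x, Tan E M x} (hZ : SmoothSection 𝓘(ℝ, E) E Z)
    {f : M → ℝ} (hf : ContMDiff 𝓘(ℝ, E) 𝓘(ℝ, ℝ) ∞ f) (x : M) :
    mlieBracket 𝓘(ℝ, E) U (mlieBracket 𝓘(ℝ, E) W (f • Z)) x =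
      mvfderiv 𝓘(ℝ, E) (fun y ↦ mvfderiv 𝓘(ℝ, E) f y (W y)) x (U x) • Z x +
      mvfderiv 𝓘(ℝ, E) f x (W x) • mlieBracket 𝓘(ℝ, E) U Z x +
      (mvfderiv 𝓘(ℝ, E) f x (U x) • mlieBracket 𝓘(ℝ, E) W Z x +
        f x • mlieBracket 𝓘(ℝ, E) U (mlieBracket 𝓘(ℝ, E) W Z) x) := by
  have hWf := contMDiff_mvfderiv_apply hf hW
  have hWZ := smoothSection_mlieBracket hW hZ
  have hf' (y) := hf.mdifferentiable (by simp) y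
  have hWf' := hWf.mdifferentiable (by simp) x
  have inner : mlieBracket 𝓘(ℝ, E) W (f • Z) =
      (fun y ↦ mvfderiv 𝓘(ℝ, E) f y (W y)) • Z + f • mlieBracket 𝓘(ℝ, E) W Z :=
    funext fun y ↦ mlieBracket_smul_right (hf' y) (hZ.diffSectionAt y)
  rw [inner, mlieBracket_add_right (SmoothSection.diffSectionAt (hWf.smul_section hZ) x)
      (SmoothSection.diffSectionAt (hf.smul_section hWZ) x),
    mlieBracket_smul_right hWf' (hZ.diffSectionAt x),
    mlieBracket_smul_right (hf' x) (hWZ.diffSectionAt x)]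

theorem mlieBracket_jacobi (hU : SmoothSection 𝓘(ℝ, E) E U)
    (hW : SmoothSection 𝓘(ℝ, E) E W) {Z : Π x, Tan E M x} (hZ : SmoothSection 𝓘(ℝ, E) E Z)
    (x : M) :
    mlieBracket 𝓘(ℝ, E) U (mlieBracket 𝓘(ℝ, E) W Z) x =
      mlieBracket 𝓘(ℝ, E) (mlieBracket 𝓘(ℝ, E) U W) Z x +
        mlieBracket 𝓘(ℝ, E) W (mlieBracket 𝓘(ℝ, E) U Z) x := by
  have := FiniteDimensional.complete ℝ E
  have : IsManifold 𝓘(ℝ, E) (minSmoothness ℝ 3) M := by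
    rw [minSmoothness_of_isRCLikeNormedField]
    infer_instance
  have h2 : minSmoothness ℝ 2 ≤ ∞ := by
    simpa using (ENat.LEInfty.out : (2 : WithTop ℕ∞) ≤ ∞)
  exact leibniz_identity_mlieBracket_apply ((hU x).of_le h2) ((hW x).of_le h2) ((hZ x).of_le h2)

/- Applying the Jacobi identity to `U`, `W` and `f • Z` and comparing the coefficients of `Z` gives
the claim without computing in charts. -/
theorem mvfderiv_mlieBracket [T2Space M] (hU : SmoothSection 𝓘(ℝ, E) E U)
    (hW : SmoothSection 𝓘(ℝ, E) E W) {f : M → ℝ} (hf : ContMDiff 𝓘(ℝ, E) 𝓘(ℝ, ℝ) ∞ f) (x : M) :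
    mvfderiv 𝓘(ℝ, E) f x (mlieBracket 𝓘(ℝ, E) U W x) =
      mvfderiv 𝓘(ℝ, E) (fun y ↦ mvfderiv 𝓘(ℝ, E) f y (W y)) x (U x) -
        mvfderiv 𝓘(ℝ, E) (fun y ↦ mvfderiv 𝓘(ℝ, E) f y (U y)) x (W x) := by
  have smul_eq (z : Tan E M x) :
      (mvfderiv 𝓘(ℝ, E) (fun y ↦ mvfderiv 𝓘(ℝ, E) f y (W y)) x (U x) -
        mvfderiv 𝓘(ℝ, E) (fun y ↦ mvfderiv 𝓘(ℝ, E) f y (U y)) x (W x)) • z =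
      mvfderiv 𝓘(ℝ, E) f x (mlieBracket 𝓘(ℝ, E) U W x) • z := by
    obtain ⟨Z, hZ, rfl⟩ := exists_smoothSection_eq 𝓘(ℝ, E) E z
    have jacobi_smul := mlieBracket_jacobi hU hW (Z := f • Z) (hZ.smul hf) x
    rw [mlieBracket_mlieBracket_smul U hW hZ hf, mlieBracket_mlieBracket_smul W hU hZ hf,
      mlieBracket_smul_right (hf.mdifferentiable (by simp) x) (hZ.diffSectionAt x),
      mlieBracket_jacobi hU hW hZ] at jacobi_smul
    rw [← sub_eq_zero] at jacobi_smul ⊢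
    rw [← jacobi_smul]
    module
  rcases subsingleton_or_nontrivial (Tan E M x) with _ | _
  · rw [Subsingleton.elim (mlieBracket 𝓘(ℝ, E) U W x) 0, Subsingleton.elim (U x) 0,
      Subsingleton.elim (W x) 0]
    simp
  · obtain ⟨z, hz⟩ := exists_ne (0 : Tan E M x)
    exact (smul_left_injective ℝ hz (smul_eq z)).symm

end LieBracket

namespace FedosovStructure

variable {E : Type*} [NormedAddCommGroup E] [NormedSpace ℝ E] [FiniteDimensional ℝ E]
  {M : Type*} [TopologicalSpace M] [ChartedSpace E M] [IsManifold 𝓘(ℝ, E) ∞ M] {n : ℕ}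
  (𝓕 : FedosovStructure E M n)

open CovariantDerivative

instance : ContMDiffCovariantDerivative 𝓕.conn ∞ := 𝓕.conn_smooth

theorem mlieBracket_eq {U W : Π x, Tan E M x} (hU : SmoothSection 𝓘(ℝ, E) E U)
    (hW : SmoothSection 𝓘(ℝ, E) E W) (x : M) :
    VectorField.mlieBracket 𝓘(ℝ, E) U W x = 𝓕.conn W x (U x) - 𝓕.conn U x (W x) :=
  ((𝓕.conn.torsion_eq_zero_iff.1 𝓕.torsion_eq_zero) (hU.diffSectionAt x)
    (hW.diffSectionAt x)).symm

section Curvature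

variable {F : Type*} [NormedAddCommGroup F] [NormedSpace ℝ F]
  {V : M → Type*} [TopologicalSpace (TotalSpace F V)]
  [∀ x, AddCommGroup (V x)] [∀ x, Module ℝ (V x)] [∀ x, TopologicalSpace (V x)]
  [∀ x, IsTopologicalAddGroup (V x)] [∀ x, ContinuousSMul ℝ (V x)]
  [FiberBundle F V] [VectorBundle ℝ F V]
  {D : CovariantDerivative 𝓘(ℝ, E) F V} [ContMDiffCovariantDerivative D ∞]

theorem secondDeriv_apply {σ : Π x, V x} (hσ : SmoothSection 𝓘(ℝ, E) F σ) {W : Π x, Tan E M x}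
    (hW : SmoothSection 𝓘(ℝ, E) E W) (x : M) (u : Tan E M x) :
    𝓕.secondDeriv D σ x u (W x) = D (fun y ↦ D σ y (W y)) x u - D σ x (𝓕.conn W x u) :=
  CovariantDerivative.hom_apply 𝓕.conn D (hσ.derivSection.diffSectionAt x) (hW.diffSectionAt x) u

theorem secondDeriv_apply_of_parallelAt {σ : Π x, V x} (hσ : SmoothSection 𝓘(ℝ, E) F σ)
    {W : Π x, Tan E M x} (hW : SmoothSection 𝓘(ℝ, E) E W) {x : M} (hWx : 𝓕.conn W x = 0)
    (u : Tan E M x) : 𝓕.secondDeriv D σ x u (W x) = D (fun y ↦ D σ y (W y)) x u :=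
  hσ.derivSection.hom_apply_of_parallelAt hW hWx u

theorem curv_eq_of_parallelAt {σ : Π x, V x} (hσ : SmoothSection 𝓘(ℝ, E) F σ)
    {U W : Π x, Tan E M x} (hU : SmoothSection 𝓘(ℝ, E) E U) (hW : SmoothSection 𝓘(ℝ, E) E W)
    {x : M} (hUx : 𝓕.conn U x = 0) (hWx : 𝓕.conn W x = 0) :
    𝓕.curv D σ x (U x) (W x) =
      D (fun y ↦ D σ y (W y)) x (U x) - D (fun y ↦ D σ y (U y)) x (W x) := by
  rw [curv, 𝓕.secondDeriv_apply_of_parallelAt hσ hU hUx,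
    𝓕.secondDeriv_apply_of_parallelAt hσ hW hWx]

theorem curv_trivialLine [T2Space M] {f : M → ℝ} (hf : ContMDiff 𝓘(ℝ, E) 𝓘(ℝ, ℝ) ∞ f) (x : M)
    (u v : Tan E M x) : 𝓕.curv (trivialLine 𝓘(ℝ, E) M) f x u v = 0 := by
  obtain ⟨U, hU, rfl⟩ := exists_smoothSection_eq 𝓘(ℝ, E) E u
  obtain ⟨W, hW, rfl⟩ := exists_smoothSection_eq 𝓘(ℝ, E) E v
  have hf' : SmoothSection 𝓘(ℝ, E) ℝ (V := Line M) f := smoothSection_line_iff.2 hf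
  have bracket := mvfderiv_mlieBracket hU hW hf x
  rw [𝓕.mlieBracket_eq hU hW, map_sub] at bracket
  rw [curv, 𝓕.secondDeriv_apply hf' hU, 𝓕.secondDeriv_apply hf' hW]
  change (mvfderiv 𝓘(ℝ, E) (fun y ↦ mvfderiv 𝓘(ℝ, E) f y (W y)) x (U x) -
    mvfderiv 𝓘(ℝ, E) f x (𝓕.conn W x (U x))) -
    (mvfderiv 𝓘(ℝ, E) (fun y ↦ mvfderiv 𝓘(ℝ, E) f y (U y)) x (W x) -
    mvfderiv 𝓘(ℝ, E) f x (𝓕.conn U x (W x))) = (0 : ℝ)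
  linarith

section Tensoriality

variable [T2Space M]

theorem curv_add {σ τ : Π x, V x} (hσ : SmoothSection 𝓘(ℝ, E) F σ)
    (hτ : SmoothSection 𝓘(ℝ, E) F τ) (x : M) (u v : Tan E M x) :
    𝓕.curv D (fun y ↦ σ y + τ y) x u v = 𝓕.curv D σ x u v + 𝓕.curv D τ x u v := by
  obtain ⟨U, hU, rfl, hUx⟩ := exists_smoothSection_parallelAt 𝓕.conn x u
  obtain ⟨W, hW, rfl, hWx⟩ := exists_smoothSection_parallelAt 𝓕.conn x v
  have covDeriv_covDeriv_add {A : Π x, Tan E M x} (hA : SmoothSection 𝓘(ℝ, E) E A)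
      (u : Tan E M x) : D (fun y ↦ D (fun z ↦ σ z + τ z) y (A y)) x u =
        D (fun y ↦ D σ y (A y)) x u + D (fun y ↦ D τ y (A y)) x u := by
    rw [← DiffSectionAt.covDeriv_add ((hσ.covDeriv_apply hA).diffSectionAt x)
      ((hτ.covDeriv_apply hA).diffSectionAt x)]
    congr 3 with y
    exact DiffSectionAt.covDeriv_add (hσ.diffSectionAt y) (hτ.diffSectionAt y) (A y)
  rw [𝓕.curv_eq_of_parallelAt hσ hU hW hUx hWx, 𝓕.curv_eq_of_parallelAt hτ hU hW hUx hWx,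
    𝓕.curv_eq_of_parallelAt (hσ.add hτ) hU hW hUx hWx]
  rw [covDeriv_covDeriv_add hU, covDeriv_covDeriv_add hW]
  abel

theorem mvfderiv_comm_of_parallelAt {f : M → ℝ} (hf : ContMDiff 𝓘(ℝ, E) 𝓘(ℝ, ℝ) ∞ f)
    {U W : Π x, Tan E M x} (hU : SmoothSection 𝓘(ℝ, E) E U) (hW : SmoothSection 𝓘(ℝ, E) E W)
    {x : M} (hUx : 𝓕.conn U x = 0) (hWx : 𝓕.conn W x = 0) :
    mvfderiv 𝓘(ℝ, E) (fun y ↦ mvfderiv 𝓘(ℝ, E) f y (W y)) x (U x) =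
      mvfderiv 𝓘(ℝ, E) (fun y ↦ mvfderiv 𝓘(ℝ, E) f y (U y)) x (W x) := by
  have bracket := mvfderiv_mlieBracket hU hW hf x
  simp only [𝓕.mlieBracket_eq hU hW, hUx, hWx, zero_apply, sub_self, map_zero] at bracket
  exact sub_eq_zero.1 bracket.symm

theorem curv_smul {f : M → ℝ} (hf : ContMDiff 𝓘(ℝ, E) 𝓘(ℝ, ℝ) ∞ f)
    {σ : Π x, V x} (hσ : SmoothSection 𝓘(ℝ, E) F σ) (x : M) (u v : Tan E M x) :
    𝓕.curv D (fun y ↦ f y • σ y) x u v = f x • 𝓕.curv D σ x u v := by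
  obtain ⟨U, hU, rfl, hUx⟩ := exists_smoothSection_parallelAt 𝓕.conn x u
  obtain ⟨W, hW, rfl, hWx⟩ := exists_smoothSection_parallelAt 𝓕.conn x v
  have hf' (y) := hf.mdifferentiable (by simp) y
  have covDeriv_covDeriv_smul {A : Π x, Tan E M x} (hA : SmoothSection 𝓘(ℝ, E) E A)
      (u : Tan E M x) : D (fun y ↦ D (fun z ↦ f z • σ z) y (A y)) x u =
        (f x • D (fun y ↦ D σ y (A y)) x u + mvfderiv 𝓘(ℝ, E) f x u • D σ x (A x)) +
        (mvfderiv 𝓘(ℝ, E) f x (A x) • D σ x u +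
          mvfderiv 𝓘(ℝ, E) (fun y ↦ mvfderiv 𝓘(ℝ, E) f y (A y)) x u • σ x) := by
    have hDσ := hσ.covDeriv_apply (D := D) hA
    have hAf := contMDiff_mvfderiv_apply hf hA
    rw [← DiffSectionAt.covDeriv_smul (hf' x) (hDσ.diffSectionAt x),
      ← DiffSectionAt.covDeriv_smul (hAf.mdifferentiable (by simp) x) (hσ.diffSectionAt x),
      ← DiffSectionAt.covDeriv_add
        ((hDσ.smul hf).diffSectionAt x) ((hσ.smul hAf).diffSectionAt x)]
    congr 3 with y
    exact DiffSectionAt.covDeriv_smul (hf' y) (hσ.diffSectionAt y) (A y)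
  rw [𝓕.curv_eq_of_parallelAt hσ hU hW hUx hWx, 𝓕.curv_eq_of_parallelAt (hσ.smul hf) hU hW hUx hWx,
    covDeriv_covDeriv_smul hU, covDeriv_covDeriv_smul hW,
    𝓕.mvfderiv_comm_of_parallelAt hf hU hW hUx hWx]
  module

theorem curv_eq_of_eq [FiniteDimensional ℝ F] [∀ x, T2Space (V x)]
    [∀ x, FiniteDimensional ℝ (V x)] [ContMDiffVectorBundle ∞ F V 𝓘(ℝ, E)] {σ τ : Π x, V x}
    (hσ : SmoothSection 𝓘(ℝ, E) F σ) (hτ : SmoothSection 𝓘(ℝ, E) F τ) {x : M} (h : σ x = τ x)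
    (u v : Tan E M x) : 𝓕.curv D σ x u v = 𝓕.curv D τ x u v :=
  SmoothSection.map_eq_of_eq (T := fun σ ↦ 𝓕.curv D σ x u v)
    (fun _ _ hσ hτ ↦ 𝓕.curv_add hσ hτ x u v) (fun _ _ hf hσ ↦ 𝓕.curv_smul hf hσ x u v) hσ hτ h

end Tensoriality

theorem smooth_secondDeriv [T2Space M]
    {σ : Π x, V x} (hσ : SmoothSection 𝓘(ℝ, E) F σ) {U W : Π x, Tan E M x}
    (hU : SmoothSection 𝓘(ℝ, E) E U) (hW : SmoothSection 𝓘(ℝ, E) E W) :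
    SmoothSection 𝓘(ℝ, E) F (fun y ↦ 𝓕.secondDeriv D σ y (U y) (W y)) :=
  (hσ.derivSection.covDeriv_apply hU).hom_apply hW

end Curvature

section HomCurvature

variable [T2Space M] {F : Type*} [NormedAddCommGroup F] [NormedSpace ℝ F] [FiniteDimensional ℝ F]
  {V : M → Type*} [TopologicalSpace (TotalSpace F V)]
  [∀ x, AddCommGroup (V x)] [∀ x, Module ℝ (V x)] [∀ x, TopologicalSpace (V x)]
  [∀ x, IsTopologicalAddGroup (V x)] [∀ x, ContinuousSMul ℝ (V x)]
  [FiberBundle F V] [VectorBundle ℝ F V] [ContMDiffVectorBundle ∞ F V 𝓘(ℝ, E)]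
  {F' : Type*} [NormedAddCommGroup F'] [NormedSpace ℝ F']
  {V' : M → Type*} [TopologicalSpace (TotalSpace F' V')]
  [∀ x, AddCommGroup (V' x)] [∀ x, Module ℝ (V' x)] [∀ x, TopologicalSpace (V' x)]
  [∀ x, IsTopologicalAddGroup (V' x)] [∀ x, ContinuousSMul ℝ (V' x)]
  [FiberBundle F' V'] [VectorBundle ℝ F' V']
  {D : CovariantDerivative 𝓘(ℝ, E) F V} [ContMDiffCovariantDerivative D ∞]
  {D' : CovariantDerivative 𝓘(ℝ, E) F' V'} [ContMDiffCovariantDerivative D' ∞]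

theorem curv_hom_apply {A : Π x, HomBundle V V' x}
    (hA : SmoothSection 𝓘(ℝ, E) (HomFiber F F') A)
    {σ : Π x, V x} (hσ : SmoothSection 𝓘(ℝ, E) F σ) (x : M) (u v : Tan E M x) :
    (𝓕.curv (D.hom D') A x u v : HomBundle V V' x) (σ x) =
      𝓕.curv D' (fun y ↦ A y (σ y)) x u v - A x (𝓕.curv D σ x u v) := by
  obtain ⟨U, hU, rfl, hUx⟩ := exists_smoothSection_parallelAt 𝓕.conn x u
  obtain ⟨W, hW, rfl, hWx⟩ := exists_smoothSection_parallelAt 𝓕.conn x v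
  have leibniz_twice {P Q : Π x, Tan E M x} (hQ : SmoothSection 𝓘(ℝ, E) E Q) :
      D' (fun y ↦ D' (fun z ↦ A z (σ z)) y (Q y)) x (P x) =
        ((D.hom D') (fun y ↦ (D.hom D') A y (Q y)) x (P x) : HomBundle V V' x) (σ x) +
          ((D.hom D') A x (Q x) : HomBundle V V' x) (D σ x (P x)) +
          (((D.hom D') A x (P x) : HomBundle V V' x) (D σ x (Q x)) +
            A x (D (fun y ↦ D σ y (Q y)) x (P x))) := by
    have hDA := hA.covDeriv_apply (D := D.hom D') hQ
    have hDσ := hσ.covDeriv_apply (D := D) hQ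
    rw [← hDA.covDeriv_hom_apply hσ, ← hA.covDeriv_hom_apply hDσ,
      ← DiffSectionAt.covDeriv_add ((hDA.hom_apply hσ).diffSectionAt x)
        ((hA.hom_apply hDσ).diffSectionAt x)]
    congr 3 with y
    exact hA.covDeriv_hom_apply hσ y (Q y)
  rw [𝓕.curv_eq_of_parallelAt hA hU hW hUx hWx, 𝓕.curv_eq_of_parallelAt hσ hU hW hUx hWx,
    𝓕.curv_eq_of_parallelAt (hA.hom_apply hσ) hU hW hUx hWx, leibniz_twice hU, leibniz_twice hW,
    map_sub, HomBundle.sub_apply]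
  abel

end HomCurvature

variable [T2Space M]

theorem secondDeriv_extend_eq {x : M} {w : Tan E M x} {Z : Π y, Tan E M y}
    (hZ : SmoothSection 𝓘(ℝ, E) E Z) (hZw : ∀ᶠ y in 𝓝 x, Z y = FiberBundle.extend E w y)
    (u v : Tan E M x) :
    𝓕.secondDeriv 𝓕.conn (FiberBundle.extend E w) x u v = 𝓕.secondDeriv 𝓕.conn Z x u v := by
  obtain ⟨s, hs, hw⟩ := contMDiffOn_extend w
  have hconn : (𝓕.conn.hom 𝓕.conn) (derivSection 𝓕.conn (FiberBundle.extend E w)) x =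
      (𝓕.conn.hom 𝓕.conn) (derivSection 𝓕.conn Z) x := by
    refine DiffSectionAt.covDeriv_congr (𝓕.diffSectionAt_conn hs hw)
      (hZ.derivSection.diffSectionAt x) ?_
    filter_upwards [hZw.eventually_nhds, eventually_mem_nhds_iff.2 hs] with y hy hys
    exact DiffSectionAt.covDeriv_congr
      (((hw y (mem_of_mem_nhds hys)).contMDiffAt hys).mdifferentiableAt (by simp))
      (hZ.diffSectionAt y) (hy.mono fun _ ↦ Eq.symm)
  rw [secondDeriv, hconn, secondDeriv]

theorem R_apply_section {W : Π x, Tan E M x} (hW : SmoothSection 𝓘(ℝ, E) E W) (x : M)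
    (u v : Tan E M x) : 𝓕.R x u v (W x) = 𝓕.curv 𝓕.conn W x u v := by
  obtain ⟨s, hs, hextend⟩ := contMDiffOn_extend (W x)
  obtain ⟨Z, hZ, hZW⟩ := exists_smoothSection_eventuallyEq hs hextend
  rw [R_apply, curv, 𝓕.secondDeriv_extend_eq hZ hZW, 𝓕.secondDeriv_extend_eq hZ hZW, ← curv]
  exact 𝓕.curv_eq_of_eq hZ hW (by simpa using hZW.self_of_nhds) u v

theorem smooth_R : SmoothSection 𝓘(ℝ, E) (HomFiber E (HomFiber E (HomFiber E E))) 𝓕.R := by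
  refine smoothSection_hom fun U hU ↦ smoothSection_hom fun W hW ↦ smoothSection_hom fun Z hZ ↦ ?_
  simp only [𝓕.R_apply_section hZ]
  exact (𝓕.smooth_secondDeriv hZ hU hW).sub (𝓕.smooth_secondDeriv hZ hW hU)

end FedosovStructure

/-! ### Symmetries of the curvature -/

theorem trace_eq_of_adjoint {K W : Type*} [Field K] [AddCommGroup W] [Module K W]
    [FiniteDimensional K W] {B : W →ₗ[K] Module.Dual K W} (hB : Function.Injective B)
    {L L' : W →ₗ[K] W} (h : ∀ a b, B (L' a) b = B a (L b)) :
    LinearMap.trace K W L' = LinearMap.trace K W L := by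
  let e : W ≃ₗ[K] Module.Dual K W :=
    LinearMap.linearEquivOfInjective B hB Subspace.dual_finrank_eq.symm
  have conj_eq : e.conj L' = Module.Dual.transpose (R := K) L := by
    ext φ b
    obtain ⟨a, rfl⟩ := e.surjective φ
    simp only [LinearEquiv.conj_apply, LinearMap.comp_apply, LinearEquiv.coe_coe,
      LinearEquiv.symm_apply_apply, Module.Dual.transpose_apply]
    exact h a b
  rw [← LinearMap.trace_conj' L' e, conj_eq, LinearMap.trace_transpose']

namespace FedosovStructure

open CovariantDerivative

variable {E : Type*} [NormedAddCommGroup E] [NormedSpace ℝ E] [FiniteDimensional ℝ E]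
  {M : Type*} [TopologicalSpace M] [ChartedSpace E M] [IsManifold 𝓘(ℝ, E) ∞ M] {n : ℕ}
  (𝓕 : FedosovStructure E M n)

section Form

theorem form_left_cancel {x : M} {a b : Tan E M x}
    (h : ∀ z, (𝓕.form x z a : ℝ) = 𝓕.form x z b) : a = b := by
  rw [← sub_eq_zero]
  refine 𝓕.nondegenerate x _ fun z ↦ ?_
  rw [𝓕.skew, map_sub, h z]
  simp

/-- The lowering map `X^a ↦ J_{ab} X^a` at a point, with values in the algebraic dual. -/
def formDual (x : M) : Tan E M x →ₗ[ℝ] Module.Dual ℝ (Tan E M x) where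
  toFun u := (𝓕.form x u).toLinear
  map_add' u v := by ext; simp
  map_smul' c u := by ext; simp

theorem formDual_injective (x : M) : Function.Injective (𝓕.formDual x) :=
  (injective_iff_map_eq_zero _).2 fun u hu ↦ 𝓕.nondegenerate x u fun v ↦ congr($hu v)

end Form

theorem curv_eq_zero_of_parallel {F : Type*} [NormedAddCommGroup F] [NormedSpace ℝ F]
    {V : M → Type*} [TopologicalSpace (TotalSpace F V)]
    [∀ x, AddCommGroup (V x)] [∀ x, Module ℝ (V x)] [∀ x, TopologicalSpace (V x)]
    [∀ x, IsTopologicalAddGroup (V x)] [∀ x, ContinuousSMul ℝ (V x)]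
    [FiberBundle F V] [VectorBundle ℝ F V] {D : CovariantDerivative 𝓘(ℝ, E) F V}
    {σ : Π x, V x} (hσ : derivSection D σ = 0) (x : M) (u v : Tan E M x) :
    𝓕.curv D σ x u v = 0 := by
  have h : (𝓕.conn.hom D) (derivSection D σ) x = 0 := by
    rw [hσ, CovariantDerivative.zero]
    rfl
  rw [curv, secondDeriv, secondDeriv, h]
  exact sub_self _

section TensorDerivative

variable {F : Type*} [NormedAddCommGroup F] [NormedSpace ℝ F]
  {V : M → Type*} [TopologicalSpace (TotalSpace F V)]
  [∀ x, AddCommGroup (V x)] [∀ x, Module ℝ (V x)] [∀ x, TopologicalSpace (V x)]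
  [∀ x, IsTopologicalAddGroup (V x)] [∀ x, ContinuousSMul ℝ (V x)]
  [FiberBundle F V] [VectorBundle ℝ F V] {D : CovariantDerivative 𝓘(ℝ, E) F V}
  {P Q W : Π x, Tan E M x} {x : M}

theorem derivSection_apply₂_of_parallelAt
    {A : Π x, HomBundle (Tan E M) (HomBundle (Tan E M) V) x}
    (hA : SmoothSection 𝓘(ℝ, E) (HomFiber E (HomFiber E F)) A)
    (hP : SmoothSection 𝓘(ℝ, E) E P) (hQ : SmoothSection 𝓘(ℝ, E) E Q)
    (hPx : 𝓕.conn P x = 0) (hQx : 𝓕.conn Q x = 0) (z : Tan E M x) :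
    derivSection (𝓕.conn.hom (𝓕.conn.hom D)) A x z (P x) (Q x) =
      D (fun y ↦ A y (P y) (Q y)) x z := by
  rw [hA.derivSection_apply_of_parallelAt hP hPx, (hA.hom_apply hP).hom_apply_of_parallelAt hQ hQx]

theorem derivSection_apply₃_of_parallelAt
    {A : Π x, HomBundle (Tan E M) (HomBundle (Tan E M) (HomBundle (Tan E M) V)) x}
    (hA : SmoothSection 𝓘(ℝ, E) (HomFiber E (HomFiber E (HomFiber E F))) A)
    (hP : SmoothSection 𝓘(ℝ, E) E P) (hQ : SmoothSection 𝓘(ℝ, E) E Q)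
    (hW : SmoothSection 𝓘(ℝ, E) E W)
    (hPx : 𝓕.conn P x = 0) (hQx : 𝓕.conn Q x = 0) (hWx : 𝓕.conn W x = 0) (z : Tan E M x) :
    derivSection (𝓕.conn.hom (𝓕.conn.hom (𝓕.conn.hom D))) A x z (P x) (Q x) (W x) =
      D (fun y ↦ A y (P y) (Q y) (W y)) x z := by
  have hAP := hA.hom_apply hP
  rw [hA.derivSection_apply_of_parallelAt hP hPx, hAP.hom_apply_of_parallelAt hQ hQx,
    (hAP.hom_apply hQ).hom_apply_of_parallelAt hW hWx]

end TensorDerivative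

section CurvatureSymmetries

variable [T2Space M]

instance : ContMDiffCovariantDerivative 𝓕.cotanConn ∞ :=
  inferInstanceAs (ContMDiffCovariantDerivative (𝓕.conn.hom (trivialLine 𝓘(ℝ, E) M)) ∞)

theorem curv_cotanConn {μ : Π x, Cotan E M x} (hμ : SmoothSection 𝓘(ℝ, E) (HomFiber E ℝ) μ)
    (x : M) (u v w : Tan E M x) :
    (𝓕.curv 𝓕.cotanConn μ x u v : Cotan E M x) w = -(μ x (𝓕.R x u v w) : ℝ) := by
  obtain ⟨W, hW, rfl⟩ := exists_smoothSection_eq 𝓘(ℝ, E) E w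
  have h := 𝓕.curv_hom_apply (D := 𝓕.conn) (D' := trivialLine 𝓘(ℝ, E) M) hμ hW x u v
  rw [𝓕.curv_trivialLine (smoothSection_line_iff.1 (hμ.hom_apply hW)),
    ← 𝓕.R_apply_section hW] at h
  exact h.trans (zero_sub _)

theorem form_R (x : M) (u v w z : Tan E M x) :
    (𝓕.form x (𝓕.R x u v w) z : ℝ) = -(𝓕.form x w (𝓕.R x u v z) : ℝ) := by
  obtain ⟨W, hW, rfl⟩ := exists_smoothSection_eq 𝓘(ℝ, E) E w
  have h := 𝓕.curv_hom_apply (D := 𝓕.conn) (D' := 𝓕.cotanConn) 𝓕.smooth hW x u v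
  rw [𝓕.curv_eq_zero_of_parallel 𝓕.parallel, ← 𝓕.R_apply_section hW] at h
  have hz := congr($h z)
  rw [HomBundle.sub_apply, 𝓕.curv_cotanConn (𝓕.smooth.hom_apply hW)] at hz
  exact (sub_eq_zero.1 hz.symm).symm

theorem R_skew (x : M) (u v w : Tan E M x) : 𝓕.R x u v w = -𝓕.R x v u w := by
  rw [R_apply, R_apply, curv, curv]
  abel

theorem trace_R (x : M) (u v : Tan E M x) :
    LinearMap.trace ℝ (Tan E M x) (𝓕.R x u v).toLinear = 0 := by
  have h := trace_eq_of_adjoint (𝓕.formDual_injective x) (L := (𝓕.R x u v).toLinear)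
    (L' := -(𝓕.R x u v).toLinear) fun a b ↦ by
      rw [LinearMap.neg_apply, map_neg, LinearMap.neg_apply, neg_eq_iff_eq_neg]
      exact 𝓕.form_R x u v a b
  rw [map_neg] at h
  linarith

theorem hessian_symm {f : M → ℝ} (hf : ContMDiff 𝓘(ℝ, E) 𝓘(ℝ, ℝ) ∞ f) (x : M)
    (u v : Tan E M x) :
    (𝓕.cotanConn (derivSection (trivialLine 𝓘(ℝ, E) M) f) x u : Cotan E M x) v =
      (𝓕.cotanConn (derivSection (trivialLine 𝓘(ℝ, E) M) f) x v : Cotan E M x) u :=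
  sub_eq_zero.1 (𝓕.curv_trivialLine hf x u v)

theorem secondDeriv_differential_symm {f : M → ℝ} (hf : ContMDiff 𝓘(ℝ, E) 𝓘(ℝ, ℝ) ∞ f) (x : M)
    (u v w : Tan E M x) :
    (𝓕.secondDeriv 𝓕.cotanConn (derivSection (trivialLine 𝓘(ℝ, E) M) f) x u v : Cotan E M x) w =
      (𝓕.secondDeriv 𝓕.cotanConn (derivSection (trivialLine 𝓘(ℝ, E) M) f) x u w :
        Cotan E M x) v := by
  obtain ⟨V, hV, rfl, hVx⟩ := exists_smoothSection_parallelAt 𝓕.conn x v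
  obtain ⟨W, hW, rfl, hWx⟩ := exists_smoothSection_parallelAt 𝓕.conn x w
  have hdf : SmoothSection 𝓘(ℝ, E) (HomFiber E ℝ) (derivSection (trivialLine 𝓘(ℝ, E) M) f) :=
    SmoothSection.derivSection (smoothSection_line_iff.2 hf)
  have hHV := hdf.covDeriv_apply (D := 𝓕.cotanConn) hV
  have hHW := hdf.covDeriv_apply (D := 𝓕.cotanConn) hW
  rw [𝓕.secondDeriv_apply_of_parallelAt hdf hV hVx, 𝓕.secondDeriv_apply_of_parallelAt hdf hW hWx,
    cotanConn, hHV.hom_apply_of_parallelAt hW hWx, hHW.hom_apply_of_parallelAt hV hVx]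
  congr 3
  exact funext fun y ↦ 𝓕.hessian_symm hf y (V y) (W y)

/- Tested on the differential of a function, the cyclic sum of the Ricci identities cancels because
the iterated derivative of a function is symmetric in its last two slots. -/
theorem bianchi_first (x : M) (u v w : Tan E M x) :
    𝓕.R x u v w + 𝓕.R x v w u + 𝓕.R x w u v = 0 := by
  refine 𝓕.form_left_cancel fun z ↦ ?_
  obtain ⟨f, hf, -, hfx⟩ := exists_contMDiff_mvfderiv_eq x (𝓕.form x z).toCLM
  have hdf : SmoothSection 𝓘(ℝ, E) (HomFiber E ℝ) (derivSection (trivialLine 𝓘(ℝ, E) M) f) :=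
    SmoothSection.derivSection (smoothSection_line_iff.2 hf)
  have ricci (u v w : Tan E M x) :
      (𝓕.secondDeriv 𝓕.cotanConn (derivSection (trivialLine 𝓘(ℝ, E) M) f) x u v :
        Cotan E M x) w -
      (𝓕.secondDeriv 𝓕.cotanConn (derivSection (trivialLine 𝓘(ℝ, E) M) f) x v u :
        Cotan E M x) w = -(𝓕.form x z (𝓕.R x u v w) : ℝ) := by
    have hdfx : derivSection (trivialLine 𝓘(ℝ, E) M) f x = 𝓕.form x z := hfx
    rw [← hdfx, ← 𝓕.curv_cotanConn hdf]
    rfl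
  have ricci_uvw : (_ - _ : ℝ) = _ := ricci u v w
  have ricci_vwu : (_ - _ : ℝ) = _ := ricci v w u
  have ricci_wuv : (_ - _ : ℝ) = _ := ricci w u v
  rw [𝓕.secondDeriv_differential_symm hf x u v w] at ricci_uvw
  rw [𝓕.secondDeriv_differential_symm hf x v w u] at ricci_vwu
  rw [𝓕.secondDeriv_differential_symm hf x w u v] at ricci_wuv
  rw [map_add, map_add, map_zero]
  change (_ + _ + _ : ℝ) = 0
  linarith

/-- `∇_e R_{ab}{}^c{}_d`, the index `e` being the first argument. -/
def gradR (x : M) : HomBundle (Tan E M)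
    (HomBundle (Tan E M) (HomBundle (Tan E M) (HomBundle (Tan E M) (Tan E M)))) x :=
  derivSection (𝓕.conn.hom (𝓕.conn.hom (𝓕.conn.hom 𝓕.conn))) 𝓕.R x

theorem conn_secondDeriv_of_parallelAt {P Q Z : Π x, Tan E M x}
    (hP : SmoothSection 𝓘(ℝ, E) E P) (hQ : SmoothSection 𝓘(ℝ, E) E Q)
    (hZ : SmoothSection 𝓘(ℝ, E) E Z) {x : M} (hPx : 𝓕.conn P x = 0) (hQx : 𝓕.conn Q x = 0)
    (u : Tan E M x) :
    𝓕.conn (fun y ↦ 𝓕.secondDeriv 𝓕.conn Z y (P y) (Q y)) x u =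
      (𝓕.secondDeriv (𝓕.conn.hom 𝓕.conn) (derivSection 𝓕.conn Z) x u (P x) :
        HomBundle (Tan E M) (Tan E M) x) (Q x) := by
  have hDZ := hZ.derivSection (D := 𝓕.conn)
  rw [𝓕.secondDeriv_apply_of_parallelAt hDZ hP hPx,
    (hDZ.covDeriv_apply hP).hom_apply_of_parallelAt hQ hQx]
  rfl

theorem gradR_eq_secondDeriv_sub_of_parallelAt {P Q Z : Π x, Tan E M x}
    (hP : SmoothSection 𝓘(ℝ, E) E P) (hQ : SmoothSection 𝓘(ℝ, E) E Q)
    (hZ : SmoothSection 𝓘(ℝ, E) E Z) {x : M} (hPx : 𝓕.conn P x = 0) (hQx : 𝓕.conn Q x = 0)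
    (hZx : 𝓕.conn Z x = 0) (u : Tan E M x) :
    𝓕.gradR x u (P x) (Q x) (Z x) =
      (𝓕.secondDeriv (𝓕.conn.hom 𝓕.conn) (derivSection 𝓕.conn Z) x u (P x) :
        HomBundle (Tan E M) (Tan E M) x) (Q x) -
      (𝓕.secondDeriv (𝓕.conn.hom 𝓕.conn) (derivSection 𝓕.conn Z) x u (Q x) :
        HomBundle (Tan E M) (Tan E M) x) (P x) := by
  rw [gradR, 𝓕.derivSection_apply₃_of_parallelAt 𝓕.smooth_R hP hQ hZ hPx hQx hZx]
  simp only [𝓕.R_apply_section hZ]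
  rw [← 𝓕.conn_secondDeriv_of_parallelAt hP hQ hZ hPx hQx,
    ← 𝓕.conn_secondDeriv_of_parallelAt hQ hP hZ hQx hPx, ← DiffSectionAt.covDeriv_sub
      ((𝓕.smooth_secondDeriv hZ hP hQ).diffSectionAt x)
      ((𝓕.smooth_secondDeriv hZ hQ hP).diffSectionAt x)]
  rfl

theorem secondDeriv_derivSection_comm_of_parallelAt {Z : Π x, Tan E M x}
    (hZ : SmoothSection 𝓘(ℝ, E) E Z) {x : M} (hZx : 𝓕.conn Z x = 0) (u v w : Tan E M x) :
    (𝓕.secondDeriv (𝓕.conn.hom 𝓕.conn) (derivSection 𝓕.conn Z) x u v :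
        HomBundle (Tan E M) (Tan E M) x) w =
      (𝓕.secondDeriv (𝓕.conn.hom 𝓕.conn) (derivSection 𝓕.conn Z) x v u :
        HomBundle (Tan E M) (Tan E M) x) w := by
  obtain ⟨Q, hQ, rfl⟩ := exists_smoothSection_eq 𝓘(ℝ, E) E w
  have hDZ := hZ.derivSection (D := 𝓕.conn)
  have ricci := 𝓕.curv_hom_apply (D := 𝓕.conn) (D' := 𝓕.conn) hDZ hQ x u v
  rw [← 𝓕.R_apply_section (hDZ.hom_apply hQ)] at ricci
  simp only [FedosovStructure.derivSection, hZx] at ricci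
  refine sub_eq_zero.1 (ricci.trans ?_)
  change 𝓕.R x u v 0 - 0 = 0
  rw [map_zero, sub_zero]

theorem bianchi_second (x : M) (u v w z : Tan E M x) :
    𝓕.gradR x u v w z + 𝓕.gradR x v w u z + 𝓕.gradR x w u v z = 0 := by
  obtain ⟨U, hU, rfl, hUx⟩ := exists_smoothSection_parallelAt 𝓕.conn x u
  obtain ⟨V, hV, rfl, hVx⟩ := exists_smoothSection_parallelAt 𝓕.conn x v
  obtain ⟨W, hW, rfl, hWx⟩ := exists_smoothSection_parallelAt 𝓕.conn x w
  obtain ⟨Z, hZ, rfl, hZx⟩ := exists_smoothSection_parallelAt 𝓕.conn x z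
  rw [𝓕.gradR_eq_secondDeriv_sub_of_parallelAt hV hW hZ hVx hWx hZx,
    𝓕.gradR_eq_secondDeriv_sub_of_parallelAt hW hU hZ hWx hUx hZx,
    𝓕.gradR_eq_secondDeriv_sub_of_parallelAt hU hV hZ hUx hVx hZx,
    𝓕.secondDeriv_derivSection_comm_of_parallelAt hZ hZx (U x) (V x),
    𝓕.secondDeriv_derivSection_comm_of_parallelAt hZ hZx (V x) (W x),
    𝓕.secondDeriv_derivSection_comm_of_parallelAt hZ hZx (W x) (U x)]
  abel

theorem Phi_symm (x : M) (v w : Tan E M x) : (𝓕.Phi x v w : ℝ) = 𝓕.Phi x w v := by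
  have firstSlot_sub :
      firstSlot (𝓕.R x) v w - firstSlot (𝓕.R x) w v = -(𝓕.R x v w).toLinear := by
    ext u
    change 𝓕.R x u v w - 𝓕.R x u w v = -𝓕.R x v w u
    rw [𝓕.R_skew x u w v, eq_neg_iff_add_eq_zero, ← 𝓕.bianchi_first x u v w]
    abel
  have h := congr(LinearMap.trace ℝ (Tan E M x) $firstSlot_sub)
  rw [map_sub, map_neg, 𝓕.trace_R, neg_zero, sub_eq_zero] at h
  rw [Phi_apply, Phi_apply, h]

end CurvatureSymmetries

end FedosovStructure

/-! ### Traces and smoothness of the tensors -/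

theorem trace_eq_sum_of_sum_smul_eq {K W ι : Type*} [Field K] [AddCommGroup W] [Module K W]
    [FiniteDimensional K W] [Fintype ι] {φ : ι → W →ₗ[K] K} {X : ι → W}
    (h : ∀ v, ∑ i, φ i v • X i = v) (L : W →ₗ[K] W) :
    LinearMap.trace K W L = ∑ i, φ i (L (X i)) := by
  have expand : L = ∑ i, (φ i).smulRight (L (X i)) := by
    ext v
    conv_lhs => rw [← h v]
    simp
  conv_lhs => rw [expand]
  simp

namespace HomBundle

variable {B : Type*} {V V' : B → Type*}
  [∀ x, AddCommGroup (V x)] [∀ x, Module ℝ (V x)] [∀ x, TopologicalSpace (V x)]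
  [∀ x, AddCommGroup (V' x)] [∀ x, Module ℝ (V' x)] [∀ x, TopologicalSpace (V' x)]
  [∀ x, IsTopologicalAddGroup (V' x)] [∀ x, ContinuousSMul ℝ (V' x)] {x : B}

theorem toLinear_sum {ι : Type*} (s : Finset ι) (A : ι → HomBundle V V' x) :
    (∑ i ∈ s, A i).toLinear = ∑ i ∈ s, (A i).toLinear :=
  map_sum (ContinuousLinearMap.coeLM ℝ : (V x →L[ℝ] V' x) →ₗ[ℝ] _) A s

theorem sum_apply {ι : Type*} (s : Finset ι) (A : ι → HomBundle V V' x) (v : V x) :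
    (∑ i ∈ s, A i) v = ∑ i ∈ s, A i v := by
  rw [← toLinear_apply, toLinear_sum, LinearMap.sum_apply]
  rfl

variable [∀ x, IsTopologicalAddGroup (V x)] [∀ x, ContinuousSMul ℝ (V x)]
  [∀ x, T2Space (V x)] [∀ x, FiniteDimensional ℝ (V x)]

/-- The rank one homomorphism `v ↦ μ(v) w` between fibres. -/
def smulRight (μ : HomBundle V (Bundle.Trivial B ℝ) x) (w : V' x) : HomBundle V V' x :=
  .ofLinear (LinearMap.smulRight (μ.toLinear : V x →ₗ[ℝ] ℝ) w)

theorem smulRight_apply (μ : HomBundle V (Bundle.Trivial B ℝ) x) (w : V' x) (v : V x) :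
    μ.smulRight w v = (μ v : ℝ) • w :=
  rfl

end HomBundle

section Trace

open CovariantDerivative

variable {E : Type*} [NormedAddCommGroup E] [NormedSpace ℝ E] [FiniteDimensional ℝ E]
  {M : Type*} [TopologicalSpace M] [ChartedSpace E M] [T2Space M] [IsManifold 𝓘(ℝ, E) ∞ M]
  {F : Type*} [NormedAddCommGroup F] [NormedSpace ℝ F] [FiniteDimensional ℝ F]
  {V : M → Type*} [TopologicalSpace (TotalSpace F V)]
  [∀ x, AddCommGroup (V x)] [∀ x, Module ℝ (V x)] [∀ x, TopologicalSpace (V x)]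
  [∀ x, IsTopologicalAddGroup (V x)] [∀ x, ContinuousSMul ℝ (V x)]
  [∀ x, T2Space (V x)] [∀ x, FiniteDimensional ℝ (V x)]
  [FiberBundle F V] [VectorBundle ℝ F V] [ContMDiffVectorBundle ∞ F V 𝓘(ℝ, E)]
  {D : CovariantDerivative 𝓘(ℝ, E) F V}

theorem SmoothSection.smulRight {μ : Π x, HomBundle V (Line M) x} {X : Π x, V x}
    (hμ : SmoothSection 𝓘(ℝ, E) (HomFiber F ℝ) μ) (hX : SmoothSection 𝓘(ℝ, E) F X) :
    SmoothSection 𝓘(ℝ, E) (HomFiber F F) (fun y ↦ (μ y).smulRight (X y)) :=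
  smoothSection_hom fun _ hσ ↦ hX.smul (smoothSection_line_iff.1 (hμ.hom_apply hσ))

theorem contMDiff_trace {T : Π x, HomBundle V V x} (hT : SmoothSection 𝓘(ℝ, E) (HomFiber F F) T) :
    ContMDiff 𝓘(ℝ, E) 𝓘(ℝ, ℝ) ∞ (fun y ↦ LinearMap.trace ℝ (V y) (T y).toLinear) := by
  intro x
  obtain ⟨X, ε, hX, hε, hXε⟩ := exists_frame (I := 𝓘(ℝ, E)) F V x
  have h : SmoothSection 𝓘(ℝ, E) ℝ (V := Line M) (fun y ↦ ∑ i, (ε i y (T y (X i y)) : ℝ)) :=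
    ContMDiff.sum_section fun i _ ↦ (hε i).hom_apply (hT.hom_apply (hX i))
  refine (smoothSection_line_iff.1 h x).congr_of_eventuallyEq ?_
  filter_upwards [hXε] with y hy
  exact trace_eq_sum_of_sum_smul_eq (φ := fun i ↦ (ε i y).toLinear) hy (T y).toLinear

theorem trace_hom_smulRight {μ : Π x, HomBundle V (Line M) x} {X : Π x, V x}
    (hμ : SmoothSection 𝓘(ℝ, E) (HomFiber F ℝ) μ) (hX : SmoothSection 𝓘(ℝ, E) F X)
    (x : M) (u : Tan E M x) :
    LinearMap.trace ℝ (V x)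
        (hom D D (fun y ↦ (μ y).smulRight (X y)) x u : HomBundle V V x).toLinear =
      mvfderiv 𝓘(ℝ, E) (fun y ↦ (μ y (X y) : ℝ)) x u := by
  have hA : (hom D D (fun y ↦ (μ y).smulRight (X y)) x u : HomBundle V V x).toLinear =
      (hom D (trivialLine 𝓘(ℝ, E) M) μ x u : HomBundle V (Line M) x).toLinear.smulRight (X x) +
        (μ x).toLinear.smulRight (D X x u) := by
    ext v
    obtain ⟨σ, hσ, rfl, hσx⟩ := exists_smoothSection_parallelAt D x v
    have hμσ := smoothSection_line_iff.1 (hμ.hom_apply hσ)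
    refine ((hμ.smulRight hX).hom_apply_of_parallelAt hσ hσx u).trans
      ((DiffSectionAt.covDeriv_smul (hμσ.mdifferentiable (by simp) x)
        (hX.diffSectionAt x) u).trans ?_)
    rw [add_comm]
    congr 2
    exact (hμ.hom_apply_of_parallelAt (D' := trivialLine 𝓘(ℝ, E) M) hσ hσx u).symm
  rw [hA, map_add, LinearMap.trace_smulRight, LinearMap.trace_smulRight]
  exact (hμ.covDeriv_hom_apply (D' := trivialLine 𝓘(ℝ, E) M) hX x u).symm

theorem mvfderiv_trace {T : Π x, HomBundle V V x}
    (hT : SmoothSection 𝓘(ℝ, E) (HomFiber F F) T) (x : M) (u : Tan E M x) :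
    mvfderiv 𝓘(ℝ, E) (fun y ↦ LinearMap.trace ℝ (V y) (T y).toLinear) x u =
      LinearMap.trace ℝ (V x) (hom D D T x u : HomBundle V V x).toLinear := by
  obtain ⟨X, ε, hX, hε, hXε⟩ := exists_frame (I := 𝓘(ℝ, E)) F V x
  have hTX (i) := hT.hom_apply (hX i)
  have hA (i) := (hε i).smulRight (hTX i)
  have hε_TX (i) := (hε i).hom_apply (hTX i)
  have T_eq : ∀ᶠ y in 𝓝 x, T y = ∑ i, HomBundle.smulRight (ε i y) (T y (X i y)) := by
    filter_upwards [hXε] with y hy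
    ext v
    conv_lhs => rw [← hy v]
    simp only [map_sum, map_smul, HomBundle.sum_apply, HomBundle.smulRight_apply]
  have trace_eq : ∀ᶠ y in 𝓝 x, LinearMap.trace ℝ (V y) (T y).toLinear =
      (∑ i, (ε i y (T y (X i y)) : ℝ)) := by
    filter_upwards [hXε] with y hy
    exact trace_eq_sum_of_sum_smul_eq (φ := fun i ↦ (ε i y).toLinear) hy (T y).toLinear
  have h_trace : mvfderiv 𝓘(ℝ, E) (fun y ↦ LinearMap.trace ℝ (V y) (T y).toLinear) x =
      trivialLine 𝓘(ℝ, E) M (fun y ↦ ∑ i, (ε i y (T y (X i y)) : ℝ)) x :=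
    DiffSectionAt.covDeriv_congr (D := trivialLine 𝓘(ℝ, E) M)
      ((smoothSection_line_iff.2 (contMDiff_trace hT)).diffSectionAt x)
      (SmoothSection.diffSectionAt (ContMDiff.sum_section fun i _ ↦ hε_TX i) x) trace_eq
  have h_hom : hom D D T x =
      hom D D (fun y ↦ ∑ i, HomBundle.smulRight (ε i y) (T y (X i y))) x :=
    DiffSectionAt.covDeriv_congr (hT.diffSectionAt x)
      (SmoothSection.diffSectionAt (ContMDiff.sum_section fun i _ ↦ hA i) x) T_eq
  rw [h_trace, h_hom, SmoothSection.covDeriv_sum _ hε_TX, SmoothSection.covDeriv_sum _ hA,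
    HomBundle.toLinear_sum, map_sum]
  exact Finset.sum_congr rfl fun i _ ↦ (trace_hom_smulRight (hε i) (hTX i) x u).symm

end Trace

namespace FedosovStructure

open CovariantDerivative

variable {E : Type*} [NormedAddCommGroup E] [NormedSpace ℝ E] [FiniteDimensional ℝ E]
  {M : Type*} [TopologicalSpace M] [ChartedSpace E M] [IsManifold 𝓘(ℝ, E) ∞ M] {n : ℕ}
  (𝓕 : FedosovStructure E M n)

theorem raise_form (x : M) (v : Tan E M x) : 𝓕.raise x (𝓕.form x v) = v :=
  (LinearMap.linearEquivOfInjective (𝓕.lower x) (𝓕.lower_injective x)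
    (finrank_cotan x)).symm_apply_apply v

/-- The endomorphism `p^a ↦ J^{cb} T_{ab} p^a` obtained by raising the last index. -/
def raiseEnd {x : M} (T : HomBundle (Tan E M) (Cotan E M) x) :
    HomBundle (Tan E M) (Tan E M) x :=
  .ofLinear (𝓕.raise x ∘ₗ T.toLinear)

/-- `firstSlot`, as an element of the fibre of a bundle of homomorphisms. -/
def firstSlotHom {x : M}
    (A : HomBundle (Tan E M) (HomBundle (Tan E M) (HomBundle (Tan E M) (Tan E M))) x)
    (v w : Tan E M x) : HomBundle (Tan E M) (Tan E M) x :=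
  .ofLinear (firstSlot A v w)

theorem smooth_raise {μ : Π x, Cotan E M x} (hμ : SmoothSection 𝓘(ℝ, E) (HomFiber E ℝ) μ) :
    SmoothSection 𝓘(ℝ, E) E (fun y ↦ 𝓕.raise y (μ y)) :=
  SmoothSection.hom_apply
    (A := fun y ↦ HomBundle.ofLinear (V := Cotan E M) (V' := Tan E M) (𝓕.raise y))
    (smoothSection_of_inverse 𝓕.smooth 𝓕.form_raise 𝓕.raise_form) hμ

theorem conn_raise {μ : Π x, Cotan E M x} (hμ : SmoothSection 𝓘(ℝ, E) (HomFiber E ℝ) μ) (x : M)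
    (u : Tan E M x) :
    𝓕.conn (fun y ↦ 𝓕.raise y (μ y)) x u = 𝓕.raise x (𝓕.cotanConn μ x u) := by
  have h := 𝓕.smooth.covDeriv_hom_apply (D := 𝓕.conn) (D' := 𝓕.cotanConn) (𝓕.smooth_raise hμ) x u
  simp only [𝓕.form_raise, 𝓕.parallel] at h
  rw [h]
  change _ = 𝓕.raise x (0 + _)
  rw [zero_add, 𝓕.raise_form]

theorem cotanConn_form {U : Π x, Tan E M x} (hU : SmoothSection 𝓘(ℝ, E) E U) (x : M)
    (u : Tan E M x) :
    𝓕.cotanConn (fun y ↦ 𝓕.form y (U y)) x u = 𝓕.form x (𝓕.conn U x u) := by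
  rw [𝓕.smooth.covDeriv_hom_apply (D := 𝓕.conn) hU, 𝓕.parallel]
  exact zero_add _

theorem mvfderiv_form_of_parallelAt {U W : Π x, Tan E M x} (hU : SmoothSection 𝓘(ℝ, E) E U)
    (hW : SmoothSection 𝓘(ℝ, E) E W) {x : M} (hUx : 𝓕.conn U x = 0) (hWx : 𝓕.conn W x = 0)
    (z : Tan E M x) : mvfderiv 𝓘(ℝ, E) (fun y ↦ (𝓕.form y (U y) (W y) : ℝ)) x z = 0 := by
  have h := (𝓕.smooth.hom_apply hU).hom_apply_of_parallelAt (D := 𝓕.conn)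
    (D' := trivialLine 𝓘(ℝ, E) M) hW hWx z
  refine h.symm.trans ?_
  change 𝓕.cotanConn (fun y ↦ 𝓕.form y (U y)) x z (W x) = 0
  rw [𝓕.cotanConn_form hU, hUx]
  change 𝓕.form x 0 (W x) = 0
  rw [map_zero]
  rfl

section Smoothness

variable [T2Space M]

theorem smooth_raiseEnd {T : Π x, HomBundle (Tan E M) (Cotan E M) x}
    (hT : SmoothSection 𝓘(ℝ, E) (HomFiber E (HomFiber E ℝ)) T) :
    SmoothSection 𝓘(ℝ, E) (HomFiber E E) (fun y ↦ 𝓕.raiseEnd (T y)) :=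
  smoothSection_hom fun _ hU ↦ 𝓕.smooth_raise (hT.hom_apply hU)

theorem contMDiff_contract {T : Π x, HomBundle (Tan E M) (Cotan E M) x}
    (hT : SmoothSection 𝓘(ℝ, E) (HomFiber E (HomFiber E ℝ)) T) :
    ContMDiff 𝓘(ℝ, E) 𝓘(ℝ, ℝ) ∞ (fun y ↦ 𝓕.contract y (T y)) :=
  contMDiff_trace (𝓕.smooth_raiseEnd hT)

theorem mvfderiv_contract {T : Π x, HomBundle (Tan E M) (Cotan E M) x}
    (hT : SmoothSection 𝓘(ℝ, E) (HomFiber E (HomFiber E ℝ)) T) (x : M) (u : Tan E M x) :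
    mvfderiv 𝓘(ℝ, E) (fun y ↦ 𝓕.contract y (T y)) x u =
      𝓕.contract x (𝓕.conn.hom 𝓕.cotanConn T x u : HomBundle (Tan E M) (Cotan E M) x) := by
  refine (mvfderiv_trace (D := 𝓕.conn) (𝓕.smooth_raiseEnd hT) x u).trans ?_
  refine congrArg (LinearMap.trace ℝ (Tan E M x)) (LinearMap.ext fun w ↦ ?_)
  obtain ⟨W, hW, rfl, hWx⟩ := exists_smoothSection_parallelAt 𝓕.conn x w
  refine ((𝓕.smooth_raiseEnd hT).hom_apply_of_parallelAt hW hWx u).trans ?_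
  refine (𝓕.conn_raise (hT.hom_apply hW) x u).trans (congrArg (𝓕.raise x) ?_)
  exact (hT.hom_apply_of_parallelAt hW hWx u).symm

theorem smooth_firstSlotHom
    {A : Π x, HomBundle (Tan E M) (HomBundle (Tan E M) (HomBundle (Tan E M) (Tan E M))) x}
    (hA : SmoothSection 𝓘(ℝ, E) (HomFiber E (HomFiber E (HomFiber E E))) A)
    {V W : Π x, Tan E M x} (hV : SmoothSection 𝓘(ℝ, E) E V) (hW : SmoothSection 𝓘(ℝ, E) E W) :
    SmoothSection 𝓘(ℝ, E) (HomFiber E E) (fun y ↦ firstSlotHom (A y) (V y) (W y)) :=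
  smoothSection_hom fun _ hU ↦ ((hA.hom_apply hU).hom_apply hV).hom_apply hW

theorem smooth_Phi : SmoothSection 𝓘(ℝ, E) (HomFiber E (HomFiber E ℝ)) 𝓕.Phi :=
  smoothSection_hom fun _ hV ↦ smoothSection_hom fun _ hW ↦
    SmoothSection.const_smul (1 / (2 * ((n : ℝ) + 1)))
    (smoothSection_line_iff.2 (contMDiff_trace (smooth_firstSlotHom 𝓕.smooth_R hV hW)))

theorem smooth_Phi_smul {P Q A : Π x, Tan E M x} (hP : SmoothSection 𝓘(ℝ, E) E P)
    (hQ : SmoothSection 𝓘(ℝ, E) E Q) (hA : SmoothSection 𝓘(ℝ, E) E A) :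
    SmoothSection 𝓘(ℝ, E) E (fun y ↦ (𝓕.Phi y (P y) (Q y) : ℝ) • A y) :=
  hA.smul (smoothSection_line_iff.1 ((𝓕.smooth_Phi.hom_apply hP).hom_apply hQ))

theorem smooth_form_smul_raise_Phi {P Q A : Π x, Tan E M x} (hP : SmoothSection 𝓘(ℝ, E) E P)
    (hQ : SmoothSection 𝓘(ℝ, E) E Q) (hA : SmoothSection 𝓘(ℝ, E) E A) :
    SmoothSection 𝓘(ℝ, E) E
      (fun y ↦ (𝓕.form y (P y) (Q y) : ℝ) • 𝓕.raise y (𝓕.Phi y (A y))) :=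
  (𝓕.smooth_raise (𝓕.smooth_Phi.hom_apply hA)).smul
    (smoothSection_line_iff.1 ((𝓕.smooth.hom_apply hP).hom_apply hQ))

theorem smooth_V : SmoothSection 𝓘(ℝ, E) (HomFiber E (HomFiber E (HomFiber E E))) 𝓕.V := by
  refine smoothSection_hom fun U hU ↦ smoothSection_hom fun V hV ↦ smoothSection_hom fun W hW ↦ ?_
  have h := (((𝓕.smooth_R.hom_apply hU).hom_apply hV).hom_apply hW).sub
    (((((𝓕.smooth_Phi_smul hV hW hU).sub (𝓕.smooth_Phi_smul hU hW hV)).add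
      (𝓕.smooth_form_smul_raise_Phi hU hW hV)).sub (𝓕.smooth_form_smul_raise_Phi hV hW hU)).add
      ((𝓕.smooth_form_smul_raise_Phi hU hV hW).const_smul 2))
  simp only [smul_smul] at h
  exact h

theorem smooth_gradPhi :
    SmoothSection 𝓘(ℝ, E) (HomFiber E (HomFiber E (HomFiber E ℝ))) 𝓕.gradPhi :=
  𝓕.smooth_Phi.derivSection

theorem smooth_gradPhiAux {U : Π x, Tan E M x} (hU : SmoothSection 𝓘(ℝ, E) E U) :
    SmoothSection 𝓘(ℝ, E) (HomFiber E (HomFiber E ℝ)) (fun y ↦ 𝓕.gradPhiAux y (U y)) :=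
  smoothSection_hom fun _ hP ↦ smoothSection_hom fun _ hQ ↦
    ((𝓕.smooth_gradPhi.hom_apply hQ).hom_apply hU).hom_apply hP

theorem smooth_S : SmoothSection 𝓘(ℝ, E) (HomFiber E ℝ) 𝓕.S :=
  smoothSection_hom fun _ hU ↦ SmoothSection.const_smul (1 / (2 * (n : ℝ) + 1))
    (smoothSection_line_iff.2 (𝓕.contMDiff_contract (𝓕.smooth_gradPhiAux hU)))

theorem smooth_Y : SmoothSection 𝓘(ℝ, E) (HomFiber E (HomFiber E (HomFiber E ℝ))) 𝓕.Y := by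
  refine smoothSection_hom fun U hU ↦ smoothSection_hom fun V hV ↦ smoothSection_hom fun W hW ↦ ?_
  have hgradV := 𝓕.smooth_V.derivSection
    (D := 𝓕.conn.hom (𝓕.conn.hom (𝓕.conn.hom 𝓕.conn)))
  have hgradVAux : SmoothSection 𝓘(ℝ, E) (HomFiber E E) (fun y ↦ HomBundle.ofLinear
      (V := Tan E M) (V' := Tan E M) (𝓕.gradVAux y (U y) (V y) (W y))) :=
    smoothSection_hom fun Z hZ ↦
      (((hgradV.hom_apply hZ).hom_apply hU).hom_apply hV).hom_apply hW
  exact SmoothSection.const_smul (1 / (2 * (n : ℝ) + 1))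
    (smoothSection_line_iff.2 (contMDiff_trace hgradVAux))

end Smoothness

end FedosovStructure

/-! ### The contracted second Bianchi identity -/

namespace FedosovStructure

open CovariantDerivative

variable {E : Type*} [NormedAddCommGroup E] [NormedSpace ℝ E] [FiniteDimensional ℝ E]
  {M : Type*} [TopologicalSpace M] [ChartedSpace E M] [IsManifold 𝓘(ℝ, E) ∞ M] {n : ℕ}
  (𝓕 : FedosovStructure E M n)

theorem form_apply_raise (x : M) (v : Tan E M x) (φ : Cotan E M x) :
    (𝓕.form x v (𝓕.raise x φ) : ℝ) = -(φ v : ℝ) := by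
  rw [𝓕.skew, 𝓕.form_raise]

theorem contract_transpose {x : M} {T T' : HomBundle (Tan E M) (Cotan E M) x}
    (h : ∀ p q, (T' p q : ℝ) = T q p) : 𝓕.contract x T' = -𝓕.contract x T := by
  rw [contract, contract, ← map_neg]
  refine trace_eq_of_adjoint (𝓕.formDual_injective x) fun a b ↦ ?_
  calc (𝓕.form x (𝓕.raise x (T' a)) b : ℝ) = T b a := by rw [𝓕.form_raise, h]
    _ = -(𝓕.form x a (𝓕.raise x (T b)) : ℝ) := by rw [𝓕.form_apply_raise]; exact (neg_neg _).symm
    _ = 𝓕.form x a (-𝓕.raise x (T b)) := (map_neg (𝓕.form x a) _).symm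

variable [T2Space M]

section Parallel

variable {P Q A : Π x, Tan E M x} {x : M}

theorem mvfderiv_Phi_of_parallelAt (hP : SmoothSection 𝓘(ℝ, E) E P)
    (hQ : SmoothSection 𝓘(ℝ, E) E Q) (hPx : 𝓕.conn P x = 0) (hQx : 𝓕.conn Q x = 0)
    (z : Tan E M x) :
    mvfderiv 𝓘(ℝ, E) (fun y ↦ (𝓕.Phi y (P y) (Q y) : ℝ)) x z = 𝓕.gradPhi x z (P x) (Q x) :=
  (𝓕.derivSection_apply₂_of_parallelAt (D := trivialLine 𝓘(ℝ, E) M)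
    𝓕.smooth_Phi hP hQ hPx hQx z).symm

theorem conn_Phi_smul_of_parallelAt (hP : SmoothSection 𝓘(ℝ, E) E P)
    (hQ : SmoothSection 𝓘(ℝ, E) E Q) (hA : SmoothSection 𝓘(ℝ, E) E A) (hPx : 𝓕.conn P x = 0)
    (hQx : 𝓕.conn Q x = 0) (hAx : 𝓕.conn A x = 0) (z : Tan E M x) :
    𝓕.conn (fun y ↦ (𝓕.Phi y (P y) (Q y) : ℝ) • A y) x z =
      (𝓕.gradPhi x z (P x) (Q x) : ℝ) • A x := by
  have hΦ := smoothSection_line_iff.1 ((𝓕.smooth_Phi.hom_apply hP).hom_apply hQ)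
  rw [DiffSectionAt.covDeriv_smul (hΦ.mdifferentiable (by simp) x) (hA.diffSectionAt x), hAx,
    𝓕.mvfderiv_Phi_of_parallelAt hP hQ hPx hQx, zero_apply, smul_zero, zero_add]

theorem conn_form_smul_raise_Phi_of_parallelAt (hP : SmoothSection 𝓘(ℝ, E) E P)
    (hQ : SmoothSection 𝓘(ℝ, E) E Q) (hA : SmoothSection 𝓘(ℝ, E) E A) (hPx : 𝓕.conn P x = 0)
    (hQx : 𝓕.conn Q x = 0) (hAx : 𝓕.conn A x = 0) (z : Tan E M x) :
    𝓕.conn (fun y ↦ (𝓕.form y (P y) (Q y) : ℝ) • 𝓕.raise y (𝓕.Phi y (A y))) x z =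
      (𝓕.form x (P x) (Q x) : ℝ) • 𝓕.raise x (𝓕.gradPhi x z (A x)) := by
  have hJ := smoothSection_line_iff.1 ((𝓕.smooth.hom_apply hP).hom_apply hQ)
  have hΦ := 𝓕.smooth_Phi.hom_apply hA
  rw [DiffSectionAt.covDeriv_smul (hJ.mdifferentiable (by simp) x)
    ((𝓕.smooth_raise hΦ).diffSectionAt x), 𝓕.mvfderiv_form_of_parallelAt hP hQ hPx hQx, zero_smul,
    add_zero, 𝓕.conn_raise hΦ, gradPhi,
    𝓕.smooth_Phi.derivSection_apply_of_parallelAt hA hAx]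

end Parallel

theorem gradPhi_eq_trace_gradR (x : M) (z v w : Tan E M x) :
    (𝓕.gradPhi x z v w : ℝ) = (1 / (2 * ((n : ℝ) + 1))) *
      LinearMap.trace ℝ (Tan E M x) (firstSlot (𝓕.gradR x z) v w) := by
  obtain ⟨V, hV, rfl, hVx⟩ := exists_smoothSection_parallelAt 𝓕.conn x v
  obtain ⟨W, hW, rfl, hWx⟩ := exists_smoothSection_parallelAt 𝓕.conn x w
  have hRVW := smooth_firstSlotHom 𝓕.smooth_R hV hW
  have hom_eq : (𝓕.conn.hom 𝓕.conn (fun y ↦ firstSlotHom (𝓕.R y) (V y) (W y)) x z :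
      HomBundle (Tan E M) (Tan E M) x).toLinear = firstSlot (𝓕.gradR x z) (V x) (W x) := by
    ext u
    obtain ⟨U, hU, rfl, hUx⟩ := exists_smoothSection_parallelAt 𝓕.conn x u
    exact (hRVW.hom_apply_of_parallelAt hU hUx z).trans
      (𝓕.derivSection_apply₃_of_parallelAt 𝓕.smooth_R hU hV hW hUx hVx hWx z).symm
  rw [← 𝓕.mvfderiv_Phi_of_parallelAt hV hW hVx hWx, ← hom_eq,
    ← mvfderiv_trace (D := 𝓕.conn) hRVW]
  exact DiffSectionAt.covDeriv_const_smul (D := trivialLine 𝓘(ℝ, E) M) (1 / (2 * ((n : ℝ) + 1)))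
    ((smoothSection_line_iff.2 (contMDiff_trace hRVW)).diffSectionAt x) z

theorem gradR_skew (x : M) (z u v w : Tan E M x) :
    𝓕.gradR x z u v w = -𝓕.gradR x z v u w := by
  obtain ⟨U, hU, rfl, hUx⟩ := exists_smoothSection_parallelAt 𝓕.conn x u
  obtain ⟨V, hV, rfl, hVx⟩ := exists_smoothSection_parallelAt 𝓕.conn x v
  obtain ⟨W, hW, rfl, hWx⟩ := exists_smoothSection_parallelAt 𝓕.conn x w
  have hRVUW := ((𝓕.smooth_R.hom_apply hV).hom_apply hU).hom_apply hW
  rw [gradR, 𝓕.derivSection_apply₃_of_parallelAt 𝓕.smooth_R hU hV hW hUx hVx hWx,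
    𝓕.derivSection_apply₃_of_parallelAt 𝓕.smooth_R hV hU hW hVx hUx hWx,
    ← neg_one_smul ℝ, ← DiffSectionAt.covDeriv_const_smul _ (hRVUW.diffSectionAt x)]
  congr 3
  funext y
  rw [𝓕.R_skew y (U y), neg_one_smul]

theorem gradR_eq (x : M) (z u v w : Tan E M x) :
    𝓕.gradR x z u v w = 𝓕.gradV x z u v w +
      ((𝓕.gradPhi x z v w : ℝ) • u - (𝓕.gradPhi x z u w : ℝ) • v
        + (𝓕.form x u w : ℝ) • 𝓕.raise x (𝓕.gradPhi x z v)
        - (𝓕.form x v w : ℝ) • 𝓕.raise x (𝓕.gradPhi x z u)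
        + (2 : ℝ) • (𝓕.form x u v : ℝ) • 𝓕.raise x (𝓕.gradPhi x z w)) := by
  obtain ⟨U, hU, rfl, hUx⟩ := exists_smoothSection_parallelAt 𝓕.conn x u
  obtain ⟨V, hV, rfl, hVx⟩ := exists_smoothSection_parallelAt 𝓕.conn x v
  obtain ⟨W, hW, rfl, hWx⟩ := exists_smoothSection_parallelAt 𝓕.conn x w
  have hVUVW := ((𝓕.smooth_V.hom_apply hU).hom_apply hV).hom_apply hW
  have hΦVW := 𝓕.smooth_Phi_smul hV hW hU
  have hΦUW := 𝓕.smooth_Phi_smul hU hW hV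
  have hJUW := 𝓕.smooth_form_smul_raise_Phi hU hW hV
  have hJVW := 𝓕.smooth_form_smul_raise_Phi hV hW hU
  have hJUV := 𝓕.smooth_form_smul_raise_Phi hU hV hW
  have h₂ := hΦVW.sub hΦUW
  have h₃ := h₂.add hJUW
  have h₄ := h₃.sub hJVW
  have h₅ := h₄.add (hJUV.const_smul 2)
  rw [gradR, gradV, 𝓕.derivSection_apply₃_of_parallelAt 𝓕.smooth_R hU hV hW hUx hVx hWx,
    𝓕.derivSection_apply₃_of_parallelAt 𝓕.smooth_V hU hV hW hUx hVx hWx]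
  simp only [𝓕.R_eq, mul_smul]
  rw [DiffSectionAt.covDeriv_add (hVUVW.diffSectionAt x) (h₅.diffSectionAt x),
    DiffSectionAt.covDeriv_add (h₄.diffSectionAt x) ((hJUV.const_smul 2).diffSectionAt x),
    DiffSectionAt.covDeriv_const_smul 2 (hJUV.diffSectionAt x),
    DiffSectionAt.covDeriv_sub (h₃.diffSectionAt x) (hJVW.diffSectionAt x),
    DiffSectionAt.covDeriv_add (h₂.diffSectionAt x) (hJUW.diffSectionAt x),
    DiffSectionAt.covDeriv_sub (hΦVW.diffSectionAt x) (hΦUW.diffSectionAt x),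
    𝓕.conn_Phi_smul_of_parallelAt hV hW hU hVx hWx hUx,
    𝓕.conn_Phi_smul_of_parallelAt hU hW hV hUx hWx hVx,
    𝓕.conn_form_smul_raise_Phi_of_parallelAt hU hW hV hUx hWx hVx,
    𝓕.conn_form_smul_raise_Phi_of_parallelAt hV hW hU hVx hWx hUx,
    𝓕.conn_form_smul_raise_Phi_of_parallelAt hU hV hW hUx hVx hWx]

/-- The linear form `z ↦ z^e v^a w^b ∇_e Φ_{ab}`, with the direction of differentiation left
free. -/
def gradPhiForm (x : M) (v w : Tan E M x) : Tan E M x →ₗ[ℝ] ℝ where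
  toFun z := 𝓕.gradPhi x z v w
  map_add' z z' := by
    rw [map_add]
    rfl
  map_smul' c z := by
    rw [map_smul]
    rfl

/-- The tensor `(z, q) ↦ z^e v^a q^b ∇_e Φ_{ab}`, the transpose of `gradPhiAux`. -/
def gradPhiAt (x : M) (v : Tan E M x) : HomBundle (Tan E M) (Cotan E M) x :=
  .ofLinear
    { toFun z := 𝓕.gradPhi x z v
      map_add' z z' := by simp
      map_smul' c z := by simp }

theorem contract_gradPhiAt (x : M) (v : Tan E M x) :
    𝓕.contract x (𝓕.gradPhiAt x v) = -((2 * (n : ℝ) + 1) * (𝓕.S x v : ℝ)) := by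
  have transpose : 𝓕.contract x (𝓕.gradPhiAux x v) = -𝓕.contract x (𝓕.gradPhiAt x v) :=
    𝓕.contract_transpose fun _ _ ↦ rfl
  have hS : (𝓕.S x v : ℝ) = (1 / (2 * (n : ℝ) + 1)) * 𝓕.contract x (𝓕.gradPhiAux x v) := rfl
  have hn : (2 * (n : ℝ) + 1) ≠ 0 := by positivity
  rw [hS, transpose]
  field_simp

theorem trace_gradR (x : M) (u v w : Tan E M x) {L : Tan E M x →ₗ[ℝ] Tan E M x}
    (hL : ∀ z, L z = 𝓕.gradR x z u v w) :
    LinearMap.trace ℝ (Tan E M x) L =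
      2 * ((n : ℝ) + 1) * ((𝓕.gradPhi x u v w : ℝ) - (𝓕.gradPhi x v u w : ℝ)) := by
  have L_eq : L = firstSlot (𝓕.gradR x u) v w - firstSlot (𝓕.gradR x v) u w := by
    ext z
    have bianchi := 𝓕.bianchi_second x z u v w
    rw [𝓕.gradR_skew x u v z w] at bianchi
    change L z = 𝓕.gradR x u z v w - 𝓕.gradR x v z u w
    rw [hL, ← sub_eq_zero, ← bianchi]
    abel
  have hn : ((n : ℝ) + 1) ≠ 0 := by positivity
  rw [L_eq, map_sub, 𝓕.gradPhi_eq_trace_gradR, 𝓕.gradPhi_eq_trace_gradR]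
  field_simp

-- The trace over the first slot of the decomposition `gradR_eq`, evaluated on the left by the
-- second Bianchi identity.
theorem Y_eq (x : M) (u v w : Tan E M x) :
    (𝓕.Y x u v w : ℝ) = (𝓕.gradPhi x u v w : ℝ) - (𝓕.gradPhi x v u w : ℝ) +
      (𝓕.S x v : ℝ) * (𝓕.form x u w : ℝ) - (𝓕.S x u : ℝ) * (𝓕.form x v w : ℝ) +
      2 * ((𝓕.S x w : ℝ) * (𝓕.form x u v : ℝ)) := by
  let raiseGradPhi (v : Tan E M x) : Tan E M x →ₗ[ℝ] Tan E M x :=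
    𝓕.raise x ∘ₗ (𝓕.gradPhiAt x v).toLinear
  let L : Tan E M x →ₗ[ℝ] Tan E M x := 𝓕.gradVAux x u v w +
    ((𝓕.gradPhiForm x v w).smulRight u - (𝓕.gradPhiForm x u w).smulRight v +
      (𝓕.form x u w : ℝ) • raiseGradPhi v - (𝓕.form x v w : ℝ) • raiseGradPhi u +
      (2 : ℝ) • (𝓕.form x u v : ℝ) • raiseGradPhi w)
  have trace_L := 𝓕.trace_gradR x u v w (L := L) fun z ↦ (𝓕.gradR_eq x z u v w).symm
  have trace_raiseGradPhi (v : Tan E M x) : LinearMap.trace ℝ (Tan E M x) (raiseGradPhi v) =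
      -((2 * (n : ℝ) + 1) * (𝓕.S x v : ℝ)) := 𝓕.contract_gradPhiAt x v
  have hY : (𝓕.Y x u v w : ℝ) = (1 / (2 * (n : ℝ) + 1)) *
    LinearMap.trace ℝ (Tan E M x) (𝓕.gradVAux x u v w) := rfl
  have gradPhiForm_apply (v w u : Tan E M x) :
    𝓕.gradPhiForm x v w u = (𝓕.gradPhi x u v w : ℝ) := rfl
  simp only [L, map_add, map_sub, map_smul, LinearMap.trace_smulRight, trace_raiseGradPhi,
    gradPhiForm_apply, smul_eq_mul] at trace_L
  have hn : (2 * (n : ℝ) + 1) ≠ 0 := by positivity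
  rw [hY, div_mul_eq_mul_div, one_mul, div_eq_iff hn]
  linear_combination trace_L

end FedosovStructure

/-! ### The Ricci identity for `Φ` -/

namespace FedosovStructure

open CovariantDerivative

variable {E : Type*} [NormedAddCommGroup E] [NormedSpace ℝ E] [FiniteDimensional ℝ E]
  {M : Type*} [TopologicalSpace M] [ChartedSpace E M] [IsManifold 𝓘(ℝ, E) ∞ M] {n : ℕ}
  (𝓕 : FedosovStructure E M n)

theorem raise_eq {x : M} {φ : Cotan E M x} {v : Tan E M x}
    (h : ∀ w, (φ w : ℝ) = 𝓕.form x v w) : 𝓕.raise x φ = v := by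
  rw [← 𝓕.raise_form x v]
  congr 1
  ext w
  exact h w

theorem apply_raise_comm (x : M) (φ ψ : Cotan E M x) :
    (φ (𝓕.raise x ψ) : ℝ) = -(ψ (𝓕.raise x φ) : ℝ) := by
  rw [← 𝓕.form_apply_raise, 𝓕.form_raise]

theorem contract_sub (x : M) (T T' : HomBundle (Tan E M) (Cotan E M) x) :
    𝓕.contract x (T - T') = 𝓕.contract x T - 𝓕.contract x T' := by
  rw [contract, contract, contract, ← map_sub]
  congr 1
  ext p
  exact map_sub (𝓕.raise x) _ _

variable [T2Space M]

/-- The endomorphism `q^a ↦ J^{cb} Φ_{ab} q^a`, that is, `Φ` with an index raised. -/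
def raisePhi (x : M) : Tan E M x →ₗ[ℝ] Tan E M x := 𝓕.raise x ∘ₗ (𝓕.Phi x).toLinear

theorem form_raisePhi (x : M) (v w : Tan E M x) :
    (𝓕.form x (𝓕.raisePhi x v) w : ℝ) = 𝓕.Phi x v w :=
  congr($(𝓕.form_raise x (𝓕.Phi x v)) w)

theorem Phi_raisePhi_skew (x : M) (u v : Tan E M x) :
    (𝓕.Phi x u (𝓕.raisePhi x v) : ℝ) = -(𝓕.Phi x v (𝓕.raisePhi x u) : ℝ) :=
  𝓕.apply_raise_comm x _ _

theorem form_raisePhi_raisePhi (x : M) (u v : Tan E M x) :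
    (𝓕.form x u (𝓕.raisePhi x (𝓕.raisePhi x v)) : ℝ) = -(𝓕.Phi x u (𝓕.raisePhi x v) : ℝ) :=
  (𝓕.form_apply_raise x u _).trans (congrArg (fun t : ℝ ↦ -t) (𝓕.Phi_symm x _ u))

theorem contract_VPhi (x : M) (u v : Tan E M x) : 𝓕.contract x (𝓕.VPhi x u v) =
    LinearMap.trace ℝ (Tan E M x) (𝓕.raisePhi x ∘ₗ (𝓕.V x u v).toLinear) := by
  rw [contract]
  congr 1
  ext p
  exact 𝓕.raise_eq fun w ↦ (𝓕.Phi_symm x w _).trans (𝓕.form_raisePhi x _ w).symm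

theorem contract_PhiPhi (x : M) : 𝓕.contract x (𝓕.PhiPhi x) =
    -LinearMap.trace ℝ (Tan E M x) (𝓕.raisePhi x ∘ₗ 𝓕.raisePhi x) := by
  rw [contract, ← map_neg]
  congr 1
  ext p
  refine 𝓕.raise_eq fun w ↦ ?_
  change (𝓕.Phi x p (𝓕.raisePhi x w) : ℝ) = 𝓕.form x (-𝓕.raisePhi x (𝓕.raisePhi x p)) w
  rw [map_neg, HomBundle.neg_apply, 𝓕.form_raisePhi, 𝓕.Phi_symm x _ w]
  exact 𝓕.Phi_raisePhi_skew x p w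

theorem trace_raisePhi_R (x : M) (u v : Tan E M x) :
    LinearMap.trace ℝ (Tan E M x) (𝓕.raisePhi x ∘ₗ (𝓕.R x u v).toLinear) =
      𝓕.contract x (𝓕.VPhi x u v) - 4 * (𝓕.Phi x u (𝓕.raisePhi x v) : ℝ) -
        2 * (𝓕.form x u v : ℝ) * 𝓕.contract x (𝓕.PhiPhi x) := by
  let Φ (v : Tan E M x) : Tan E M x →ₗ[ℝ] ℝ := (𝓕.Phi x v).toLinear
  let J (v : Tan E M x) : Tan E M x →ₗ[ℝ] ℝ := (𝓕.form x v).toLinear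
  have decomposition : 𝓕.raisePhi x ∘ₗ (𝓕.R x u v).toLinear =
      𝓕.raisePhi x ∘ₗ (𝓕.V x u v).toLinear +
      ((Φ v).smulRight (𝓕.raisePhi x u) - (Φ u).smulRight (𝓕.raisePhi x v) +
        (J u).smulRight (𝓕.raisePhi x (𝓕.raisePhi x v)) -
        (J v).smulRight (𝓕.raisePhi x (𝓕.raisePhi x u)) +
        (2 * (𝓕.form x u v : ℝ)) • (𝓕.raisePhi x ∘ₗ 𝓕.raisePhi x)) := by
    ext p
    change 𝓕.raisePhi x (𝓕.R x u v p) = _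
    rw [𝓕.R_eq]
    simp only [map_add, map_sub, map_smul]
    rfl
  have hJ (a b : Tan E M x) : J a (𝓕.raisePhi x (𝓕.raisePhi x b)) =
      -(𝓕.Phi x a (𝓕.raisePhi x b) : ℝ) := 𝓕.form_raisePhi_raisePhi x a b
  have hΦ (a b : Tan E M x) : Φ a (𝓕.raisePhi x b) = (𝓕.Phi x a (𝓕.raisePhi x b) : ℝ) := rfl
  rw [decomposition, contract_VPhi, contract_PhiPhi]
  simp only [map_add, map_sub, map_smul, LinearMap.trace_smulRight, smul_eq_mul, hJ, hΦ]
  rw [𝓕.Phi_raisePhi_skew x v u]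
  ring

theorem trace_firstSlot_R (x : M) (v w : Tan E M x) :
    LinearMap.trace ℝ (Tan E M x) (firstSlot (𝓕.R x) v w) =
      2 * ((n : ℝ) + 1) * (𝓕.Phi x v w : ℝ) := by
  have hn : ((n : ℝ) + 1) ≠ 0 := by positivity
  rw [𝓕.Phi_apply]
  field_simp

theorem trace_raisePhi_firstSlot_R_sub (x : M) (u v : Tan E M x) :
    LinearMap.trace ℝ (Tan E M x) (𝓕.raisePhi x ∘ₗ firstSlot (𝓕.R x) u v) -
        LinearMap.trace ℝ (Tan E M x) (𝓕.raisePhi x ∘ₗ firstSlot (𝓕.R x) v u) =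
      -LinearMap.trace ℝ (Tan E M x) (𝓕.raisePhi x ∘ₗ (𝓕.R x u v).toLinear) := by
  rw [← map_sub, ← map_neg]
  congr 1
  ext p
  change 𝓕.raisePhi x (𝓕.R x p u v) - 𝓕.raisePhi x (𝓕.R x p v u) = -𝓕.raisePhi x (𝓕.R x u v p)
  rw [← map_sub, ← map_neg, 𝓕.R_skew x p v u]
  congr 1
  rw [eq_neg_iff_add_eq_zero, ← 𝓕.bianchi_first x p u v]
  abel

/-- `∇_e ∇_c Φ_{ab}`, the indices `e` and `c` being the first two arguments. -/
def hessPhi (x : M) : HomBundle (Tan E M) (HomBundle (Tan E M)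
    (HomBundle (Tan E M) (Cotan E M))) x :=
  derivSection (𝓕.conn.hom (𝓕.conn.hom 𝓕.cotanConn)) 𝓕.gradPhi x

theorem hessPhi_sub_hessPhi_swap (x : M) (p u v w : Tan E M x) :
    (𝓕.hessPhi x p u v w : ℝ) - (𝓕.hessPhi x u p v w : ℝ) =
      -(𝓕.Phi x (𝓕.R x p u v) w : ℝ) - (𝓕.Phi x v (𝓕.R x p u w) : ℝ) := by
  obtain ⟨V, hV, rfl⟩ := exists_smoothSection_eq 𝓘(ℝ, E) E v
  have ricci := 𝓕.curv_hom_apply (D := 𝓕.conn) (D' := 𝓕.cotanConn) 𝓕.smooth_Phi hV x p u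
  rw [← 𝓕.R_apply_section hV] at ricci
  have ricci_apply := congr($ricci w)
  rw [HomBundle.sub_apply, 𝓕.curv_cotanConn (𝓕.smooth_Phi.hom_apply hV)] at ricci_apply
  refine (Eq.trans rfl ricci_apply).trans ?_
  change (-_ - _ : ℝ) = _
  ring

section Parallel

variable {P Q W : Π x, Tan E M x} {x : M}

theorem mvfderiv_S_of_parallelAt (hP : SmoothSection 𝓘(ℝ, E) E P) (hPx : 𝓕.conn P x = 0)
    (z : Tan E M x) :
    mvfderiv 𝓘(ℝ, E) (fun y ↦ (𝓕.S y (P y) : ℝ)) x z = 𝓕.gradS x z (P x) :=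
  (𝓕.smooth_S.hom_apply_of_parallelAt (D' := trivialLine 𝓘(ℝ, E) M) hP hPx z).symm

theorem smooth_S_smul_form (hP : SmoothSection 𝓘(ℝ, E) E P) (hQ : SmoothSection 𝓘(ℝ, E) E Q)
    (hW : SmoothSection 𝓘(ℝ, E) E W) :
    SmoothSection 𝓘(ℝ, E) ℝ (fun y ↦ (𝓕.S y (P y) : ℝ) • 𝓕.form y (Q y) (W y)) :=
  ((𝓕.smooth.hom_apply hQ).hom_apply hW).smul (smoothSection_line_iff.1 (𝓕.smooth_S.hom_apply hP))

theorem trivialLine_S_smul_form_of_parallelAt (hP : SmoothSection 𝓘(ℝ, E) E P)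
    (hQ : SmoothSection 𝓘(ℝ, E) E Q) (hW : SmoothSection 𝓘(ℝ, E) E W) (hPx : 𝓕.conn P x = 0)
    (hQx : 𝓕.conn Q x = 0) (hWx : 𝓕.conn W x = 0) (z : Tan E M x) :
    trivialLine 𝓘(ℝ, E) M (fun y ↦ (𝓕.S y (P y) : ℝ) • 𝓕.form y (Q y) (W y)) x z =
      (𝓕.gradS x z (P x) : ℝ) * (𝓕.form x (Q x) (W x) : ℝ) := by
  have hS := smoothSection_line_iff.1 (𝓕.smooth_S.hom_apply hP)
  have hJ := (𝓕.smooth.hom_apply hQ).hom_apply hW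
  have hJx : trivialLine 𝓘(ℝ, E) M (fun y ↦ 𝓕.form y (Q y) (W y)) x z = 0 :=
    𝓕.mvfderiv_form_of_parallelAt hQ hW hQx hWx z
  rw [DiffSectionAt.covDeriv_smul (hS.mdifferentiable (by simp) x) (hJ.diffSectionAt x), hJx,
    smul_zero, 𝓕.mvfderiv_S_of_parallelAt hP hPx]
  exact zero_add (M := ℝ) _

end Parallel

theorem gradY_eq (x : M) (p u v w : Tan E M x) :
    (𝓕.gradY x p u v w : ℝ) = (𝓕.hessPhi x p u v w : ℝ) - (𝓕.hessPhi x p v u w : ℝ) +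
      (𝓕.gradS x p v : ℝ) * (𝓕.form x u w : ℝ) - (𝓕.gradS x p u : ℝ) * (𝓕.form x v w : ℝ) +
      2 * ((𝓕.gradS x p w : ℝ) * (𝓕.form x u v : ℝ)) := by
  obtain ⟨U, hU, rfl, hUx⟩ := exists_smoothSection_parallelAt 𝓕.conn x u
  obtain ⟨V, hV, rfl, hVx⟩ := exists_smoothSection_parallelAt 𝓕.conn x v
  obtain ⟨W, hW, rfl, hWx⟩ := exists_smoothSection_parallelAt 𝓕.conn x w
  have Y_eq_smul : (fun y ↦ 𝓕.Y y (U y) (V y) (W y)) = fun y ↦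
      𝓕.gradPhi y (U y) (V y) (W y) - 𝓕.gradPhi y (V y) (U y) (W y) +
        (𝓕.S y (V y) : ℝ) • 𝓕.form y (U y) (W y) - (𝓕.S y (U y) : ℝ) • 𝓕.form y (V y) (W y) +
        (2 : ℝ) • (𝓕.S y (W y) : ℝ) • 𝓕.form y (U y) (V y) :=
    funext fun y ↦ 𝓕.Y_eq y (U y) (V y) (W y)
  have hUVW := ((𝓕.smooth_gradPhi.hom_apply hU).hom_apply hV).hom_apply hW
  have hVUW := ((𝓕.smooth_gradPhi.hom_apply hV).hom_apply hU).hom_apply hW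
  have hSV := 𝓕.smooth_S_smul_form hV hU hW
  have hSU := 𝓕.smooth_S_smul_form hU hV hW
  have hSW := 𝓕.smooth_S_smul_form hW hU hV
  have h₂ := hUVW.sub hVUW
  have h₃ := h₂.add hSV
  have h₄ := h₃.sub hSU
  rw [gradY, cotanConn, 𝓕.derivSection_apply₃_of_parallelAt (D := trivialLine 𝓘(ℝ, E) M)
      𝓕.smooth_Y hU hV hW hUx hVx hWx, Y_eq_smul,
    DiffSectionAt.covDeriv_add (h₄.diffSectionAt x) ((hSW.const_smul 2).diffSectionAt x),
    DiffSectionAt.covDeriv_sub (h₃.diffSectionAt x) (hSU.diffSectionAt x),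
    DiffSectionAt.covDeriv_add (h₂.diffSectionAt x) (hSV.diffSectionAt x),
    DiffSectionAt.covDeriv_sub (hUVW.diffSectionAt x) (hVUW.diffSectionAt x),
    DiffSectionAt.covDeriv_const_smul 2 (hSW.diffSectionAt x),
    𝓕.trivialLine_S_smul_form_of_parallelAt hV hU hW hVx hUx hWx,
    𝓕.trivialLine_S_smul_form_of_parallelAt hU hV hW hUx hVx hWx,
    𝓕.trivialLine_S_smul_form_of_parallelAt hW hU hV hWx hUx hVx, hessPhi, cotanConn,
    𝓕.derivSection_apply₃_of_parallelAt (D := trivialLine 𝓘(ℝ, E) M)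
      𝓕.smooth_gradPhi hU hV hW hUx hVx hWx,
    𝓕.derivSection_apply₃_of_parallelAt (D := trivialLine 𝓘(ℝ, E) M)
      𝓕.smooth_gradPhi hV hU hW hVx hUx hWx]
  rfl

theorem smooth_gradPhiAt {V : Π x, Tan E M x} (hV : SmoothSection 𝓘(ℝ, E) E V) :
    SmoothSection 𝓘(ℝ, E) (HomFiber E (HomFiber E ℝ)) (fun y ↦ 𝓕.gradPhiAt y (V y)) :=
  smoothSection_hom fun _ hP ↦ (𝓕.smooth_gradPhi.hom_apply hP).hom_apply hV

theorem derivSection_gradPhiAt_of_parallelAt {V : Π x, Tan E M x}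
    (hV : SmoothSection 𝓘(ℝ, E) E V) {x : M} (hVx : 𝓕.conn V x = 0) (u p : Tan E M x) :
    (𝓕.conn.hom 𝓕.cotanConn (fun y ↦ 𝓕.gradPhiAt y (V y)) x u :
      HomBundle (Tan E M) (Cotan E M) x) p = 𝓕.hessPhi x u p (V x) := by
  obtain ⟨P, hP, rfl, hPx⟩ := exists_smoothSection_parallelAt 𝓕.conn x p
  exact ((𝓕.smooth_gradPhiAt hV).hom_apply_of_parallelAt hP hPx u).trans
    (𝓕.derivSection_apply₂_of_parallelAt (D := 𝓕.cotanConn)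
      𝓕.smooth_gradPhi hP hV hPx hVx u).symm

theorem trace_hessPhi (x : M) (u v : Tan E M x) {L : Tan E M x →ₗ[ℝ] Tan E M x}
    (hL : ∀ p, L p = 𝓕.raise x (𝓕.hessPhi x u p v)) :
    LinearMap.trace ℝ (Tan E M x) L = -((2 * (n : ℝ) + 1) * (𝓕.gradS x u v : ℝ)) := by
  obtain ⟨V, hV, rfl, hVx⟩ := exists_smoothSection_parallelAt 𝓕.conn x v
  let T : HomBundle (Tan E M) (Cotan E M) x :=
    𝓕.conn.hom 𝓕.cotanConn (fun y ↦ 𝓕.gradPhiAt y (V y)) x u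
  have trace_L : LinearMap.trace ℝ (Tan E M x) L = 𝓕.contract x T := by
    rw [contract]
    congr 1
    ext p
    rw [hL, ← 𝓕.derivSection_gradPhiAt_of_parallelAt hV hVx]
    rfl
  have contract_eq : (fun y ↦ 𝓕.contract y (𝓕.gradPhiAt y (V y))) =
      fun y ↦ (-(2 * (n : ℝ) + 1)) • (𝓕.S y (V y) : ℝ) := by
    funext y
    rw [𝓕.contract_gradPhiAt, smul_eq_mul, neg_mul]
  rw [trace_L, ← 𝓕.mvfderiv_contract (𝓕.smooth_gradPhiAt hV) x u, contract_eq, ← neg_mul,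
    ← 𝓕.mvfderiv_S_of_parallelAt hV hVx]
  exact DiffSectionAt.covDeriv_const_smul (D := trivialLine 𝓘(ℝ, E) M) (-(2 * (n : ℝ) + 1))
    ((𝓕.smooth_S.hom_apply hV).diffSectionAt x) u

/-- The endomorphism `p^e ↦ J^{cb} p^e u^f v^a ∇_e ∇_f Φ_{ab}`. -/
def raiseHessPhi (x : M) (u v : Tan E M x) : Tan E M x →ₗ[ℝ] Tan E M x :=
  𝓕.raise x ∘ₗ
    { toFun p := 𝓕.hessPhi x p u v
      map_add' p p' := by simp
      map_smul' c p := by simp }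

theorem form_raiseHessPhi (x : M) (u v p w : Tan E M x) :
    (𝓕.form x (𝓕.raiseHessPhi x u v p) w : ℝ) = 𝓕.hessPhi x p u v w :=
  congr($(𝓕.form_raise x (𝓕.hessPhi x p u v)) w)

-- The Ricci identity reduces this trace to `trace_hessPhi`, where the contraction commutes with
-- the outer derivative.
theorem trace_raiseHessPhi (x : M) (u v : Tan E M x) :
    LinearMap.trace ℝ (Tan E M x) (𝓕.raiseHessPhi x u v) =
      -((2 * (n : ℝ) + 1) * (𝓕.gradS x u v : ℝ)) -
      LinearMap.trace ℝ (Tan E M x) (𝓕.raisePhi x ∘ₗ firstSlot (𝓕.R x) u v) +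
      2 * ((n : ℝ) + 1) * (𝓕.Phi x u (𝓕.raisePhi x v) : ℝ) := by
  let A := 𝓕.raisePhi x ∘ₗ firstSlot (𝓕.R x) u v
  let B := firstSlot (𝓕.R x) u (𝓕.raisePhi x v)
  have form_A (p w : Tan E M x) : (𝓕.form x (A p) w : ℝ) = 𝓕.Phi x (𝓕.R x p u v) w :=
    𝓕.form_raisePhi x _ w
  have form_B (p w : Tan E M x) :
      (𝓕.form x (B p) w : ℝ) = -(𝓕.Phi x v (𝓕.R x p u w) : ℝ) := by
    rw [← 𝓕.form_raisePhi]
    exact 𝓕.form_R x p u _ w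
  have trace_swap := 𝓕.trace_hessPhi x u v (L := 𝓕.raiseHessPhi x u v + A - B) fun p ↦ by
    refine Eq.symm (𝓕.raise_eq fun w ↦ ?_)
    have ricci := 𝓕.hessPhi_sub_hessPhi_swap x p u v w
    rw [← 𝓕.form_raiseHessPhi, ← form_A] at ricci
    rw [LinearMap.sub_apply, LinearMap.add_apply, map_sub, map_add, HomBundle.sub_apply,
      HomBundle.add_apply]
    linear_combination form_B p w - ricci
  rw [map_sub, map_add, 𝓕.trace_firstSlot_R] at trace_swap
  linear_combination trace_swap

/-- The linear form `p ↦ p^c v^d ∇_c S_d`, with the direction of differentiation left free. -/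
def gradSForm (x : M) (v : Tan E M x) : Tan E M x →ₗ[ℝ] ℝ where
  toFun p := 𝓕.gradS x p v
  map_add' p p' := by
    rw [map_add]
    rfl
  map_smul' c p := by
    rw [map_smul]
    rfl

theorem raise_gradYAux (x : M) (u v : Tan E M x) :
    𝓕.raise x ∘ₗ (𝓕.gradYAux x u v).toLinear =
      𝓕.raiseHessPhi x u v - 𝓕.raiseHessPhi x v u +
      ((𝓕.gradSForm x v).smulRight u - (𝓕.gradSForm x u).smulRight v) +
      (2 * (𝓕.form x u v : ℝ)) • (𝓕.raise x ∘ₗ (𝓕.gradS x).toLinear) := by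
  ext p
  refine 𝓕.raise_eq fun w ↦ ?_
  change (𝓕.gradY x p u v w : ℝ) =
    𝓕.form x (𝓕.raise x (𝓕.hessPhi x p u v) - 𝓕.raise x (𝓕.hessPhi x p v u) +
      ((𝓕.gradS x p v : ℝ) • u - (𝓕.gradS x p u : ℝ) • v) +
      (2 * (𝓕.form x u v : ℝ)) • 𝓕.raise x (𝓕.gradS x p)) w
  simp only [map_add, map_sub, map_smul, HomBundle.add_apply, HomBundle.sub_apply,
    HomBundle.smul_apply, 𝓕.form_raise, smul_eq_mul]
  rw [𝓕.gradY_eq]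
  ring

theorem contract_gradYAux (x : M) (u v : Tan E M x) :
    𝓕.contract x (𝓕.gradYAux x u v) = 𝓕.contract x (𝓕.VPhi x u v) -
      2 * (n : ℝ) * ((𝓕.gradS x u v : ℝ) - (𝓕.gradS x v u : ℝ) -
        2 * (𝓕.Phi x u (𝓕.raisePhi x v) : ℝ)) +
      2 * (𝓕.form x u v : ℝ) * 𝓕.contract x (𝓕.gradS x - 𝓕.PhiPhi x) := by
  have curvature_terms := 𝓕.trace_raisePhi_firstSlot_R_sub x u v
  have contract_gradS : 𝓕.contract x (𝓕.gradS x) =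
    LinearMap.trace ℝ (Tan E M x) (𝓕.raise x ∘ₗ (𝓕.gradS x).toLinear) := rfl
  have gradSForm_apply (u v : Tan E M x) : 𝓕.gradSForm x v u = (𝓕.gradS x u v : ℝ) := rfl
  rw [trace_raisePhi_R] at curvature_terms
  rw [contract, raise_gradYAux]
  simp only [map_add, map_sub, map_smul, LinearMap.trace_smulRight, smul_eq_mul, gradSForm_apply,
    trace_raiseHessPhi, contract_sub, 𝓕.Phi_raisePhi_skew x v u, ← contract_gradS]
  linear_combination -curvature_terms

end FedosovStructure

/-! ### Tractors -/

section ProductSections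

variable {E : Type*} [NormedAddCommGroup E] [NormedSpace ℝ E]
  {H : Type*} [TopologicalSpace H] {I : ModelWithCorners ℝ E H}
  {M : Type*} [TopologicalSpace M] [ChartedSpace H M]
  {F : Type*} [NormedAddCommGroup F] [NormedSpace ℝ F]
  {V : M → Type*} [TopologicalSpace (TotalSpace F V)]
  [∀ x, AddCommGroup (V x)] [∀ x, TopologicalSpace (V x)] [FiberBundle F V]
  {F' : Type*} [NormedAddCommGroup F'] [NormedSpace ℝ F']
  {V' : M → Type*} [TopologicalSpace (TotalSpace F' V')]
  [∀ x, AddCommGroup (V' x)] [∀ x, TopologicalSpace (V' x)] [FiberBundle F' V']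

theorem smoothSection_prod_iff {s : Π x, (V ×ᵇ V') x} :
    SmoothSection I (F × F') s ↔
      SmoothSection I F (fun y ↦ (s y).1) ∧ SmoothSection I F' (fun y ↦ (s y).2) := by
  refine Iff.trans (forall_congr' fun x ↦ ?_) forall_and
  rw [contMDiffAt_section, contMDiffAt_section, contMDiffAt_section]
  exact contMDiffAt_prod_module_iff _

end ProductSections

namespace FedosovStructure

open CovariantDerivative

section TractorSections

variable {E : Type*} [NormedAddCommGroup E] [NormedSpace ℝ E]
  {M : Type*} [TopologicalSpace M] [ChartedSpace E M] [IsManifold 𝓘(ℝ, E) ∞ M]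

/-- The section `(σ, μ, ρ)` of the standard tractor bundle assembled from its components. -/
def tractorSection (σ : M → ℝ) (μ : Π x, Cotan E M x) (ρ : M → ℝ) (x : M) : Tractor E M x :=
  (σ x, μ x, ρ x)

theorem smoothSection_tractorSection_iff {σ ρ : M → ℝ} {μ : Π x, Cotan E M x} :
    SmoothSection 𝓘(ℝ, E) (TractorFiber E) (tractorSection σ μ ρ) ↔
      ContMDiff 𝓘(ℝ, E) 𝓘(ℝ, ℝ) ∞ σ ∧ SmoothSection 𝓘(ℝ, E) (HomFiber E ℝ) μ ∧
        ContMDiff 𝓘(ℝ, E) 𝓘(ℝ, ℝ) ∞ ρ := by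
  rw [smoothSection_prod_iff, smoothSection_prod_iff]
  exact and_congr smoothSection_line_iff (and_congr_right' smoothSection_line_iff)

theorem exists_eq_tractorSection {s : Π x, Tractor E M x}
    (hs : SmoothSection 𝓘(ℝ, E) (TractorFiber E) s) :
    ∃ (σ : M → ℝ) (μ : Π x, Cotan E M x) (ρ : M → ℝ), ContMDiff 𝓘(ℝ, E) 𝓘(ℝ, ℝ) ∞ σ ∧
      SmoothSection 𝓘(ℝ, E) (HomFiber E ℝ) μ ∧ ContMDiff 𝓘(ℝ, E) 𝓘(ℝ, ℝ) ∞ ρ ∧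
      s = tractorSection σ μ ρ :=
  have ⟨hσ, hμ, hρ⟩ := smoothSection_tractorSection_iff.1 hs
  ⟨_, _, _, hσ, hμ, hρ, rfl⟩

end TractorSections

variable {E : Type*} [NormedAddCommGroup E] [NormedSpace ℝ E] [FiniteDimensional ℝ E]
  {M : Type*} [TopologicalSpace M] [ChartedSpace E M] [IsManifold 𝓘(ℝ, E) ∞ M] {n : ℕ}
  (𝓕 : FedosovStructure E M n)

section Pairing

theorem pairing_apply (x : M) (σ σ' ρ ρ' : ℝ) (μ μ' : Cotan E M x) :
    𝓕.pairing x (σ, μ, ρ) (σ', μ', ρ') = σ * ρ' + (μ (𝓕.raise x μ') : ℝ) - ρ * σ' :=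
  rfl

theorem pairing_skew (x : M) (s t : Tractor E M x) : 𝓕.pairing x s t = -𝓕.pairing x t s := by
  rw [pairing, pairing, 𝓕.apply_raise_comm x s.2.1 t.2.1]
  ring

theorem pairing_nondegenerate (x : M) (s : Tractor E M x) (h : ∀ t, 𝓕.pairing x s t = 0) :
    s = 0 := by
  obtain ⟨σ, μ, ρ⟩ := s
  have apply_raise_zero : (μ (𝓕.raise x 0) : ℝ) = 0 := by rw [map_zero, map_zero]
  have sigma_eq_zero : (σ : ℝ) = 0 := by
    have := h (0, 0, (1 : ℝ))
    rw [pairing_apply, apply_raise_zero] at this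
    linarith
  have rho_eq_zero : (ρ : ℝ) = 0 := by
    have := h ((1 : ℝ), 0, 0)
    rw [pairing_apply, apply_raise_zero] at this
    linarith
  have mu_eq_zero : μ = 0 := by
    ext w
    have := h (0, 𝓕.form x w, 0)
    rw [pairing_apply, raise_form] at this
    change (μ w : ℝ) = 0
    linarith
  exact Prod.ext sigma_eq_zero (Prod.ext mu_eq_zero rho_eq_zero)

theorem pairing_add_left (x : M) (s s' t : Tractor E M x) :
    𝓕.pairing x (s + s') t = 𝓕.pairing x s t + 𝓕.pairing x s' t := by
  obtain ⟨σ, μ, ρ⟩ := s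
  obtain ⟨σ', μ', ρ'⟩ := s'
  change (σ + σ' : ℝ) * t.2.2 + (μ (𝓕.raise x t.2.1) + μ' (𝓕.raise x t.2.1) : ℝ) -
    (ρ + ρ' : ℝ) * t.1 = _
  rw [pairing, pairing]
  ring

theorem pairing_add_right (x : M) (s t t' : Tractor E M x) :
    𝓕.pairing x s (t + t') = 𝓕.pairing x s t + 𝓕.pairing x s t' := by
  rw [pairing_skew, pairing_add_left, 𝓕.pairing_skew x t, 𝓕.pairing_skew x t']
  ring

theorem mvfderiv_apply_raise {μ μ' : Π x, Cotan E M x}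
    (hμ : SmoothSection 𝓘(ℝ, E) (HomFiber E ℝ) μ) (hμ' : SmoothSection 𝓘(ℝ, E) (HomFiber E ℝ) μ')
    (x : M) (u : Tan E M x) :
    mvfderiv 𝓘(ℝ, E) (fun y ↦ (μ y (𝓕.raise y (μ' y)) : ℝ)) x u =
      ((𝓕.cotanConn μ x u : Cotan E M x) (𝓕.raise x (μ' x)) : ℝ) +
        (μ x (𝓕.raise x (𝓕.cotanConn μ' x u)) : ℝ) := by
  rw [← 𝓕.conn_raise hμ']
  exact hμ.covDeriv_hom_apply (D := 𝓕.conn) (D' := trivialLine 𝓘(ℝ, E) M) (𝓕.smooth_raise hμ') x u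

theorem mvfderiv_pairing_tractorSection {σ σ' ρ ρ' : M → ℝ} {μ μ' : Π x, Cotan E M x}
    (hσ : ContMDiff 𝓘(ℝ, E) 𝓘(ℝ, ℝ) ∞ σ) (hσ' : ContMDiff 𝓘(ℝ, E) 𝓘(ℝ, ℝ) ∞ σ')
    (hμ : SmoothSection 𝓘(ℝ, E) (HomFiber E ℝ) μ) (hμ' : SmoothSection 𝓘(ℝ, E) (HomFiber E ℝ) μ')
    (hρ : ContMDiff 𝓘(ℝ, E) 𝓘(ℝ, ℝ) ∞ ρ) (hρ' : ContMDiff 𝓘(ℝ, E) 𝓘(ℝ, ℝ) ∞ ρ')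
    (x : M) (u : Tan E M x) :
    mvfderiv 𝓘(ℝ, E)
        (fun y ↦ 𝓕.pairing y (tractorSection σ μ ρ y) (tractorSection σ' μ' ρ' y)) x u =
      𝓕.pairing x (mvfderiv 𝓘(ℝ, E) σ x u, 𝓕.cotanConn μ x u, mvfderiv 𝓘(ℝ, E) ρ x u)
          (tractorSection σ' μ' ρ' x) +
        𝓕.pairing x (tractorSection σ μ ρ x)
          (mvfderiv 𝓘(ℝ, E) σ' x u, 𝓕.cotanConn μ' x u, mvfderiv 𝓘(ℝ, E) ρ' x u) := by
  have dσ := hσ.mdifferentiable (by simp) x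
  have dσ' := hσ'.mdifferentiable (by simp) x
  have dρ := hρ.mdifferentiable (by simp) x
  have dρ' := hρ'.mdifferentiable (by simp) x
  have dμ : MDifferentiableAt 𝓘(ℝ, E) 𝓘(ℝ, ℝ) (fun y ↦ (μ y (𝓕.raise y (μ' y)) : ℝ)) x :=
    (smoothSection_line_iff.1 (hμ.hom_apply (𝓕.smooth_raise hμ'))).mdifferentiable (by simp) x
  have leibniz := mvfderiv_sub ((dσ.mul dρ').add dμ) (dρ.mul dσ')
  rw [mvfderiv_add (dσ.mul dρ') dμ, mvfderiv_mul dσ dρ', mvfderiv_mul dρ dσ'] at leibniz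
  refine (congrArg (fun L ↦ L u) leibniz).trans ?_
  simp only [sub_apply, add_apply,
    smul_apply, smul_eq_mul, tractorSection, pairing_apply,
    𝓕.mvfderiv_apply_raise hμ hμ']
  ring

end Pairing

theorem mvfderiv_tractorConnection_fst_of_parallelAt {σ : M → ℝ} {μ : Π x, Cotan E M x}
    {W : Π x, Tan E M x} (hσ : ContMDiff 𝓘(ℝ, E) 𝓘(ℝ, ℝ) ∞ σ)
    (hμ : SmoothSection 𝓘(ℝ, E) (HomFiber E ℝ) μ) (hW : SmoothSection 𝓘(ℝ, E) E W) {x : M}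
    (hWx : 𝓕.conn W x = 0) (u : Tan E M x) :
    mvfderiv 𝓘(ℝ, E) (fun y ↦ mvfderiv 𝓘(ℝ, E) σ y (W y) - (μ y (W y) : ℝ)) x u =
      mvfderiv 𝓘(ℝ, E) (fun y ↦ mvfderiv 𝓘(ℝ, E) σ y (W y)) x u -
        ((𝓕.cotanConn μ x u : Cotan E M x) (W x) : ℝ) := by
  have dσ := (contMDiff_mvfderiv_apply hσ hW).mdifferentiable (by simp) x
  have dμ := (smoothSection_line_iff.1 (hμ.hom_apply hW)).mdifferentiable (by simp) x
  refine (congrArg (fun L ↦ L u) (mvfderiv_sub dσ dμ)).trans ?_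
  exact congrArg (_ - ·)
    (hμ.hom_apply_of_parallelAt (D := 𝓕.conn) (D' := trivialLine 𝓘(ℝ, E) M) hW hWx u).symm

variable [T2Space M]

section PairingDerivative

theorem tractorConnection_eq_add_tractorForm (s : Π x, Tractor E M x) (x : M) (u : Tan E M x) :
    𝓕.tractorConnection s x u =
      (mvfderiv 𝓘(ℝ, E) (fun y ↦ (s y).1 : M → ℝ) x u, 𝓕.cotanConn (fun y ↦ (s y).2.1) x u,
        mvfderiv 𝓘(ℝ, E) (fun y ↦ (s y).2.2 : M → ℝ) x u) + 𝓕.tractorForm x (s x) u :=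
  rfl

theorem pairing_tractorForm (x : M) (s t : Tractor E M x) (u : Tan E M x) :
    𝓕.pairing x (𝓕.tractorForm x s u) t = -𝓕.pairing x s (𝓕.tractorForm x t u) := by
  obtain ⟨σ, μ, ρ⟩ := s
  obtain ⟨σ', μ', ρ'⟩ := t
  change (-(μ u) * ρ' + (ρ * 𝓕.form x u (𝓕.raise x μ') + σ * 𝓕.Phi x u (𝓕.raise x μ')) -
      (-(𝓕.Phi x u (𝓕.raise x μ)) + 𝓕.S x u * σ) * σ' : ℝ) =
    -(σ * (-(𝓕.Phi x u (𝓕.raise x μ')) + 𝓕.S x u * σ') +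
      μ (𝓕.raise x (ρ' • 𝓕.form x u + σ' • 𝓕.Phi x u)) - ρ * -(μ' u) : ℝ)
  have apply_raise : (μ (𝓕.raise x (ρ' • 𝓕.form x u + σ' • 𝓕.Phi x u)) : ℝ) =
      ρ' * (μ u : ℝ) - σ' * (𝓕.Phi x u (𝓕.raise x μ) : ℝ) := by
    simp only [map_add, map_smul, raise_form, smul_eq_mul, 𝓕.apply_raise_comm x μ (𝓕.Phi x u)]
    ring
  rw [apply_raise, form_apply_raise]
  ring

theorem mvfderiv_pairing {s t : Π x, Tractor E M x}
    (hs : SmoothSection 𝓘(ℝ, E) (TractorFiber E) s)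
    (ht : SmoothSection 𝓘(ℝ, E) (TractorFiber E) t) (x : M) (u : Tan E M x) :
    mvfderiv 𝓘(ℝ, E) (fun y ↦ 𝓕.pairing y (s y) (t y)) x u =
      𝓕.pairing x (𝓕.tractorConnection s x u) (t x) +
        𝓕.pairing x (s x) (𝓕.tractorConnection t x u) := by
  obtain ⟨σ, μ, ρ, hσ, hμ, hρ, rfl⟩ := exists_eq_tractorSection hs
  obtain ⟨σ', μ', ρ', hσ', hμ', hρ', rfl⟩ := exists_eq_tractorSection ht
  rw [𝓕.mvfderiv_pairing_tractorSection hσ hσ' hμ hμ' hρ hρ',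
    tractorConnection_eq_add_tractorForm, tractorConnection_eq_add_tractorForm, pairing_add_left,
    pairing_add_right, pairing_tractorForm]
  simp only [tractorSection]
  ring

end PairingDerivative

section TractorCurvature

variable {σ ρ : M → ℝ} {μ : Π x, Cotan E M x} {W : Π x, Tan E M x}

variable (σ μ ρ W) in
theorem tractorConnection_tractorSection :
    (fun y ↦ 𝓕.tractorConnection (tractorSection σ μ ρ) y (W y)) = tractorSection
      (fun y ↦ mvfderiv 𝓘(ℝ, E) σ y (W y) - (μ y (W y) : ℝ))
      (fun y ↦ 𝓕.cotanConn μ y (W y) + (ρ y • 𝓕.form y (W y) + σ y • 𝓕.Phi y (W y)))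
      (fun y ↦ mvfderiv 𝓘(ℝ, E) ρ y (W y) +
        (-(𝓕.Phi y (W y) (𝓕.raise y (μ y)) : ℝ) + (𝓕.S y (W y) : ℝ) * σ y)) :=
  funext fun y ↦ 𝓕.tractorConnection_apply (tractorSection σ μ ρ) y (W y)

section SmoothComponents

variable (hσ : ContMDiff 𝓘(ℝ, E) 𝓘(ℝ, ℝ) ∞ σ) (hμ : SmoothSection 𝓘(ℝ, E) (HomFiber E ℝ) μ)
  (hρ : ContMDiff 𝓘(ℝ, E) 𝓘(ℝ, ℝ) ∞ ρ) (hW : SmoothSection 𝓘(ℝ, E) E W)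

include hμ hW in
theorem contMDiff_Phi_raise :
    ContMDiff 𝓘(ℝ, E) 𝓘(ℝ, ℝ) ∞ (fun y ↦ (𝓕.Phi y (W y) (𝓕.raise y (μ y)) : ℝ)) :=
  smoothSection_line_iff.1 ((𝓕.smooth_Phi.hom_apply hW).hom_apply (𝓕.smooth_raise hμ))

include hW in
theorem contMDiff_S_apply : ContMDiff 𝓘(ℝ, E) 𝓘(ℝ, ℝ) ∞ (fun y ↦ (𝓕.S y (W y) : ℝ)) :=
  smoothSection_line_iff.1 (𝓕.smooth_S.hom_apply hW)

instance : ContMDiffCovariantDerivative 𝓕.tractorConnection ∞ :=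
  contMDiffCovariantDerivative_of_apply fun s hs W hW ↦ by
    obtain ⟨σ, μ, ρ, hσ, hμ, hρ, rfl⟩ := exists_eq_tractorSection hs
    rw [tractorConnection_tractorSection, smoothSection_tractorSection_iff]
    refine ⟨(contMDiff_mvfderiv_apply hσ hW).sub (smoothSection_line_iff.1 (hμ.hom_apply hW)),
      (hμ.covDeriv_apply hW).add (((𝓕.smooth.hom_apply hW).smul hρ).add
        ((𝓕.smooth_Phi.hom_apply hW).smul hσ)),
      (contMDiff_mvfderiv_apply hρ hW).add
        ((𝓕.contMDiff_Phi_raise hμ hW).neg.add ((𝓕.contMDiff_S_apply hW).mul hσ))⟩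

variable {x : M} (hWx : 𝓕.conn W x = 0) (u : Tan E M x)

include hσ hμ hρ hW hWx in
theorem cotanConn_tractorConnection_snd_of_parallelAt :
    𝓕.cotanConn (fun y ↦ 𝓕.cotanConn μ y (W y) + (ρ y • 𝓕.form y (W y) + σ y • 𝓕.Phi y (W y)))
        x u =
      𝓕.cotanConn (fun y ↦ 𝓕.cotanConn μ y (W y)) x u +
        (mvfderiv 𝓘(ℝ, E) ρ x u • 𝓕.form x (W x) +
          (σ x • 𝓕.gradPhi x u (W x) + mvfderiv 𝓘(ℝ, E) σ x u • 𝓕.Phi x (W x))) := by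
  have smooth_form := 𝓕.smooth.hom_apply hW
  have smooth_Phi := 𝓕.smooth_Phi.hom_apply hW
  have form_parallel : 𝓕.cotanConn (fun y ↦ 𝓕.form y (W y)) x u = 0 := by
    rw [𝓕.cotanConn_form hW, hWx]
    exact map_zero (𝓕.form x)
  have Phi_deriv : 𝓕.cotanConn (fun y ↦ 𝓕.Phi y (W y)) x u = 𝓕.gradPhi x u (W x) :=
    (𝓕.smooth_Phi.derivSection_apply_of_parallelAt hW hWx u).symm
  rw [((hμ.covDeriv_apply hW).diffSectionAt x).covDeriv_add
      (((smooth_form.smul hρ).add (smooth_Phi.smul hσ)).diffSectionAt x),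
    ((smooth_form.smul hρ).diffSectionAt x).covDeriv_add ((smooth_Phi.smul hσ).diffSectionAt x),
    DiffSectionAt.covDeriv_smul (hρ.mdifferentiable (by simp) x) (smooth_form.diffSectionAt x),
    DiffSectionAt.covDeriv_smul (hσ.mdifferentiable (by simp) x) (smooth_Phi.diffSectionAt x),
    form_parallel, Phi_deriv, smul_zero, zero_add]

include hμ hW hWx in
theorem mvfderiv_Phi_raise_of_parallelAt :
    mvfderiv 𝓘(ℝ, E) (fun y ↦ (𝓕.Phi y (W y) (𝓕.raise y (μ y)) : ℝ)) x u =
      (𝓕.gradPhi x u (W x) (𝓕.raise x (μ x)) : ℝ) +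
        (𝓕.Phi x (W x) (𝓕.raise x (𝓕.cotanConn μ x u)) : ℝ) := by
  rw [𝓕.mvfderiv_apply_raise (𝓕.smooth_Phi.hom_apply hW) hμ,
    ← 𝓕.smooth_Phi.derivSection_apply_of_parallelAt hW hWx]
  rfl

include hσ hμ hρ hW hWx in
theorem mvfderiv_tractorConnection_thd_of_parallelAt :
    mvfderiv 𝓘(ℝ, E) (fun y ↦ mvfderiv 𝓘(ℝ, E) ρ y (W y) +
        (-(𝓕.Phi y (W y) (𝓕.raise y (μ y)) : ℝ) + (𝓕.S y (W y) : ℝ) * σ y)) x u =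
      mvfderiv 𝓘(ℝ, E) (fun y ↦ mvfderiv 𝓘(ℝ, E) ρ y (W y)) x u +
        (-((𝓕.gradPhi x u (W x) (𝓕.raise x (μ x)) : ℝ) +
            (𝓕.Phi x (W x) (𝓕.raise x (𝓕.cotanConn μ x u)) : ℝ)) +
          ((𝓕.S x (W x) : ℝ) * mvfderiv 𝓘(ℝ, E) σ x u + (𝓕.gradS x u (W x) : ℝ) * σ x)) := by
  have dρ := (contMDiff_mvfderiv_apply hρ hW).mdifferentiable (by simp) x
  have dΦ := (𝓕.contMDiff_Phi_raise hμ hW).mdifferentiable (by simp) x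
  have dS := (𝓕.contMDiff_S_apply hW).mdifferentiable (by simp) x
  have dσ := hσ.mdifferentiable (by simp) x
  have leibniz := mvfderiv_add dρ (dΦ.neg.add (dS.mul dσ))
  rw [mvfderiv_add dΦ.neg (dS.mul dσ), mvfderiv_neg, mvfderiv_mul dS dσ] at leibniz
  refine (congrArg (fun L ↦ L u) leibniz).trans ?_
  simp only [add_apply, neg_apply, smul_apply, smul_eq_mul,
    𝓕.mvfderiv_Phi_raise_of_parallelAt hμ hW hWx, 𝓕.mvfderiv_S_of_parallelAt hW hWx]
  ring

include hσ hμ hW hWx in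
theorem tractorConnection_tractorConnection_fst_of_parallelAt :
    ((𝓕.tractorConnection (fun y ↦ 𝓕.tractorConnection (tractorSection σ μ ρ) y (W y)) x u).1 : ℝ) =
      mvfderiv 𝓘(ℝ, E) (fun y ↦ mvfderiv 𝓘(ℝ, E) σ y (W y)) x u -
        ((𝓕.cotanConn μ x u : Cotan E M x) (W x) : ℝ) -
      (((𝓕.cotanConn μ x (W x) : Cotan E M x) u : ℝ) +
        (ρ x * (𝓕.form x (W x) u : ℝ) + σ x * (𝓕.Phi x (W x) u : ℝ))) := by
  rw [tractorConnection_tractorSection, tractorConnection_apply]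
  exact congrArg (· - _) (𝓕.mvfderiv_tractorConnection_fst_of_parallelAt hσ hμ hW hWx u)

include hσ hμ hρ hW hWx in
theorem tractorConnection_tractorConnection_snd_of_parallelAt (w : Tan E M x) :
    ((𝓕.tractorConnection (fun y ↦ 𝓕.tractorConnection (tractorSection σ μ ρ) y (W y)) x u).2.1 w :
        ℝ) =
      ((𝓕.cotanConn (fun y ↦ 𝓕.cotanConn μ y (W y)) x u : Cotan E M x) w : ℝ) +
        (mvfderiv 𝓘(ℝ, E) ρ x u * (𝓕.form x (W x) w : ℝ) +
          (σ x * (𝓕.gradPhi x u (W x) w : ℝ) +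
            mvfderiv 𝓘(ℝ, E) σ x u * (𝓕.Phi x (W x) w : ℝ))) +
        ((mvfderiv 𝓘(ℝ, E) ρ x (W x) +
            (-(𝓕.Phi x (W x) (𝓕.raise x (μ x)) : ℝ) + (𝓕.S x (W x) : ℝ) * σ x)) *
              (𝓕.form x u w : ℝ) +
          (mvfderiv 𝓘(ℝ, E) σ x (W x) - (μ x (W x) : ℝ)) * (𝓕.Phi x u w : ℝ)) := by
  rw [tractorConnection_tractorSection, tractorConnection_apply]
  exact congrArg (fun φ : Cotan E M x ↦ (φ w : ℝ) + _)
    (𝓕.cotanConn_tractorConnection_snd_of_parallelAt hσ hμ hρ hW hWx u)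

include hσ hμ hρ hW hWx in
theorem tractorConnection_tractorConnection_thd_of_parallelAt :
    ((𝓕.tractorConnection (fun y ↦ 𝓕.tractorConnection (tractorSection σ μ ρ) y (W y)) x u).2.2 :
        ℝ) =
      mvfderiv 𝓘(ℝ, E) (fun y ↦ mvfderiv 𝓘(ℝ, E) ρ y (W y)) x u +
        (-((𝓕.gradPhi x u (W x) (𝓕.raise x (μ x)) : ℝ) +
            (𝓕.Phi x (W x) (𝓕.raise x (𝓕.cotanConn μ x u)) : ℝ)) +
          ((𝓕.S x (W x) : ℝ) * mvfderiv 𝓘(ℝ, E) σ x u + (𝓕.gradS x u (W x) : ℝ) * σ x)) +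
        (-((𝓕.Phi x u (𝓕.raise x (𝓕.cotanConn μ x (W x))) : ℝ) +
            (ρ x * (𝓕.Phi x u (W x) : ℝ) + σ x * (𝓕.Phi x u (𝓕.raisePhi x (W x)) : ℝ))) +
          (𝓕.S x u : ℝ) * (mvfderiv 𝓘(ℝ, E) σ x (W x) - (μ x (W x) : ℝ))) := by
  have Phi_raise : (𝓕.Phi x u (𝓕.raise x (𝓕.cotanConn μ x (W x) +
        (ρ x • 𝓕.form x (W x) + σ x • 𝓕.Phi x (W x)))) : ℝ) =
      (𝓕.Phi x u (𝓕.raise x (𝓕.cotanConn μ x (W x))) : ℝ) +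
        (ρ x * (𝓕.Phi x u (W x) : ℝ) + σ x * (𝓕.Phi x u (𝓕.raisePhi x (W x)) : ℝ)) := by
    simp only [map_add, map_smul, raise_form]
    rfl
  rw [tractorConnection_tractorSection, tractorConnection_apply, ← Phi_raise]
  exact congrArg (· + _) (𝓕.mvfderiv_tractorConnection_thd_of_parallelAt hσ hμ hρ hW hWx u)

end SmoothComponents

theorem apply_R (x : M) (φ : Cotan E M x) (u v w : Tan E M x) :
    (φ (𝓕.R x u v w) : ℝ) = (φ (𝓕.V x u v w) : ℝ) +
      ((𝓕.Phi x v w : ℝ) * (φ u : ℝ) - (𝓕.Phi x u w : ℝ) * (φ v : ℝ) -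
        (𝓕.form x u w : ℝ) * (𝓕.Phi x v (𝓕.raise x φ) : ℝ) +
        (𝓕.form x v w : ℝ) * (𝓕.Phi x u (𝓕.raise x φ) : ℝ) -
        2 * (𝓕.form x u v : ℝ) * (𝓕.Phi x w (𝓕.raise x φ) : ℝ)) := by
  rw [𝓕.R_eq]
  simp only [map_add, map_sub, map_smul, 𝓕.apply_raise_comm x φ (𝓕.Phi x _), smul_eq_mul]
  ring

theorem gradS_sub_gradS_swap (x : M) (u v : Tan E M x) :
    (𝓕.gradS x u v : ℝ) - (𝓕.gradS x v u : ℝ) - 2 * (𝓕.Phi x u (𝓕.raisePhi x v) : ℝ) =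
      (1 / (2 * (n : ℝ))) * (𝓕.contract x (𝓕.VPhi x u v) - 𝓕.contract x (𝓕.gradYAux x u v)) +
      2 * (𝓕.form x u v : ℝ) *
        ((1 / (2 * (n : ℝ))) * 𝓕.contract x (𝓕.gradS x - 𝓕.PhiPhi x)) := by
  rcases Nat.eq_zero_or_pos n with rfl | hn
  · have subsingleton_model : Subsingleton E :=
      Module.finrank_zero_iff.1 (𝓕.finrank_eq.trans (by simp))
    have : Subsingleton (Tan E M x) := subsingleton_model
    rw [Subsingleton.elim v u]
    simp only [Nat.cast_zero, mul_zero, div_zero, zero_mul, add_zero]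
    linear_combination -𝓕.Phi_raisePhi_skew x u u
  · rw [𝓕.contract_gradYAux]
    field_simp
    ring

section Curvature

variable (hσ : ContMDiff 𝓘(ℝ, E) 𝓘(ℝ, ℝ) ∞ σ) (hμ : SmoothSection 𝓘(ℝ, E) (HomFiber E ℝ) μ)
  (hρ : ContMDiff 𝓘(ℝ, E) 𝓘(ℝ, ℝ) ∞ ρ) (x : M) (u v : Tan E M x)

include hσ hμ hρ

theorem curv_tractorConnection_fst :
    ((𝓕.curv 𝓕.tractorConnection (tractorSection σ μ ρ) x u v).1 : ℝ) =
      2 * (𝓕.form x u v : ℝ) * ρ x := by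
  have hs := smoothSection_tractorSection_iff.2 ⟨hσ, hμ, hρ⟩
  obtain ⟨U, hU, rfl, hUx⟩ := exists_smoothSection_parallelAt 𝓕.conn x u
  obtain ⟨W, hW, rfl, hWx⟩ := exists_smoothSection_parallelAt 𝓕.conn x v
  rw [𝓕.curv_eq_of_parallelAt hs hU hW hUx hWx]
  refine (congrArg₂ (fun a b : ℝ ↦ a - b)
    (𝓕.tractorConnection_tractorConnection_fst_of_parallelAt hσ hμ hW hWx (U x))
    (𝓕.tractorConnection_tractorConnection_fst_of_parallelAt hσ hμ hU hUx (W x))).trans ?_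
  rw [𝓕.mvfderiv_comm_of_parallelAt hσ hU hW hUx hWx, 𝓕.Phi_symm x (U x) (W x),
    𝓕.skew x (W x) (U x)]
  ring

theorem curv_tractorConnection_snd (w : Tan E M x) :
    ((𝓕.curv 𝓕.tractorConnection (tractorSection σ μ ρ) x u v).2.1 w : ℝ) =
      -(μ x (𝓕.V x u v w) : ℝ) + σ x * (𝓕.Y x u v w : ℝ) +
        2 * (𝓕.form x u v : ℝ) * ((𝓕.Phi x (𝓕.raise x (μ x)) w : ℝ) - σ x * (𝓕.S x w : ℝ)) := by
  have hs := smoothSection_tractorSection_iff.2 ⟨hσ, hμ, hρ⟩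
  have curv_μ := 𝓕.curv_cotanConn hμ x u v w
  have apply_R := 𝓕.apply_R x (μ x) u v w
  obtain ⟨U, hU, rfl, hUx⟩ := exists_smoothSection_parallelAt 𝓕.conn x u
  obtain ⟨W, hW, rfl, hWx⟩ := exists_smoothSection_parallelAt 𝓕.conn x v
  rw [𝓕.curv_eq_of_parallelAt hμ hU hW hUx hWx, HomBundle.sub_apply] at curv_μ
  rw [𝓕.curv_eq_of_parallelAt hs hU hW hUx hWx]
  refine (congrArg₂ (fun a b : ℝ ↦ a - b)
    (𝓕.tractorConnection_tractorConnection_snd_of_parallelAt hσ hμ hρ hW hWx (U x) w)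
    (𝓕.tractorConnection_tractorConnection_snd_of_parallelAt hσ hμ hρ hU hUx (W x) w)).trans ?_
  rw [𝓕.Y_eq, 𝓕.Phi_symm x (𝓕.raise x (μ x)) w]
  linear_combination curv_μ - apply_R

theorem curv_tractorConnection_thd :
    ((𝓕.curv 𝓕.tractorConnection (tractorSection σ μ ρ) x u v).2.2 : ℝ) =
      -(𝓕.Y x u v (𝓕.raise x (μ x)) : ℝ) + (1 / (2 * (n : ℝ))) *
          (𝓕.contract x (𝓕.VPhi x u v) - 𝓕.contract x (𝓕.gradYAux x u v)) * σ x +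
        2 * (𝓕.form x u v : ℝ) * ((𝓕.S x (𝓕.raise x (μ x)) : ℝ) +
          (1 / (2 * (n : ℝ))) * 𝓕.contract x (𝓕.gradS x - 𝓕.PhiPhi x) * σ x) := by
  have hs := smoothSection_tractorSection_iff.2 ⟨hσ, hμ, hρ⟩
  have gradS_swap := 𝓕.gradS_sub_gradS_swap x u v
  have Phi_raisePhi_skew := 𝓕.Phi_raisePhi_skew x u v
  obtain ⟨U, hU, rfl, hUx⟩ := exists_smoothSection_parallelAt 𝓕.conn x u
  obtain ⟨W, hW, rfl, hWx⟩ := exists_smoothSection_parallelAt 𝓕.conn x v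
  rw [𝓕.curv_eq_of_parallelAt hs hU hW hUx hWx]
  refine (congrArg₂ (fun a b : ℝ ↦ a - b)
    (𝓕.tractorConnection_tractorConnection_thd_of_parallelAt hσ hμ hρ hW hWx (U x))
    (𝓕.tractorConnection_tractorConnection_thd_of_parallelAt hσ hμ hρ hU hUx (W x))).trans ?_
  rw [𝓕.Y_eq, form_apply_raise, form_apply_raise, 𝓕.mvfderiv_comm_of_parallelAt hρ hU hW hUx hWx,
    𝓕.Phi_symm x (U x) (W x)]
  linear_combination σ x * gradS_swap + σ x * Phi_raisePhi_skew

end Curvature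

theorem curv_tractorConnection {s : Π x, Tractor E M x}
    (hs : SmoothSection 𝓘(ℝ, E) (TractorFiber E) s) (x : M) (u v : Tan E M x) :
    𝓕.curv 𝓕.tractorConnection s x u v =
      𝓕.curvatureVY x u v (s x) + (2 * (𝓕.form x u v : ℝ)) • 𝓕.Theta x (s x) := by
  obtain ⟨σ, μ, ρ, hσ, hμ, hρ, rfl⟩ := exists_eq_tractorSection hs
  refine Prod.ext ?_ (Prod.ext ?_ ?_)
  · exact (𝓕.curv_tractorConnection_fst hσ hμ hρ x u v).trans (zero_add (_ : ℝ)).symm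
  · ext w
    exact 𝓕.curv_tractorConnection_snd hσ hμ hρ x u v w
  · exact 𝓕.curv_tractorConnection_thd hσ hμ hρ x u v

end TractorCurvature

end FedosovStructure

end

theorem mainTheorem6 {E : Type*} [NormedAddCommGroup E] [NormedSpace ℝ E] [FiniteDimensional ℝ E]
    {M : Type*} [TopologicalSpace M] [T2Space M] [ChartedSpace E M] [IsManifold 𝓘(ℝ, E) ∞ M]
    {n : ℕ} (𝓕 : FedosovStructure E M n) :
    (∀ (x : M),
      (∀ s t : FedosovStructure.Tractor E M x, 𝓕.pairing x s t = -𝓕.pairing x t s) ∧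
      (∀ s : FedosovStructure.Tractor E M x, (∀ t, 𝓕.pairing x s t = 0) → s = 0)) ∧
    (∀ s t : Π x, FedosovStructure.Tractor E M x,
      SmoothSection 𝓘(ℝ, E) (FedosovStructure.TractorFiber E) s →
      SmoothSection 𝓘(ℝ, E) (FedosovStructure.TractorFiber E) t →
      ∀ (x : M) (u : Tan E M x),
        mvfderiv 𝓘(ℝ, E) (fun y ↦ 𝓕.pairing y (s y) (t y)) x u =
          𝓕.pairing x (𝓕.tractorConnection s x u) (t x) +
            𝓕.pairing x (s x) (𝓕.tractorConnection t x u)) ∧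
    (∀ s : Π x, FedosovStructure.Tractor E M x,
      SmoothSection 𝓘(ℝ, E) (FedosovStructure.TractorFiber E) s →
      ∀ (x : M) (u v : Tan E M x),
        𝓕.curv 𝓕.tractorConnection s x u v =
          𝓕.curvatureVY x u v (s x) + (2 * (𝓕.form x u v : ℝ)) • 𝓕.Theta x (s x)) :=
  ⟨fun x ↦ ⟨𝓕.pairing_skew x, 𝓕.pairing_nondegenerate x⟩,
    fun _ _ hs ht ↦ 𝓕.mvfderiv_pairing hs ht, fun _ hs ↦ 𝓕.curv_tractorConnection hs⟩
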